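/- **Theorem 2.3.** Let $K=SU(2)$ or $K=SO(3)$, with Lie algebra $\mathfrak k$, and let $\pi:P\to M$ be a smooth principal $K$-bundle (right action $R_k(p)=pk$) with a connection $A$, given by its connection 1-form $\omega_A$. For $X\in\mathfrak k$ let $X^\#$ be the fundamental vector field on $P$. Let $\alpha$ be a smooth $\mathfrak k$-valued 1-form on $P$ which vanishes on vertical vectors, satisfies $R_k^*\alpha=\mathrm{ad}_{k^{-1}}\alpha$ for all $k\in K$, and restricts to an isomorphism $\alpha_p:A_p=\ker(\omega_A)_p\to\mathfrak k$ for every $p\in P$; equivalently, let a bundle isomorphism ${}^\vee\alpha:TM\to\mathrm{ad}(P)=P\times_{\mathrm{ad}}\mathfrak k$, $u\mapsto[p;\alpha_p(\tilde u)]$, be given, where $\tilde u$ is the horizontal lift of $u$ to $p$. Let $J_\alpha$ be the almost complex structure on $P$ with $$J_\alpha(w+X^\#_p)=-\alpha_p^{-1}(X)+(\alpha_p(w))^\#_p\qquad(w\in A_p,\ X\in\mathfrak k).$$ For an $\mathrm{ad}$-invariant inner product $\langle\cdot,\cdot\rangle$ on $\mathfrak k$, let $g_\alpha$ be the Riemannian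 metric on $M$ for which ${}^\vee\alpha$ is an isometry, $\mathrm{ad}(P)$ carrying the metric induced by $\langle\cdot,\cdot\rangle$. Suppose that $J_\alpha$ is integrable, i.e. comes from the structure of a complex manifold on $P$. Then $(M,g_\alpha)$ has constant negative sectional curvature. More precisely: 1. If $K=SU(2)$ and $\langle X,Y\rangle=\mathrm{tr}(XY^*)$ for $X,Y\in\mathfrak{su}(2)$, the sectional curvature of $(M,g_\alpha)$ is $-2$. 2. If $K=SO(3)$ and $\langle\cdot,\cdot\rangle$ is the inner product $\mathrm{tr}(XY^*)$ of $\mathfrak{su}(2)$ transported to $\mathfrak{so}(3)$ by a Lie algebra isomorphism $\mathfrak{so}(3)\cong\mathfrak{su}(2)$, the sectional curvature of $(M,g_\alpha)$ is $-2$. 3. If $K=SO(3)$ and $\langle X,Y\rangle=\mathrm{tr}(XY^*)$ for the real skew-symmetric $3\times3$ matrices $X,Y\in\mathfrak{so}(3)$, the sectional curvature of $(M,g_\alpha)$ is $-\tfrac12$. -/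

import Mathlib

open scoped Matrix.Norms.Frobenius Manifold ContDiff Matrix

set_option linter.unusedSectionVars false
set_option linter.style.longLine false

noncomputable section

section CayleyCharts

/-- The Cayley transform `a ↦ (1 - a) (1 + a)⁻¹`, an involution where `1 + a` is invertible. -/
def cayley {A : Type*} [Ring A] (a : A) : A := (1 - a) * Ring.inverse (1 + a)

section algebra
variable {A : Type*} [Ring A]

theorem cayley_mul {a : A} (h : IsUnit (1 + a)) : cayley a * (1 + a) = 1 - a := by
  rw [cayley, mul_assoc, Ring.inverse_mul_cancel _ h, mul_one]

theorem cayley_commute {a : A} (h : IsUnit (1 + a)) : Commute (1 + a) (cayley a) := by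
  obtain ⟨u, hu⟩ := h
  have h1 : Commute (1 + a) (1 - a) := by
    simp only [Commute, SemiconjBy]; noncomm_ring
  have h2 : Commute (1 + a) (Ring.inverse (1 + a)) := by
    rw [← hu, Ring.inverse_unit]; simp [Commute, SemiconjBy]
  exact h1.mul_right h2

theorem one_add_cayley_mul {a : A} (h : IsUnit (1 + a)) : (1 + cayley a) * (1 + a) = 2 := by
  rw [add_mul, cayley_mul h, one_mul, add_add_sub_cancel, one_add_one_eq_two]

theorem isUnit_one_add_cayley {a : A} (h2 : IsUnit (2 : A)) (h : IsUnit (1 + a)) :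
    IsUnit (1 + cayley a) := by
  rw [← one_add_cayley_mul h] at h2
  obtain ⟨u, hu⟩ := h
  rw [← hu] at h2
  simpa using h2

theorem cayley_cayley {a : A} (h2 : IsUnit (2 : A)) (h : IsUnit (1 + a)) :
    cayley (cayley a) = a := by
  have hu := isUnit_one_add_cayley h2 h
  have h1 := cayley_mul hu
  apply hu.mul_right_cancel
  rw [h1]
  apply h.mul_right_cancel
  have e1 := cayley_mul h
  have e2 : a * cayley a = cayley a * a := by
    have := (cayley_commute h).eq
    rw [add_mul, mul_add, one_mul, mul_one] at this
    exact add_left_cancel this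
  have e3 : (1 - cayley a) * (1 + a) = 2 * a := by
    rw [sub_mul, e1]; noncomm_ring
  have e4 : a * (1 + cayley a) * (1 + a) = a * 2 := by
    rw [mul_assoc, one_add_cayley_mul h]
  rw [e3, e4]; noncomm_ring

theorem star_cayley_of_unitary [StarRing A] {a : A} (h : IsUnit (1 + a)) (ha : a * star a = 1) :
    star (cayley a) = -cayley a := by
  apply h.mul_left_cancel
  have e := congrArg star (cayley_mul h)
  simp only [star_mul, star_add, star_sub, star_one] at e
  have e2 : (1 + a) * star (cayley a) = a * ((1 + star a) * star (cayley a)) := by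
    rw [← mul_assoc, mul_add, ha, mul_one, add_comm]
  rw [e2, e, mul_sub, ha, mul_one, mul_neg, (cayley_commute h).eq, cayley_mul h, neg_sub]

theorem cayley_unitary_of_skew [StarRing A] {x : A} (h : IsUnit (1 + x)) (hx : star x = -x) :
    cayley x * star (cayley x) = 1 := by
  have h' : IsUnit (1 - x) := by
    have := h.star
    rwa [star_add, star_one, hx, ← sub_eq_add_neg] at this
  have e := congrArg star (cayley_mul h)
  simp only [star_mul, star_add, star_sub, star_one, hx, sub_neg_eq_add, ← sub_eq_add_neg] at e
  apply h'.mul_left_cancel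
  have c : (1 - x) * cayley x = cayley x * (1 - x) := by
    have := (cayley_commute h).eq
    rw [add_mul, mul_add, one_mul, mul_one] at this
    rw [sub_mul, mul_sub, one_mul, mul_one, add_left_cancel this]
  rw [← mul_assoc, c, mul_assoc, e, cayley_mul h, mul_one]

end algebra

variable {A : Type*} [NormedRing A] [NormedAlgebra ℝ A] [CompleteSpace A]

theorem contDiffAt_cayley {a : A} (h : IsUnit (1 + a)) : ContDiffAt ℝ ∞ (cayley : A → A) a := by
  obtain ⟨u, hu⟩ := h
  have h1 : ContDiffAt ℝ ∞ (Ring.inverse : A → A) (1 + a) := hu ▸ contDiffAt_ringInverse ℝ u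
  exact (contDiffAt_const.sub contDiffAt_id).mul
    (h1.comp a (contDiffAt_const.add contDiffAt_id))

theorem isOpen_isUnit_one_add : IsOpen {a : A | IsUnit (1 + a)} :=
  Units.isOpen.preimage (continuous_const.add continuous_id)

/-- A topological group `G` embedded in the algebra `A` by `ι`, and a linear subspace `𝔤` of `A`,
such that the Cayley transform exchanges `ι(G)` and `𝔤` (away from the elements `a` with `1 + a`
singular). -/
structure IsCayleyPair {G : Type*} [Group G] [TopologicalSpace G] (ι : G →* A)
    (𝔤 : Submodule ℝ A) : Prop where
  injective : Function.Injective ι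
  isInducing : Topology.IsInducing ι
  mem_algebra : ∀ g, IsUnit (1 + ι g) → cayley (ι g) ∈ 𝔤
  mem_group : ∀ x ∈ 𝔤, IsUnit (1 + x) → cayley x ∈ Set.range ι

theorem isUnit_two_of_real : IsUnit (2 : A) := by
  have h := (isUnit_iff_ne_zero.2 (two_ne_zero (α := ℝ))).map (algebraMap ℝ A)
  rwa [map_ofNat] at h

/-- The differential at `1` of a map `f` from a Lie group to a vector space. -/
def derivAtOne {E K A : Type*} [NormedAddCommGroup E] [NormedSpace ℝ E] [TopologicalSpace K]
    [ChartedSpace E K] [Group K] [NormedAddCommGroup A] [NormedSpace ℝ A] (f : K → A)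
    (X : GroupLieAlgebra 𝓘(ℝ, E) K) : A :=
  mfderiv 𝓘(ℝ, E) 𝓘(ℝ, A) f 1 X

theorem hasFDerivAt_cayley_zero : HasFDerivAt (𝕜 := ℝ) (cayley : A → A)
    ((-2 : ℝ) • ContinuousLinearMap.id ℝ A) 0 := by
  have h1 : HasFDerivAt (𝕜 := ℝ) (fun a : A ↦ 1 - a) (-ContinuousLinearMap.id ℝ A) 0 :=
    (hasFDerivAt_id (0 : A)).const_sub 1
  have h2 : HasFDerivAt (𝕜 := ℝ) (fun a : A ↦ 1 + a) (ContinuousLinearMap.id ℝ A) 0 :=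
    (hasFDerivAt_id (0 : A)).const_add 1
  have h3 := hasFDerivAt_ringInverse (𝕜 := ℝ) (1 : Aˣ)
  have h4 : HasFDerivAt (𝕜 := ℝ) (fun a : A ↦ Ring.inverse (1 + a)) _ 0 :=
    HasFDerivAt.comp (g := Ring.inverse) (0 : A) (by simpa using h3) h2
  refine (h1.mul' h4).congr_fderiv ?_
  ext v
  simp
  rw [two_smul, neg_add]

namespace IsCayleyPair

variable {G : Type*} [Group G] [TopologicalSpace G] {ι : G →* A} {𝔤 : Submodule ℝ A}

theorem map_invFun (hS : IsCayleyPair ι 𝔤) {x : A} (hx : x ∈ 𝔤) (h : IsUnit (1 + x)) :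
    ι (Function.invFun ι (cayley x)) = cayley x :=
  Function.invFun_eq (hS.mem_group x hx h)

theorem continuous_map_mul (hS : IsCayleyPair ι 𝔤) (a : G) : Continuous fun g : G ↦ ι (a * g) := by
  simp only [map_mul]
  exact continuous_const.mul hS.isInducing.continuous

theorem map_inv_eq (a : G) : ι a⁻¹ = Ring.inverse (ι a) := by
  let u : Aˣ := ⟨ι a, ι a⁻¹, by simp [← map_mul], by simp [← map_mul]⟩
  exact (Ring.inverse_unit u).symm

open Classical in
/-- The Cayley chart `g ↦ cayley (g₀⁻¹ g)` around the element `g₀`, with inverse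
`x ↦ g₀ (cayley x)`. -/
def chart (hS : IsCayleyPair ι 𝔤) (g₀ : G) : OpenPartialHomeomorph G 𝔤 where
  toFun g := if h : IsUnit (1 + ι (g₀⁻¹ * g)) then
    ⟨cayley (ι (g₀⁻¹ * g)), hS.mem_algebra _ h⟩ else 0
  invFun x := g₀ * Function.invFun ι (cayley (x : A))
  source := {g | IsUnit (1 + ι (g₀⁻¹ * g))}
  target := {x | IsUnit (1 + (x : A))}
  map_source' g hg := by
    replace hg : IsUnit (1 + ι (g₀⁻¹ * g)) := hg
    change IsUnit _
    rw [dif_pos hg]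
    exact isUnit_one_add_cayley isUnit_two_of_real hg
  map_target' x hx := by
    replace hx : IsUnit (1 + (x : A)) := hx
    change IsUnit _
    rw [inv_mul_cancel_left, hS.map_invFun x.2 hx]
    exact isUnit_one_add_cayley isUnit_two_of_real hx
  left_inv' g hg := by
    replace hg : IsUnit (1 + ι (g₀⁻¹ * g)) := hg
    rw [dif_pos hg]
    dsimp only
    rw [cayley_cayley isUnit_two_of_real hg, Function.leftInverse_invFun hS.injective,
      mul_inv_cancel_left]
  right_inv' x hx := by
    replace hx : IsUnit (1 + (x : A)) := hx
    have e : ι (g₀⁻¹ * (g₀ * Function.invFun ι (cayley (x : A)))) = cayley (x : A) := by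
      rw [inv_mul_cancel_left, hS.map_invFun x.2 hx]
    rw [dif_pos (by rw [e]; exact isUnit_one_add_cayley isUnit_two_of_real hx)]
    apply Subtype.ext
    dsimp only
    rw [e, cayley_cayley isUnit_two_of_real hx]
  open_source := isOpen_isUnit_one_add.preimage (hS.continuous_map_mul g₀⁻¹)
  open_target := isOpen_isUnit_one_add.preimage continuous_subtype_val
  continuousOn_toFun := by
    rw [Topology.IsInducing.subtypeVal.continuousOn_iff]
    refine ContinuousOn.congr (f := fun g : G ↦ cayley (ι (g₀⁻¹ * g))) (fun g hg ↦ ?_)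
      fun g hg ↦ ?_
    · exact ((contDiffAt_cayley hg).continuousAt.comp (f := fun g : G ↦ ι (g₀⁻¹ * g))
        (hS.continuous_map_mul g₀⁻¹).continuousAt).continuousWithinAt
    · simp only [Function.comp, dif_pos (show IsUnit _ from hg)]
  continuousOn_invFun := by
    rw [hS.isInducing.continuousOn_iff]
    refine ContinuousOn.congr (f := fun x : 𝔤 ↦ ι g₀ * cayley (x : A)) (fun x hx ↦ ?_)
      fun x hx ↦ ?_
    · exact (continuousAt_const.mul ((contDiffAt_cayley hx).continuousAt.comp
        (f := fun x : 𝔤 ↦ (x : A)) continuous_subtype_val.continuousAt)).continuousWithinAt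
    · simp only [Function.comp, map_mul, hS.map_invFun x.2 hx]

open Classical in
theorem coe_chart (hS : IsCayleyPair ι 𝔤) {g₀ g : G} (h : IsUnit (1 + ι (g₀⁻¹ * g))) :
    (hS.chart g₀ g : A) = cayley (ι (g₀⁻¹ * g)) := by
  change ((if h : IsUnit (1 + ι (g₀⁻¹ * g)) then
    ⟨cayley (ι (g₀⁻¹ * g)), hS.mem_algebra _ h⟩ else 0 : 𝔤) : A) = _
  rw [dif_pos h]

theorem map_chart_symm (hS : IsCayleyPair ι 𝔤) {g₀ : G} {x : 𝔤} (h : IsUnit (1 + (x : A))) :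
    ι ((hS.chart g₀).symm x) = ι g₀ * cayley (x : A) := by
  change ι (g₀ * Function.invFun ι (cayley (x : A))) = _
  rw [map_mul, hS.map_invFun x.2 h]

theorem mem_chart_source (hS : IsCayleyPair ι 𝔤) (g : G) : g ∈ (hS.chart g).source := by
  change IsUnit (1 + ι (g⁻¹ * g))
  rw [inv_mul_cancel, map_one, one_add_one_eq_two]
  exact isUnit_two_of_real

/-- The manifold structure given by the Cayley charts. -/
@[reducible] def chartedSpace (hS : IsCayleyPair ι 𝔤) : ChartedSpace 𝔤 G where
  atlas := Set.range hS.chart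
  chartAt := hS.chart
  mem_chart_source := hS.mem_chart_source
  chart_mem_atlas g := ⟨g, rfl⟩

/-- A map into a subspace is smooth if it is smooth as a map into the ambient space. -/
theorem contDiffAt_of_coe [FiniteDimensional ℝ A] {E : Type*} [NormedAddCommGroup E]
    [NormedSpace ℝ E] {f : E → 𝔤} {x : E} (h : ContDiffAt ℝ ∞ (fun y ↦ (f y : A)) x) :
    ContDiffAt ℝ ∞ f x := by
  obtain ⟨p, hp⟩ := 𝔤.subtype.exists_leftInverse_of_injective (by simp)
  have : f = fun y ↦ p.toContinuousLinearMap (f y : A) := by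
    funext y; exact (LinearMap.congr_fun hp (f y)).symm
  rw [this]
  exact p.toContinuousLinearMap.contDiff.contDiffAt.comp x h

variable [FiniteDimensional ℝ A]

theorem isManifold (hS : IsCayleyPair ι 𝔤) : letI := hS.chartedSpace; IsManifold 𝓘(ℝ, 𝔤) ∞ G := by
  let _ := hS.chartedSpace
  apply isManifold_of_contDiffOn
  rintro _ _ ⟨a, rfl⟩ ⟨b, rfl⟩ x ⟨hx, -⟩
  refine ContDiffAt.contDiffWithinAt ?_
  have hx1 : IsUnit (1 + (x : A)) := hx.1
  have hx2 : IsUnit (1 + ι (b⁻¹ * (hS.chart a).symm x)) := hx.2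
  apply contDiffAt_of_coe
  have hopen := ((hS.chart a).symm ≫ₕ (hS.chart b)).open_source.mem_nhds hx
  refine ContDiffAt.congr_of_eventuallyEq
    (f := fun y : 𝔤 ↦ cayley (ι b⁻¹ * (ι a * cayley (y : A)))) ?_ ?_
  · rw [map_mul, hS.map_chart_symm hx1] at hx2
    exact (contDiffAt_cayley hx2).comp x (contDiffAt_const.mul (contDiffAt_const.mul
      ((contDiffAt_cayley hx1).comp x 𝔤.subtypeL.contDiff.contDiffAt)))
  · filter_upwards [hopen] with y hy
    have hy1 : IsUnit (1 + (y : A)) := hy.1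
    have hy2 : IsUnit (1 + ι (b⁻¹ * (hS.chart a).symm y)) := hy.2
    change (hS.chart b ((hS.chart a).symm y) : A) = _
    rw [hS.coe_chart hy2, map_mul, hS.map_chart_symm hy1]

theorem contMDiff_map (hS : IsCayleyPair ι 𝔤) : letI := hS.chartedSpace; ContMDiff 𝓘(ℝ, 𝔤) 𝓘(ℝ, A) ∞ ι := by
  let _ := hS.chartedSpace
  have := hS.isManifold
  intro g
  have hg := hS.mem_chart_source g
  refine ContMDiffAt.congr_of_eventuallyEq
    (f := (fun x : 𝔤 ↦ ι g * cayley (x : A)) ∘ hS.chart g) ?_ ?_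
  · refine ContMDiffAt.comp g (I' := 𝓘(ℝ, 𝔤)) ?_ ?_
    · refine ContDiffAt.contMDiffAt (contDiffAt_const.mul
        (ContDiffAt.comp _ (contDiffAt_cayley ?_) 𝔤.subtypeL.contDiff.contDiffAt))
      exact (hS.chart g).map_source hg
    · exact contMDiffOn_chart.contMDiffAt ((hS.chart g).open_source.mem_nhds hg)
  · filter_upwards [(hS.chart g).open_source.mem_nhds hg] with y hy
    have := hS.map_chart_symm (g₀ := g) ((hS.chart g).map_source hy)
    rwa [(hS.chart g).left_inv hy] at this

theorem contMDiff_of_map (hS : IsCayleyPair ι 𝔤) {E H N : Type*} [NormedAddCommGroup E] [NormedSpace ℝ E]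
    [TopologicalSpace H] {I : ModelWithCorners ℝ E H} [TopologicalSpace N] [ChartedSpace H N]
    {f : N → G} (h : ContMDiff I 𝓘(ℝ, A) ∞ fun y ↦ ι (f y)) :
    letI := hS.chartedSpace; ContMDiff I 𝓘(ℝ, 𝔤) ∞ f := by
  let _ := hS.chartedSpace
  obtain ⟨p, hp⟩ := 𝔤.subtype.exists_leftInverse_of_injective (by simp)
  have hf : Continuous f := hS.isInducing.continuous_iff.2 h.continuous
  intro x
  rw [contMDiffAt_iff_target]
  refine ⟨hf.continuousAt, ?_⟩
  have hx := hS.mem_chart_source (f x)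
  refine ContMDiffAt.congr_of_eventuallyEq
    (f := p.toContinuousLinearMap ∘ (fun z : A ↦ cayley (ι (f x)⁻¹ * z)) ∘ fun y ↦ ι (f y)) ?_ ?_
  · refine p.toContinuousLinearMap.contMDiff.contMDiffAt.comp x ?_
    refine ContMDiffAt.comp (I' := 𝓘(ℝ, A)) x (ContDiffAt.contMDiffAt ?_) (h x)
    have hx : IsUnit (1 + ι ((f x)⁻¹ * f x)) := hx
    rw [map_mul] at hx
    exact (contDiffAt_cayley hx).comp _ (contDiffAt_const.mul contDiffAt_id)
  · filter_upwards [hf.continuousAt ((hS.chart (f x)).open_source.mem_nhds hx)] with y hy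
    change hS.chart (f x) (f y) = p (cayley (ι (f x)⁻¹ * ι (f y)))
    rw [← map_mul, ← hS.coe_chart hy]
    exact (LinearMap.congr_fun hp _).symm

theorem lieGroup (hS : IsCayleyPair ι 𝔤) : letI := hS.chartedSpace; LieGroup 𝓘(ℝ, 𝔤) ∞ G := by
  let _ := hS.chartedSpace
  have := hS.isManifold
  have hc := hS.contMDiff_map
  refine { contMDiff_mul := hS.contMDiff_of_map ?_, contMDiff_inv := hS.contMDiff_of_map ?_ }
  · simp only [map_mul]
    intro q
    have h1 : ContMDiffAt (𝓘(ℝ, 𝔤).prod 𝓘(ℝ, 𝔤)) 𝓘(ℝ, A) ∞ (fun q : G × G ↦ ι q.1) q :=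
      (hc.comp contMDiff_fst) q
    have h2 : ContMDiffAt (𝓘(ℝ, 𝔤).prod 𝓘(ℝ, 𝔤)) 𝓘(ℝ, A) ∞ (fun q : G × G ↦ ι q.2) q :=
      (hc.comp contMDiff_snd) q
    have hm : ContDiff ℝ ∞ fun z : A × A ↦ z.1 * z.2 := contDiff_mul
    exact hm.contMDiff.contMDiffAt.comp q (h1.prodMk_space h2)
  · simp only [map_inv_eq]
    intro g
    let u : Aˣ := ⟨ι g, ι g⁻¹, by simp [← map_mul], by simp [← map_mul]⟩
    exact (contDiffAt_ringInverse ℝ u).contMDiffAt.comp g (hc g)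

/-- In the Cayley chart at `1` the differential of the embedding `ι` is `X ↦ -2 X`. -/
theorem derivAtOne_map (hS : IsCayleyPair ι 𝔤) (X : 𝔤) :
    letI := hS.chartedSpace; derivAtOne (E := 𝔤) (K := G) ι X = (-2 : ℝ) • (X : A) := by
  let _ := hS.chartedSpace
  have h : MDifferentiableAt 𝓘(ℝ, 𝔤) 𝓘(ℝ, A) ι 1 :=
    (hS.contMDiff_map 1).mdifferentiableAt (by simp)
  have h0 : hS.chart 1 1 = 0 := by
    apply Subtype.ext
    rw [hS.coe_chart (hS.mem_chart_source 1)]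
    simp [cayley]
  have h1 : (0 : 𝔤) ∈ (hS.chart 1).target := by
    rw [← h0]; exact (hS.chart 1).map_source (hS.mem_chart_source 1)
  have key : HasFDerivAt (fun x : 𝔤 ↦ cayley (x : A)) ((-2 : ℝ) • 𝔤.subtypeL) 0 :=
    (HasFDerivAt.comp (g := (cayley : A → A)) (0 : 𝔤) (by simpa using hasFDerivAt_cayley_zero)
      𝔤.subtypeL.hasFDerivAt).congr_fderiv (by ext; simp)
  have e : writtenInExtChartAt 𝓘(ℝ, 𝔤) 𝓘(ℝ, A) (1 : G) ι =ᶠ[nhds 0]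
      fun x : 𝔤 ↦ cayley (x : A) := by
    filter_upwards [(hS.chart 1).open_target.mem_nhds h1] with x hx
    have := hS.map_chart_symm (g₀ := 1) (x := x) hx
    rw [map_one, one_mul] at this
    exact this
  have e2 : extChartAt 𝓘(ℝ, 𝔤) (1 : G) 1 = 0 := h0
  unfold derivAtOne
  rw [h.mfderiv, show Set.range 𝓘(ℝ, 𝔤) = Set.univ by simp, fderivWithin_univ, e2,
    (key.congr_of_eventuallyEq e).fderiv]
  rfl

end IsCayleyPair

end CayleyCharts

section SpecialUnitary

/-- The real Lie algebra `𝔰𝔲(n)` of traceless skew-Hermitian matrices; over `𝕜 = ℝ` this is the Lie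
algebra `𝔰𝔬(n)` of skew-symmetric matrices. -/
def specialUnitaryAlgebra (n : ℕ) (𝕜 : Type*) [RCLike 𝕜] :
    Submodule ℝ (Matrix (Fin n) (Fin n) 𝕜) where
  carrier := {X | Xᴴ = -X ∧ X.trace = 0}
  zero_mem' := by simp
  add_mem' := by
    rintro X Y ⟨hX, hX'⟩ ⟨hY, hY'⟩
    exact ⟨by rw [Matrix.conjTranspose_add, hX, hY, neg_add], by simp [hX', hY']⟩
  smul_mem' := by
    rintro c X ⟨hX, hX'⟩
    exact ⟨by rw [Matrix.conjTranspose_smul, hX]; simp, by simp [hX']⟩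

/-- The Lie group `SU(2)`. -/
abbrev SU2 : Type := Matrix.specialUnitaryGroup (Fin 2) ℂ

/-- The Lie group `SO(3)`. -/
abbrev SO3 : Type := Matrix.specialOrthogonalGroup (Fin 3) ℝ

theorem isCayleyPair_SU2 : IsCayleyPair (Matrix.specialUnitaryGroup (Fin 2) ℂ).subtype
    (specialUnitaryAlgebra 2 ℂ) where
  injective := Subtype.val_injective
  isInducing := Topology.IsInducing.subtypeVal
  mem_algebra := by
    rintro ⟨g, hg⟩ h
    obtain ⟨h1, h2⟩ := Matrix.mem_specialUnitaryGroup_iff.1 hg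
    replace h : IsUnit (1 + g) := h
    refine ⟨star_cayley_of_unitary h (Matrix.mem_unitaryGroup_iff.1 h1), ?_⟩
    change (cayley g).trace = 0
    rw [cayley, ← Matrix.nonsing_inv_eq_ringInverse, Matrix.inv_def, Matrix.mul_smul,
      Matrix.trace_smul]
    convert smul_zero _
    rw [Matrix.det_fin_two] at h2
    simp [Matrix.adjugate_fin_two, Matrix.trace_fin_two, Matrix.mul_apply]
    linear_combination -2 * h2
  mem_group := by
    rintro x ⟨hx, hx'⟩ h
    have hu := cayley_unitary_of_skew h hx
    refine ⟨⟨cayley x, Matrix.mem_specialUnitaryGroup_iff.2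
      ⟨Matrix.mem_unitaryGroup_iff.2 hu, ?_⟩⟩, rfl⟩
    have e := congrArg Matrix.det (cayley_mul h)
    have hd := (Matrix.isUnit_iff_isUnit_det _).1 h
    rw [Matrix.det_mul] at e
    apply hd.mul_right_cancel
    rw [e, one_mul]
    rw [Matrix.trace_fin_two] at hx'
    simp [Matrix.det_fin_two]
    linear_combination -2 * hx'

theorem isCayleyPair_SO3 : IsCayleyPair (Matrix.specialOrthogonalGroup (Fin 3) ℝ).subtype
    (specialUnitaryAlgebra 3 ℝ) where
  injective := Subtype.val_injective
  isInducing := Topology.IsInducing.subtypeVal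
  mem_algebra := by
    rintro ⟨g, hg⟩ h
    obtain ⟨h1, h2⟩ := Matrix.mem_specialOrthogonalGroup_iff.1 hg
    replace h : IsUnit (1 + g) := h
    have h3 : g * star g = 1 := by
      rw [Matrix.star_eq_conjTranspose, Matrix.conjTranspose_eq_transpose_of_trivial]
      exact (Matrix.mem_orthogonalGroup_iff (Fin 3) ℝ).1 h1
    have hs : (cayley g)ᴴ = -cayley g := star_cayley_of_unitary h h3
    refine ⟨hs, ?_⟩
    change (cayley g).trace = 0
    have := congrArg Matrix.trace hs
    rw [Matrix.conjTranspose_eq_transpose_of_trivial, Matrix.trace_transpose,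
      Matrix.trace_neg] at this
    linarith
  mem_group := by
    rintro x ⟨hx, -⟩ h
    have hu := cayley_unitary_of_skew h hx
    rw [Matrix.star_eq_conjTranspose, Matrix.conjTranspose_eq_transpose_of_trivial] at hu
    refine ⟨⟨cayley x, Matrix.mem_specialOrthogonalGroup_iff.2
      ⟨(Matrix.mem_orthogonalGroup_iff (Fin 3) ℝ).2 hu, ?_⟩⟩, rfl⟩
    have e := congrArg Matrix.det (cayley_mul h)
    have hd := (Matrix.isUnit_iff_isUnit_det _).1 h
    rw [Matrix.det_mul] at e
    apply hd.mul_right_cancel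
    rw [e, one_mul, ← Matrix.det_transpose (1 + x), Matrix.transpose_add, Matrix.transpose_one,
      ← Matrix.conjTranspose_eq_transpose_of_trivial x, hx, sub_eq_add_neg]

/-- The model space of the manifold `SU(2)`: the space `𝔰𝔲(2)`, normed by the Frobenius norm. -/
def SU2Model : Type := specialUnitaryAlgebra 2 ℂ

instance : NormedAddCommGroup SU2Model := inferInstanceAs (NormedAddCommGroup (specialUnitaryAlgebra 2 ℂ))
instance : NormedSpace ℝ SU2Model := inferInstanceAs (NormedSpace ℝ (specialUnitaryAlgebra 2 ℂ))
instance : ChartedSpace SU2Model SU2 := isCayleyPair_SU2.chartedSpace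
instance : LieGroup 𝓘(ℝ, SU2Model) ∞ SU2 := isCayleyPair_SU2.lieGroup

/-- The model space of the manifold `SO(3)`: the space `𝔰𝔬(3)`, normed by the Frobenius norm. -/
def SO3Model : Type := specialUnitaryAlgebra 3 ℝ

instance : NormedAddCommGroup SO3Model := inferInstanceAs (NormedAddCommGroup (specialUnitaryAlgebra 3 ℝ))
instance : NormedSpace ℝ SO3Model := inferInstanceAs (NormedSpace ℝ (specialUnitaryAlgebra 3 ℝ))
instance : ChartedSpace SO3Model SO3 := isCayleyPair_SO3.chartedSpace
instance : LieGroup 𝓘(ℝ, SO3Model) ∞ SO3 := isCayleyPair_SO3.lieGroup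

end SpecialUnitary

section Bundles

variable {E_K : Type*} [NormedAddCommGroup E_K] [NormedSpace ℝ E_K]
  {K : Type*} [TopologicalSpace K] [ChartedSpace E_K K] [Group K]
  {E_P : Type*} [NormedAddCommGroup E_P] [NormedSpace ℝ E_P]
  {P : Type*} [TopologicalSpace P] [ChartedSpace E_P P] [IsManifold 𝓘(ℝ, E_P) ∞ P]
  {E_M : Type*} [NormedAddCommGroup E_M] [NormedSpace ℝ E_M]
  {M : Type*} [TopologicalSpace M] [ChartedSpace E_M M] [IsManifold 𝓘(ℝ, E_M) ∞ M]

variable (E_K K E_P P E_M M) in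
/-- A smooth principal `K`-bundle `π : P → M` with its right action `(p, k) ↦ p k`. -/
structure SmoothPrincipalBundle where
  /-- the projection `π : P → M` -/
  proj : P → M
  /-- the right action of the structure group on the total space -/
  act : P → K → P
  contMDiff_proj : ContMDiff 𝓘(ℝ, E_P) 𝓘(ℝ, E_M) ∞ proj
  contMDiff_act : ContMDiff (𝓘(ℝ, E_P).prod 𝓘(ℝ, E_K)) 𝓘(ℝ, E_P) ∞ fun q : P × K ↦ act q.1 q.2
  act_one : ∀ p, act p 1 = p
  act_mul : ∀ p a b, act (act p a) b = act p (a * b)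
  proj_act : ∀ p k, proj (act p k) = proj p
  /-- equivariant local trivializations `π⁻¹(U) ≃ U × K` -/
  exists_trivialization : ∀ x : M, ∃ (U : Set M) (e : OpenPartialHomeomorph P (M × K)),
    IsOpen U ∧ x ∈ U ∧ e.source = proj ⁻¹' U ∧ e.target = U ×ˢ Set.univ ∧
    ContMDiffOn 𝓘(ℝ, E_P) (𝓘(ℝ, E_M).prod 𝓘(ℝ, E_K)) ∞ e e.source ∧
    ContMDiffOn (𝓘(ℝ, E_M).prod 𝓘(ℝ, E_K)) 𝓘(ℝ, E_P) ∞ e.symm e.target ∧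
    (∀ p ∈ e.source, (e p).1 = proj p) ∧
    ∀ p ∈ e.source, ∀ k, (e (act p k)).2 = (e p).2 * k

/-- The adjoint action `ad_k : 𝔨 → 𝔨` of `k ∈ K`, the derivative of `h ↦ k h k⁻¹` at `1`. -/
def adjointAction (k : K) (X : GroupLieAlgebra 𝓘(ℝ, E_K) K) : GroupLieAlgebra 𝓘(ℝ, E_K) K :=
  mfderiv 𝓘(ℝ, E_K) 𝓘(ℝ, E_K) (fun h : K ↦ k * h * k⁻¹) 1 X

namespace SmoothPrincipalBundle

variable (Q : SmoothPrincipalBundle E_K K E_P P E_M M)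

/-- The differential `π_* : T_p P → T_{π p} M` of the projection. -/
def dproj (p : P) : TangentSpace 𝓘(ℝ, E_P) p →L[ℝ] TangentSpace 𝓘(ℝ, E_M) (Q.proj p) :=
  mfderiv 𝓘(ℝ, E_P) 𝓘(ℝ, E_M) Q.proj p

/-- The value `X^#_p` at `p` of the fundamental vector field of `X ∈ 𝔨`: the derivative of
`k ↦ p k` at `k = 1` in direction `X`. -/
def fundamental (p : P) : GroupLieAlgebra 𝓘(ℝ, E_K) K →L[ℝ] TangentSpace 𝓘(ℝ, E_P) p :=
  mfderiv 𝓘(ℝ, E_K) 𝓘(ℝ, E_P) (fun k : K ↦ Q.act p k) 1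

/-- The differential `(R_k)_* : T_p P → T_{pk} P` of the right translation by `k`. -/
def rightTranslation (k : K) (p : P) :
    TangentSpace 𝓘(ℝ, E_P) p →L[ℝ] TangentSpace 𝓘(ℝ, E_P) (Q.act p k) :=
  mfderiv 𝓘(ℝ, E_P) 𝓘(ℝ, E_P) (fun q : P ↦ Q.act q k) p

/-- A connection `A`, given by its connection 1-form `ω_A`. -/
structure Connection where
  /-- the connection form `ω_A` -/
  form : ∀ p : P, TangentSpace 𝓘(ℝ, E_P) p →L[ℝ] GroupLieAlgebra 𝓘(ℝ, E_K) K
  contMDiff_form : ContMDiff (M' := E_K) 𝓘(ℝ, E_P).tangent 𝓘(ℝ, E_K) ∞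
    fun v : TangentBundle 𝓘(ℝ, E_P) P ↦ form v.1 v.2
  form_fundamental : ∀ p X, form p (Q.fundamental p X) = X
  form_rightTranslation : ∀ k p v,
    form (Q.act p k) (Q.rightTranslation k p v) = adjointAction k⁻¹ (form p v)

variable {Q}

/-- A tensorial 1-form `α` of type `ad` with values in `𝔨` which restricts to an isomorphism from
the horizontal space `A_p = ker ω_A` onto `𝔨` for each `p`; equivalently, a bundle
isomorphism `TM → ad(P)`. -/
structure TensorialIso (A : Q.Connection) where
  /-- the form `α` -/
  form : ∀ p : P, TangentSpace 𝓘(ℝ, E_P) p →L[ℝ] GroupLieAlgebra 𝓘(ℝ, E_K) K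
  contMDiff_form : ContMDiff (M' := E_K) 𝓘(ℝ, E_P).tangent 𝓘(ℝ, E_K) ∞
    fun v : TangentBundle 𝓘(ℝ, E_P) P ↦ form v.1 v.2
  form_vertical : ∀ p v, Q.dproj p v = 0 → form p v = 0
  form_rightTranslation : ∀ k p v,
    form (Q.act p k) (Q.rightTranslation k p v) = adjointAction k⁻¹ (form p v)
  existsUnique_horizontal : ∀ p X, ∃! w, A.form p w = 0 ∧ form p w = X

variable {A : Q.Connection}

/-- The inverse `α_p⁻¹ : 𝔨 → A_p ⊆ T_p P`. -/
def TensorialIso.inv (α : TensorialIso A) (p : P) (X : GroupLieAlgebra 𝓘(ℝ, E_K) K) :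
    TangentSpace 𝓘(ℝ, E_P) p :=
  (α.existsUnique_horizontal p X).choose

/-- The almost complex structure `J_α` on `P`: it maps `w + X^#`, with `w` horizontal, to
`-α⁻¹(X) + (α(w))^#`. -/
def TensorialIso.almostComplex (α : TensorialIso A) (p : P) (v : TangentSpace 𝓘(ℝ, E_P) p) :
    TangentSpace 𝓘(ℝ, E_P) p :=
  Q.fundamental p (α.form p v) - α.inv p (A.form p v)

theorem proj_surjective (Q : SmoothPrincipalBundle E_K K E_P P E_M M) :
    Function.Surjective Q.proj := by
  intro x
  obtain ⟨U, e, -, hx, hs, ht, -, -, h1, -⟩ := Q.exists_trivialization x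
  have hm : (x, (1 : K)) ∈ e.target := by rw [ht]; exact ⟨hx, trivial⟩
  refine ⟨e.symm (x, 1), ?_⟩
  rw [← h1 _ (e.map_target hm), e.right_inv hm]

theorem dproj_surjective (Q : SmoothPrincipalBundle E_K K E_P P E_M M) (p : P) :
    Function.Surjective (Q.dproj p) := by
  obtain ⟨U, e, hU, hx, hs, ht, -, h2, h1, -⟩ := Q.exists_trivialization (Q.proj p)
  have hp : p ∈ e.source := by rw [hs]; exact hx
  have hep : e p = (Q.proj p, (e p).2) := Prod.ext (h1 p hp) rfl
  have hm : (Q.proj p, (e p).2) ∈ e.target := by rw [ht]; exact ⟨hx, trivial⟩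
  let s : M → P := fun y ↦ e.symm (y, (e p).2)
  have hsp : s (Q.proj p) = p := by
    change e.symm (Q.proj p, (e p).2) = p
    rw [← hep, e.left_inv hp]
  have hsd : MDifferentiableAt 𝓘(ℝ, E_M) 𝓘(ℝ, E_P) s (Q.proj p) := by
    refine ContMDiffAt.mdifferentiableAt (n := ∞) ?_ (by simp)
    have h3 := h2.contMDiffAt (e.open_target.mem_nhds hm)
    exact h3.comp (Q.proj p) (contMDiffAt_id.prodMk contMDiffAt_const)
  have hpd : MDifferentiableAt 𝓘(ℝ, E_P) 𝓘(ℝ, E_M) Q.proj (s (Q.proj p)) :=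
    (Q.contMDiff_proj _).mdifferentiableAt (by simp)
  have hid : (Q.proj ∘ s) =ᶠ[nhds (Q.proj p)] id := by
    filter_upwards [hU.mem_nhds hx] with y hy
    have hy' : (y, (e p).2) ∈ e.target := by rw [ht]; exact ⟨hy, trivial⟩
    change Q.proj (e.symm (y, (e p).2)) = y
    rw [← h1 _ (e.map_target hy'), e.right_inv hy']
  have hc := mfderiv_comp (Q.proj p) hpd hsd
  rw [hid.mfderiv_eq, mfderiv_id] at hc
  intro u
  refine ⟨(mfderiv 𝓘(ℝ, E_M) 𝓘(ℝ, E_P) s (Q.proj p) : E_M →L[ℝ] E_P) u, ?_⟩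
  have h4 : (mfderiv 𝓘(ℝ, E_P) 𝓘(ℝ, E_M) Q.proj (s (Q.proj p)) : E_P →L[ℝ] E_M) = Q.dproj p := by
    rw [hsp]; rfl
  have h5 := DFunLike.congr_fun hc u
  exact (DFunLike.congr_fun h4 _).symm.trans h5.symm

theorem dproj_fundamental (Q : SmoothPrincipalBundle E_K K E_P P E_M M) (p : P)
    (X : GroupLieAlgebra 𝓘(ℝ, E_K) K) : Q.dproj p (Q.fundamental p X) = 0 := by
  have hpd : MDifferentiableAt 𝓘(ℝ, E_P) 𝓘(ℝ, E_M) Q.proj (Q.act p 1) :=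
    (Q.contMDiff_proj _).mdifferentiableAt (by simp)
  have had : MDifferentiableAt 𝓘(ℝ, E_K) 𝓘(ℝ, E_P) (fun k ↦ Q.act p k) (1 : K) :=
    (Q.contMDiff_act.comp (contMDiff_const.prodMk contMDiff_id) (1 : K)).mdifferentiableAt
      (by simp)
  have hc := mfderiv_comp (1 : K) hpd had
  have hconst : (Q.proj ∘ fun k ↦ Q.act p k) = fun _ ↦ Q.proj p := by
    funext k; exact Q.proj_act p k
  rw [hconst, mfderiv_const] at hc
  have h4 : (mfderiv 𝓘(ℝ, E_P) 𝓘(ℝ, E_M) Q.proj (Q.act p 1) : E_P →L[ℝ] E_M) = Q.dproj p := by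
    rw [Q.act_one]; rfl
  exact (DFunLike.congr_fun h4 _).symm.trans (DFunLike.congr_fun hc X).symm

theorem exists_horizontalLift (A : Q.Connection) (p : P)
    (u : TangentSpace 𝓘(ℝ, E_M) (Q.proj p)) :
    ∃ w : TangentSpace 𝓘(ℝ, E_P) p, A.form p w = 0 ∧ Q.dproj p w = u := by
  obtain ⟨w, hw⟩ := Q.dproj_surjective p u
  refine ⟨w - Q.fundamental p (A.form p w), ?_, ?_⟩
  · rw [map_sub, A.form_fundamental, sub_self]
  · rw [map_sub, Q.dproj_fundamental, hw, sub_zero]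

/-- The horizontal lift to `p` of a tangent vector of `M` at `π p`. -/
def Connection.horizontalLift (A : Q.Connection) (p : P)
    (u : TangentSpace 𝓘(ℝ, E_M) (Q.proj p)) : TangentSpace 𝓘(ℝ, E_P) p :=
  (exists_horizontalLift A p u).choose

/-- The metric `g_α` on `M` induced by `α` and an inner product `B` on `𝔨`. The
isomorphism `TM → ad(P)` given by `α` is `u ↦ [p; α_p(ũ)]`, where `ũ` is the horizontal
lift of `u` to a point `p` of the fibre, and the metric of `ad(P)` is
`⟨[p; X], [p; Y]⟩ = B(X, Y)`. -/
def TensorialIso.inducedMetric (α : TensorialIso A)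
    (B : GroupLieAlgebra 𝓘(ℝ, E_K) K → GroupLieAlgebra 𝓘(ℝ, E_K) K → ℝ)
    (x : M) (u v : TangentSpace 𝓘(ℝ, E_M) x) : ℝ :=
  let p := (Q.proj_surjective x).choose
  B (α.form p (A.horizontalLift p u)) (α.form p (A.horizontalLift p v))

end SmoothPrincipalBundle

/-- An almost complex structure `J` on `P` is integrable if it comes from the structure of a
complex manifold: around each point there are smooth charts with values in `ℂⁿ` whose differential
turns `J` into multiplication by `i`. (The transition maps of such charts are holomorphic.) -/
def IsIntegrable (J : ∀ p : P, TangentSpace 𝓘(ℝ, E_P) p → TangentSpace 𝓘(ℝ, E_P) p) : Prop :=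
  ∃ n : ℕ, ∀ p : P, ∃ φ : OpenPartialHomeomorph P (EuclideanSpace ℂ (Fin n)),
    p ∈ φ.source ∧
    ContMDiffOn 𝓘(ℝ, E_P) 𝓘(ℝ, EuclideanSpace ℂ (Fin n)) ∞ φ φ.source ∧
    ContMDiffOn 𝓘(ℝ, EuclideanSpace ℂ (Fin n)) 𝓘(ℝ, E_P) ∞ φ.symm φ.target ∧
    ∀ q ∈ φ.source, ∀ v : TangentSpace 𝓘(ℝ, E_P) q,
      let dφ : TangentSpace 𝓘(ℝ, E_P) q →L[ℝ] EuclideanSpace ℂ (Fin n) :=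
        mfderiv 𝓘(ℝ, E_P) 𝓘(ℝ, EuclideanSpace ℂ (Fin n)) φ q
      dφ (J q v) = Complex.I • dφ v

end Bundles

section Curvature

variable {E : Type*} [NormedAddCommGroup E] [NormedSpace ℝ E] [FiniteDimensional ℝ E]
  {M : Type*} [TopologicalSpace M] [ChartedSpace E M] [IsManifold 𝓘(ℝ, E) ∞ M]

/-- `∇` is the Levi-Civita connection of the metric `g`: it is smooth, torsion-free and compatible
with `g`. -/
structure IsLeviCivita
    (g : ∀ x : M, TangentSpace 𝓘(ℝ, E) x → TangentSpace 𝓘(ℝ, E) x → ℝ)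
    (D : CovariantDerivative 𝓘(ℝ, E) E (TangentSpace 𝓘(ℝ, E) : M → Type _)) : Prop where
  smooth : D.ContMDiffCovariantDerivative ∞
  torsion_eq_zero : D.torsion = 0
  metric : ∀ (Y Z : ∀ x : M, TangentSpace 𝓘(ℝ, E) x),
    ContMDiff 𝓘(ℝ, E) 𝓘(ℝ, E).tangent ∞ (fun x ↦ (⟨x, Y x⟩ : TangentBundle 𝓘(ℝ, E) M)) →
    ContMDiff 𝓘(ℝ, E) 𝓘(ℝ, E).tangent ∞ (fun x ↦ (⟨x, Z x⟩ : TangentBundle 𝓘(ℝ, E) M)) →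
    ∀ (x : M) (v : TangentSpace 𝓘(ℝ, E) x),
      (mfderiv 𝓘(ℝ, E) 𝓘(ℝ, ℝ) (fun y ↦ g y (Y y) (Z y)) x v : ℝ) =
        g x (D Y x v) (Z x) + g x (Y x) (D Z x v)

/-- The curvature `R(X, Y)Z = ∇_X ∇_Y Z - ∇_Y ∇_X Z - ∇_{[X, Y]} Z`. -/
def curvature (D : CovariantDerivative 𝓘(ℝ, E) E (TangentSpace 𝓘(ℝ, E) : M → Type _))
    (X Y Z : ∀ x : M, TangentSpace 𝓘(ℝ, E) x) (x : M) : TangentSpace 𝓘(ℝ, E) x :=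
  D (fun y ↦ D Z y (Y y)) x (X x) - D (fun y ↦ D Z y (X y)) x (Y x) -
    D Z x (VectorField.mlieBracket 𝓘(ℝ, E) X Y x)

/-- `(M, g)` has constant sectional curvature `κ`: with respect to the Levi-Civita connection, the
sectional curvature `g(R(X, Y)Y, X) / (g(X, X) g(Y, Y) - g(X, Y)²)` of each tangent plane is `κ`. -/
def HasConstantSectionalCurvature
    (g : ∀ x : M, TangentSpace 𝓘(ℝ, E) x → TangentSpace 𝓘(ℝ, E) x → ℝ) (κ : ℝ) : Prop :=
  ∃ D : CovariantDerivative 𝓘(ℝ, E) E (TangentSpace 𝓘(ℝ, E) : M → Type _),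
    IsLeviCivita g D ∧
    ∀ (X Y : ∀ x : M, TangentSpace 𝓘(ℝ, E) x),
      ContMDiff 𝓘(ℝ, E) 𝓘(ℝ, E).tangent ∞ (fun x ↦ (⟨x, X x⟩ : TangentBundle 𝓘(ℝ, E) M)) →
      ContMDiff 𝓘(ℝ, E) 𝓘(ℝ, E).tangent ∞ (fun x ↦ (⟨x, Y x⟩ : TangentBundle 𝓘(ℝ, E) M)) →
      ∀ x : M, LinearIndependent ℝ ![X x, Y x] →
        g x (curvature D X Y Y x) (X x) /
          (g x (X x) (X x) * g x (Y x) (Y x) - g x (X x) (Y x) ^ 2) = κ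

end Curvature

section TraceForms

/-- The inner product `⟨X, Y⟩ = Re tr(X Y*)` of square matrices; on skew-Hermitian matrices it is
`-tr(X Y)`. -/
def traceInner {n : ℕ} {𝕜 : Type*} [RCLike 𝕜] (X Y : Matrix (Fin n) (Fin n) 𝕜) : ℝ :=
  RCLike.re (X * Yᴴ).trace

/-- The identification of the Lie algebra of `SU(2)` with the matrices in `𝔰𝔲(2)`, by means of the
differential of the inclusion of `SU(2)` into the matrices. -/
def SU2.toMatrix (X : GroupLieAlgebra 𝓘(ℝ, SU2Model) SU2) : Matrix (Fin 2) (Fin 2) ℂ :=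
  derivAtOne (fun k : SU2 ↦ (k : Matrix (Fin 2) (Fin 2) ℂ)) X

/-- The identification of the Lie algebra of `SO(3)` with the matrices in `𝔰𝔬(3)`, by means of the
differential of the inclusion of `SO(3)` into the matrices. -/
def SO3.toMatrix (X : GroupLieAlgebra 𝓘(ℝ, SO3Model) SO3) : Matrix (Fin 3) (Fin 3) ℝ :=
  derivAtOne (fun k : SO3 ↦ (k : Matrix (Fin 3) (Fin 3) ℝ)) X

theorem SU2.toMatrix_eq (X : specialUnitaryAlgebra 2 ℂ) :
    SU2.toMatrix (show SU2Model from X) = (-2 : ℝ) • (X : Matrix (Fin 2) (Fin 2) ℂ) :=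
  isCayleyPair_SU2.derivAtOne_map X

theorem SO3.toMatrix_eq (X : specialUnitaryAlgebra 3 ℝ) :
    SO3.toMatrix (show SO3Model from X) = (-2 : ℝ) • (X : Matrix (Fin 3) (Fin 3) ℝ) :=
  isCayleyPair_SO3.derivAtOne_map X

/-- The Lie algebra isomorphism `𝔰𝔬(3) ≅ 𝔰𝔲(2)` which maps the cross product matrix of
`x ∈ ℝ³` to `-(i/2) (x₁ σ₁ + x₂ σ₂ + x₃ σ₃)`, where `σ₁, σ₂, σ₃` are the Pauli matrices. -/
def so3ToSu2 (X : Matrix (Fin 3) (Fin 3) ℝ) : Matrix (Fin 2) (Fin 2) ℂ :=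
  (-Complex.I / 2) • ((X 2 1 : ℂ) • !![0, 1; 1, 0] + (X 0 2 : ℂ) • !![0, -Complex.I; Complex.I, 0]
    + (X 1 0 : ℂ) • !![1, 0; 0, -1])

theorem so3ToSu2_lie {X Y : Matrix (Fin 3) (Fin 3) ℝ} (hX : X ∈ specialUnitaryAlgebra 3 ℝ)
    (hY : Y ∈ specialUnitaryAlgebra 3 ℝ) :
    so3ToSu2 (X * Y - Y * X) = so3ToSu2 X * so3ToSu2 Y - so3ToSu2 Y * so3ToSu2 X := by
  have hX' (i j) : X j i = -X i j := by simpa using congrFun (congrFun hX.1 i) j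
  have hY' (i j) : Y j i = -Y i j := by simpa using congrFun (congrFun hY.1 i) j
  have hX0 (i) : X i i = 0 := by linarith [hX' i i]
  have hY0 (i) : Y i i = 0 := by linarith [hY' i i]
  ext i j
  fin_cases i <;> fin_cases j <;>
  · simp [so3ToSu2, Matrix.mul_apply, Fin.sum_univ_succ, hX0, hY0, hX' 0 1, hX' 0 2, hX' 1 2,
      hY' 0 1, hY' 0 2, hY' 1 2]
    ring_nf
    simp [Complex.I_sq, Complex.I_pow_three]
    try ring

/-- The trace inner product on the Lie algebra of `SU(2)`. -/
def SU2.traceForm (X Y : GroupLieAlgebra 𝓘(ℝ, SU2Model) SU2) : ℝ :=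
  traceInner (SU2.toMatrix X) (SU2.toMatrix Y)

/-- The trace inner product of `𝔰𝔲(2)`, transported to the Lie algebra of `SO(3)` by the isomorphism
`𝔰𝔬(3) ≅ 𝔰𝔲(2)`. -/
def SO3.su2TraceForm (X Y : GroupLieAlgebra 𝓘(ℝ, SO3Model) SO3) : ℝ :=
  traceInner (so3ToSu2 (SO3.toMatrix X)) (so3ToSu2 (SO3.toMatrix Y))

/-- The trace inner product of real `3 × 3` matrices on the Lie algebra of `SO(3)`. -/
def SO3.traceForm (X Y : GroupLieAlgebra 𝓘(ℝ, SO3Model) SO3) : ℝ :=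
  traceInner (SO3.toMatrix X) (SO3.toMatrix Y)

end TraceForms


end

open scoped Matrix.Norms.Frobenius Manifold ContDiff Matrix

/-! Write `ω` for the connection form. By definition of `J_α`, `ω ∘ J = α`, hence `α ∘ J = -ω`, so
`ω - iα` is a `𝔨 ⊗ ℂ`-valued form of type (1,0). In holomorphic charts the exterior derivative of
such a form has no (0,2) part (`extd_type`, `mextd_of_isIntegrable`). Equivariance determines the
contractions with fundamental fields: `dω(X^#, ·) = -[X, ω]` and `dα(X^#, ·) = -[X, α]`
(`mextd_vert`). For horizontal `u`, `v` the vectors `Ju`, `Jv` are vertical, so the vanishing of the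
(0,2) part gives `dω(u, v) = [α u, α v]` and `dα(u, v) = 0`. In other words `F_A = [α, α] / 2` and
`d_A α = 0` (`structure_equations`).

Geometrically, transport `A` to a covariant derivative on `TM` by the isomorphism `TM ≅ ad(P)`. It
is metric because the inner product is `ad`-invariant and torsion-free because `d_A α = 0`, so it is
the Levi-Civita connection of `g_α`. Its curvature is `ad(F_A)`, that is `R(X, Y)Z = [[X, Y], Z]`
(`sec_curvature`). The numerator of the sectional curvature is therefore `⟨[[X, Y], Y], X⟩ = -|[X,
Y]|²`, and on a three-dimensional algebra of cross-product type this is a constant multiple of the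
Gram determinant. The constant is computed with matrices in `𝔰𝔲(2)` (`traceInner_commutator_su2`);
the two forms on `𝔰𝔬(3)` differ by a factor 4, which gives the other values.

A vector field `Y` is handled through the equivariant function `sec Y : P → 𝔨`, and local
computations are pulled back to the model space of `M` by a local section of `P`. There the
covariant derivative becomes `s ↦ X s + [a(X), s]` (`gaugeDeriv`). The bracket is an abstract
bilinear map subject to `IsAdBracket`, realized at the end by matrix commutators. -/

noncomputable section

/-! ### Exterior derivatives and gauge covariant derivatives on a normed space. -/

section ExteriorDerivative

variable {V W F G : Type*} [NormedAddCommGroup V] [NormedSpace ℝ V] [NormedAddCommGroup W]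
  [NormedSpace ℝ W] [NormedAddCommGroup F] [NormedSpace ℝ F] [NormedAddCommGroup G]
  [NormedSpace ℝ G]

/-- The exterior derivative `dθ(u, v) = (D_u θ)(v) - (D_v θ)(u)` of a vector valued 1-form `θ` on a
normed space. -/
def extd (θ : V → V →L[ℝ] F) (x u v : V) : F := fderiv ℝ θ x u v - fderiv ℝ θ x v u

theorem extd_congr {θ θ' : V → V →L[ℝ] F} {x : V} (h : θ =ᶠ[nhds x] θ') (u v : V) :
    extd θ x u v = extd θ' x u v := by
  rw [extd, extd, h.fderiv_eq]

/-- Differentiating `θ (f y) ∘ Df(y)` produces an extra term `θ (D²f(u, v))`, which the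
antisymmetrization removes because the second derivative is symmetric; this is why `f` must be of
class `C²`. -/
theorem extd_comp {θ : W → W →L[ℝ] F} {f : V → W} {x : V} (hθ : DifferentiableAt ℝ θ (f x))
    (hf : ContDiffAt ℝ 2 f x) (u v : V) :
    extd (fun y ↦ (θ (f y)).comp (fderiv ℝ f y)) x u v =
      extd θ (f x) (fderiv ℝ f x u) (fderiv ℝ f x v) := by
  have h1 : HasFDerivAt (fun y ↦ θ (f y)) _ x :=
    hθ.hasFDerivAt.comp x (hf.differentiableAt (by simp)).hasFDerivAt
  have h2 : HasFDerivAt (fderiv ℝ f) _ x :=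
    ((hf.fderiv_right (m := 1) (by norm_num)).differentiableAt (by simp)).hasFDerivAt
  have h3 := h1.clm_comp h2
  have hs := hf.isSymmSndFDerivAt (by simp) u v
  simp only [extd, h3.fderiv]
  simp [hs]

theorem fderiv_apply_field {θ : V → V →L[ℝ] F} {X : V → V} {x : V} (hθ : DifferentiableAt ℝ θ x)
    (hX : DifferentiableAt ℝ X x) (u : V) :
    fderiv ℝ (fun y ↦ θ y (X y)) x u = fderiv ℝ θ x u (X x) + θ x (fderiv ℝ X x u) := by
  rw [(hθ.hasFDerivAt.clm_apply hX.hasFDerivAt).fderiv]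
  simp [add_comm]

/-- `X (θ Y) - Y (θ X) - θ [X, Y] = dθ(X, Y)`. -/
theorem extd_fields {θ : V → V →L[ℝ] F} {X Y : V → V} {x : V} (hθ : DifferentiableAt ℝ θ x)
    (hX : DifferentiableAt ℝ X x) (hY : DifferentiableAt ℝ Y x) :
    fderiv ℝ (fun y ↦ θ y (Y y)) x (X x) - fderiv ℝ (fun y ↦ θ y (X y)) x (Y x) -
      θ x (VectorField.lieBracket ℝ X Y x) = extd θ x (X x) (Y x) := by
  rw [fderiv_apply_field hθ hX, fderiv_apply_field hθ hY, VectorField.lieBracket, extd, map_sub]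
  abel

/-- The covariant derivative in direction of the vector field `X`, `s ↦ X s + [a(X), s]`, on
functions with values in a Lie algebra which is given by a connection form `a`. -/
def gaugeDeriv (br : G →L[ℝ] G →L[ℝ] G) (a : V → V →L[ℝ] G) (X : V → V) (s : V → G) (x : V) : G :=
  fderiv ℝ s x (X x) + br (a x (X x)) (s x)

theorem gaugeDeriv_congr {br : G →L[ℝ] G →L[ℝ] G} {a : V → V →L[ℝ] G} {X : V → V} {s s' : V → G}
    {x : V} (h : s =ᶠ[nhds x] s') : gaugeDeriv br a X s x = gaugeDeriv br a X s' x := by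
  rw [gaugeDeriv, gaugeDeriv, h.fderiv_eq, h.self_of_nhds]

theorem fderiv_gaugeDeriv {br : G →L[ℝ] G →L[ℝ] G} {a : V → V →L[ℝ] G} {X : V → V} {s : V → G}
    {x : V} (ha : DifferentiableAt ℝ a x) (hs : ContDiffAt ℝ 2 s x) (hX : DifferentiableAt ℝ X x)
    (u : V) :
    fderiv ℝ (gaugeDeriv br a X s) x u = fderiv ℝ (fderiv ℝ s) x u (X x) +
      fderiv ℝ s x (fderiv ℝ X x u) + br (fderiv ℝ a x u (X x)) (s x) +
      br (a x (fderiv ℝ X x u)) (s x) + br (a x (X x)) (fderiv ℝ s x u) := by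
  have h1 : DifferentiableAt ℝ (fderiv ℝ s) x :=
    (hs.fderiv_right (m := 1) (by norm_num)).differentiableAt (by simp)
  have h2 := h1.hasFDerivAt.clm_apply hX.hasFDerivAt
  have h3 := ha.hasFDerivAt.clm_apply hX.hasFDerivAt
  have h4 := (br.hasFDerivAt.comp x h3).clm_apply (hs.differentiableAt (by simp)).hasFDerivAt
  have h5 : HasFDerivAt (gaugeDeriv br a X s) _ x := h2.add h4
  rw [h5.fderiv]
  simp
  abel

/-- The curvature of the connection form `a` is `da + [a, a] / 2`, acting by the bracket. Second
derivatives of `s` cancel by symmetry, derivatives of `X` and `Y` are absorbed by their Lie bracket,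
and the Jacobi identity combines the two double brackets. -/
theorem gaugeDeriv_curvature {br : G →L[ℝ] G →L[ℝ] G}
    (jacobi : ∀ x y z, br x (br y z) - br y (br x z) = br (br x y) z)
    {a : V → V →L[ℝ] G} {X Y : V → V} {s : V → G}
    {x : V} (ha : DifferentiableAt ℝ a x) (hs : ContDiffAt ℝ 2 s x) (hX : DifferentiableAt ℝ X x)
    (hY : DifferentiableAt ℝ Y x) :
    gaugeDeriv br a X (gaugeDeriv br a Y s) x - gaugeDeriv br a Y (gaugeDeriv br a X s) x -
      gaugeDeriv br a (VectorField.lieBracket ℝ X Y) s x =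
    br (extd a x (X x) (Y x) + br (a x (X x)) (a x (Y x))) (s x) := by
  have hsym := hs.isSymmSndFDerivAt (by simp) (X x) (Y x)
  have hj := jacobi (a x (X x)) (a x (Y x)) (s x)
  change fderiv ℝ (gaugeDeriv br a Y s) x (X x) + br (a x (X x)) (gaugeDeriv br a Y s x) -
    (fderiv ℝ (gaugeDeriv br a X s) x (Y x) + br (a x (Y x)) (gaugeDeriv br a X s x)) - _ = _
  rw [fderiv_gaugeDeriv ha hs hX, fderiv_gaugeDeriv ha hs hY, hsym]
  simp only [gaugeDeriv, VectorField.lieBracket, extd, map_sub, map_add,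
    add_apply, sub_apply]
  rw [← hj]
  abel

end ExteriorDerivative

/-! ### Vector valued 1-forms on manifolds and naturality of `d`. -/

section ManifoldForms

variable {V W F E : Type*} [NormedAddCommGroup V] [NormedSpace ℝ V] [NormedAddCommGroup W]
  [NormedSpace ℝ W] [NormedAddCommGroup F] [NormedSpace ℝ F] [NormedAddCommGroup E]
  [NormedSpace ℝ E] {N : Type*} [TopologicalSpace N] [ChartedSpace E N]

theorem two_le_infty : (2 : ℕ∞ω) ≤ ∞ := WithTop.coe_le_coe.2 (le_top : (2 : ℕ∞) ≤ ⊤)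

/-- The differential of a map from a normed space to a manifold, in terms of the model space. -/
def mdiff (f : V → N) (y : V) : V →L[ℝ] E := mfderiv 𝓘(ℝ, V) 𝓘(ℝ, E) f y

/-- The differential of the preferred chart at `p`. -/
def dchart (p q : N) : E →L[ℝ] E := mfderiv 𝓘(ℝ, E) 𝓘(ℝ, E) (extChartAt 𝓘(ℝ, E) p) q

/-- The pullback of a 1-form `θ` on a manifold by a map `f` defined on a normed space. -/
def mpull (f : V → N) (θ : N → E →L[ℝ] F) (y : V) : V →L[ℝ] F := (θ (f y)).comp (mdiff f y)

/-- The exterior derivative of a 1-form on a manifold. -/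
def mextd (θ : N → E →L[ℝ] F) (p : N) (u v : E) : F :=
  extd (mpull (extChartAt 𝓘(ℝ, E) p).symm θ) (extChartAt 𝓘(ℝ, E) p p) (dchart p p u) (dchart p p v)

variable [IsManifold 𝓘(ℝ, E) ∞ N]

/-- Smoothness of a vector valued 1-form on a manifold. -/
def SmoothForm (θ : N → E →L[ℝ] F) : Prop :=
  ContMDiff (M' := F) 𝓘(ℝ, E).tangent 𝓘(ℝ, F) ∞ fun v : TangentBundle 𝓘(ℝ, E) N ↦ θ v.1 v.2

/-- Smoothness of a form means smoothness on the tangent bundle. Composing with the tangent map of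
`f` along a constant field `v` gives smoothness of `(f^* θ)(v)`; since `V` is finite-dimensional,
this for all `v` is smoothness as a map into `V →L[ℝ] F`. -/
theorem SmoothForm.contDiffOn_mpull [FiniteDimensional ℝ V] {θ : N → E →L[ℝ] F}
    (hθ : SmoothForm θ) {f : V → N} {s : Set V} (hs : IsOpen s)
    (hf : ContMDiffOn 𝓘(ℝ, V) 𝓘(ℝ, E) ∞ f s) : ContDiffOn ℝ ∞ (mpull f θ) s := by
  rw [contDiffOn_clm_apply]
  intro v
  have h1 := hf.contMDiffOn_tangentMapWithin (m := ∞) (by simp) hs.uniqueMDiffOn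
  have h2 : ContMDiffOn 𝓘(ℝ, V) 𝓘(ℝ, V).tangent ∞
      (fun y : V ↦ (⟨y, v⟩ : TangentBundle 𝓘(ℝ, V) V)) s := by
    exact contMDiffOn_vectorSpace_iff_contDiffOn.2 contDiffOn_const
  have h3 := (hθ.comp_contMDiffOn (h1.comp h2 (fun y hy ↦ hy))).contDiffOn
  refine h3.congr fun y hy ↦ ?_
  simp only [Function.comp, tangentMapWithin, mfderivWithin_of_isOpen hs hy]
  rfl

/-- Naturality `d(f^* θ) = f^*(dθ)`. It frees `mextd` from the chart used to define it, so that `dθ`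
can be computed from any convenient parametrization: a holomorphic chart, the group action, or a
local section. -/
theorem mextd_mpull [FiniteDimensional ℝ E] {θ : N → E →L[ℝ] F}
    (hθ : SmoothForm θ) {f : V → N} {s : Set V} (hs : IsOpen s)
    (hf : ContMDiffOn 𝓘(ℝ, V) 𝓘(ℝ, E) ∞ f s) {x : V} (hxs : x ∈ s) (u v : V) :
    extd (mpull f θ) x u v = mextd θ (f x) (mdiff f x u) (mdiff f x v) := by
  set ψ := extChartAt 𝓘(ℝ, E) (f x) with hψ
  have hψs : ψ.source ∈ nhds (f x) := extChartAt_source_mem_nhds (f x)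
  have hso : IsOpen ψ.source := isOpen_extChartAt_source (f x)
  have hto : IsOpen ψ.target := isOpen_extChartAt_target (f x)
  let g : V → E := ψ ∘ f
  have hev : ∀ᶠ y in nhds x, ContMDiffAt 𝓘(ℝ, V) 𝓘(ℝ, E) 2 f y ∧ f y ∈ ψ.source :=
    Filter.Eventually.and (Filter.eventually_of_mem (hs.mem_nhds hxs) fun y hy ↦
      (hf.contMDiffAt (hs.mem_nhds hy)).of_le two_le_infty)
      ((hf.contMDiffAt (hs.mem_nhds hxs)).continuousAt hψs)
  have hψd : ∀ q ∈ ψ.source, ContMDiffAt 𝓘(ℝ, E) 𝓘(ℝ, E) ∞ ψ q := fun q hq ↦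
    contMDiffAt_extChartAt' (by simpa [hψ] using hq)
  have hψi : ContMDiffOn 𝓘(ℝ, E) 𝓘(ℝ, E) ∞ ψ.symm ψ.target := contMDiffOn_extChartAt_symm _
  have hg : ContDiffAt ℝ 2 g x := by
    rw [← contMDiffAt_iff_contDiffAt]
    exact ((hψd _ (mem_of_mem_nhds hψs)).of_le two_le_infty).comp x hev.self_of_nhds.1
  have key : ∀ y, ContMDiffAt 𝓘(ℝ, V) 𝓘(ℝ, E) 2 f y → f y ∈ ψ.source →
      fderiv ℝ g y = (dchart (f x) (f y)).comp (mdiff f y) := by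
    intro y hy1 hy2
    rw [← mfderiv_eq_fderiv]
    exact mfderiv_comp y ((hψd _ hy2).mdifferentiableAt (by simp)) (hy1.mdifferentiableAt (by simp))
  -- With `g = ψ ∘ f` one has `f^* θ = g^* (ψ⁻¹)^* θ` near `x`, a pullback between normed spaces, to
  -- which `extd_comp` applies.
  have key2 : ∀ y, ContMDiffAt 𝓘(ℝ, V) 𝓘(ℝ, E) 2 f y → f y ∈ ψ.source →
      (mdiff f y : V →L[ℝ] E) = (mdiff ψ.symm (g y) : E →L[ℝ] E).comp (fderiv ℝ g y) := by
    intro y hy1 hy2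
    have h1 : MDifferentiableAt 𝓘(ℝ, E) 𝓘(ℝ, E) ψ.symm (g y) :=
      ((hψi.contMDiffAt (hto.mem_nhds (ψ.map_source hy2)))).mdifferentiableAt (by simp)
    have h2 : MDifferentiableAt 𝓘(ℝ, V) 𝓘(ℝ, E) g y :=
      ((hψd _ hy2).mdifferentiableAt (by simp)).comp y (hy1.mdifferentiableAt (by simp))
    have h3 := mfderiv_comp y h1 h2
    have h4 : ψ.symm ∘ g =ᶠ[nhds y] f := by
      filter_upwards [hy1.continuousAt (hso.mem_nhds hy2)] with z hz
      exact ψ.left_inv hz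
    rw [h4.mfderiv_eq, mfderiv_eq_fderiv] at h3
    exact h3
  have hx := hev.self_of_nhds
  have e1 : mpull f θ =ᶠ[nhds x] fun y ↦ (mpull ψ.symm θ (g y)).comp (fderiv ℝ g y) := by
    filter_upwards [hev] with y hy
    have : ψ.symm (g y) = f y := ψ.left_inv hy.2
    rw [mpull, mpull, key2 y hy.1 hy.2, this]
    rfl
  have hd : DifferentiableAt ℝ (mpull ψ.symm θ) (g x) :=
    ((hθ.contDiffOn_mpull hto hψi).contDiffAt
      (hto.mem_nhds (ψ.map_source hx.2))).differentiableAt (by simp)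
  rw [extd_congr e1, extd_comp hd hg, key x hx.1 hx.2, mextd]
  rfl

theorem mextd_swap (θ : N → E →L[ℝ] F) (p : N) (u v : E) : mextd θ p u v = -mextd θ p v u := by
  simp [mextd, extd]

theorem mextd_add_left (θ : N → E →L[ℝ] F) (p : N) (u u' v : E) :
    mextd θ p (u + u') v = mextd θ p u v + mextd θ p u' v := by
  simp [mextd, extd]; abel

theorem mextd_add_right (θ : N → E →L[ℝ] F) (p : N) (u v v' : E) :
    mextd θ p u (v + v') = mextd θ p u v + mextd θ p u v' := by
  simp [mextd, extd]; abel

end ManifoldForms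

/-! ### Consequences of integrability for forms of type (1,0). -/

section Integrability

/-- If the `F ⊗ ℂ`-valued form `w - i a` on a complex vector space is of type `(1, 0)`, its
exterior derivative has no component of type `(0, 2)`. -/
theorem extd_type {V F : Type*} [NormedAddCommGroup V] [NormedSpace ℂ V] [NormedAddCommGroup F]
    [NormedSpace ℝ F] {w a : V → V →L[ℝ] F} {z : V} (hw : DifferentiableAt ℝ w z)
    (h : ∀ᶠ y in nhds z, ∀ v, a y v = w y (Complex.I • v)) (u v : V) :
    extd w z u v = extd w z (Complex.I • u) (Complex.I • v) - extd a z (Complex.I • u) v -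
      extd a z u (Complex.I • v) ∧
    extd a z u v = extd a z (Complex.I • u) (Complex.I • v) + extd w z (Complex.I • u) v +
      extd w z u (Complex.I • v) := by
  let T : V →L[ℝ] V := Complex.I • ContinuousLinearMap.id ℝ V
  have hT : ∀ v, T v = Complex.I • v := fun v ↦ rfl
  have ha : a =ᶠ[nhds z] fun y ↦ (w y).comp T := by
    filter_upwards [h] with y hy
    ext v
    exact hy v
  -- Near `z` the form `a` is `w` composed with the constant map `T`, so every derivative of `a` is
  -- one of `w`. The two identities, the real and imaginary parts of the vanishing of the (0,2)
  -- component, then reduce to `i² = -1`.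
  have hd : ∀ u v, fderiv ℝ a z u v = fderiv ℝ w z u (Complex.I • v) := by
    intro u v
    rw [ha.fderiv_eq, (hw.hasFDerivAt.clm_comp (hasFDerivAt_const T z)).fderiv]
    simp [hT]
  have hI : ∀ v : V, Complex.I • Complex.I • v = -v := fun v ↦ by
    rw [smul_smul, Complex.I_mul_I, neg_one_smul]
  simp only [extd, hd, hI, map_neg]
  constructor <;> abel

variable {E_P : Type*} [NormedAddCommGroup E_P] [NormedSpace ℝ E_P] [FiniteDimensional ℝ E_P]
  {P : Type*} [TopologicalSpace P] [ChartedSpace E_P P] [IsManifold 𝓘(ℝ, E_P) ∞ P]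
  {F : Type*} [NormedAddCommGroup F] [NormedSpace ℝ F]

/-- Both forms are pulled back by the inverse of a holomorphic chart, whose differential intertwines
multiplication by `i` with `J`; there `extd_type` applies. The companion relation `α ∘ J = -w` need
not be assumed, since it follows from `i² = -1` in the chart. -/
theorem mextd_of_isIntegrable
    {J : P → E_P → E_P} (hJ : IsIntegrable (P := P) (E_P := E_P) J)
    {w α : P → E_P →L[ℝ] F} (hw : SmoothForm w) (hα : SmoothForm α)
    (h1 : ∀ (p : P) (v : E_P), w p (J p v) = α p v)
    (p : P) (u v : E_P) :
    mextd w p u v = mextd w p (J p u) (J p v) - mextd α p (J p u) v - mextd α p u (J p v) ∧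
    mextd α p u v = mextd α p (J p u) (J p v) + mextd w p (J p u) v + mextd w p u (J p v) := by
  obtain ⟨n, hn⟩ := hJ
  obtain ⟨φ, hp, hφ, hφs, hd⟩ := hn p
  have hz : φ p ∈ φ.target := φ.map_source hp
  have hinv : φ.symm (φ p) = p := φ.left_inv hp
  let dφ (q : P) : E_P →L[ℝ] EuclideanSpace ℂ (Fin n) :=
    mfderiv 𝓘(ℝ, E_P) 𝓘(ℝ, EuclideanSpace ℂ (Fin n)) φ q
  have hdφ : ∀ q ∈ φ.source, ∀ v : E_P, dφ q (J q v) = Complex.I • dφ q v := hd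
  have hφd : ∀ q ∈ φ.source,
      MDifferentiableAt 𝓘(ℝ, E_P) 𝓘(ℝ, EuclideanSpace ℂ (Fin n)) φ q := fun q hq ↦
    (hφ.contMDiffAt (φ.open_source.mem_nhds hq)).mdifferentiableAt (by simp)
  have hφsd : ∀ z ∈ φ.target,
      MDifferentiableAt 𝓘(ℝ, EuclideanSpace ℂ (Fin n)) 𝓘(ℝ, E_P) φ.symm z := fun z hq ↦
    (hφs.contMDiffAt (φ.open_target.mem_nhds hq)).mdifferentiableAt (by simp)
  have e1 : ∀ q ∈ φ.source, ∀ v : E_P, (mdiff φ.symm (φ q) : _ →L[ℝ] E_P) (dφ q v) = v := by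
    intro q hq v
    have h3 := mfderiv_comp q (hφsd _ (φ.map_source hq)) (hφd q hq)
    have h4 : φ.symm ∘ φ =ᶠ[nhds q] id := by
      filter_upwards [φ.open_source.mem_nhds hq] with z hz using φ.left_inv hz
    rw [h4.mfderiv_eq, mfderiv_id] at h3
    exact (DFunLike.congr_fun h3 v).symm
  have e2 : ∀ q ∈ φ.source, ∀ v, dφ q ((mdiff φ.symm (φ q) : _ →L[ℝ] E_P) v) = v := by
    intro q hq v
    have h3 := mfderiv_comp (φ q) (I' := 𝓘(ℝ, E_P)) (f := φ.symm) (g := φ) (by rw [φ.left_inv hq]; exact hφd q hq)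
      (hφsd _ (φ.map_source hq))
    have h4 : φ ∘ φ.symm =ᶠ[nhds (φ q)] id := by
      filter_upwards [φ.open_target.mem_nhds (φ.map_source hq)] with z hz using φ.right_inv hz
    rw [h4.mfderiv_eq, mfderiv_id] at h3
    have h5 : (mfderiv 𝓘(ℝ, E_P) 𝓘(ℝ, EuclideanSpace ℂ (Fin n)) φ (φ.symm (φ q)) :
      E_P →L[ℝ] EuclideanSpace ℂ (Fin n)) = dφ q := by rw [φ.left_inv hq]
    exact ((DFunLike.congr_fun h5 _).symm.trans (DFunLike.congr_fun h3 v).symm)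
  have e3 : ∀ q ∈ φ.source, ∀ v, (mdiff φ.symm (φ q) : _ →L[ℝ] E_P) (Complex.I • v) =
      J q ((mdiff φ.symm (φ q) : _ →L[ℝ] E_P) v) := by
    intro q hq v
    rw [← e1 q hq (J q _), hdφ q hq, e2 q hq]
  have hev : ∀ᶠ y in nhds (φ p), ∀ v, mpull φ.symm α y v = mpull φ.symm w y (Complex.I • v) := by
    filter_upwards [φ.open_target.mem_nhds hz] with y hy v
    obtain ⟨q, hq, rfl⟩ : ∃ q ∈ φ.source, φ q = y := ⟨φ.symm y, φ.map_target hy, φ.right_inv hy⟩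
    have : φ.symm (φ q) = q := φ.left_inv hq
    simp only [mpull, ContinuousLinearMap.comp_apply, this]
    rw [e3 q hq, h1]
  have hwd : DifferentiableAt ℝ (mpull φ.symm w) (φ p) :=
    ((hw.contDiffOn_mpull φ.open_target hφs).contDiffAt
      (φ.open_target.mem_nhds hz)).differentiableAt (by simp)
  have key := extd_type hwd hev (dφ p u) (dφ p v)
  simp only [mextd_mpull hw φ.open_target hφs hz, mextd_mpull hα φ.open_target hφs hz, e3 p hp,
    e1 p hp, hinv] at key
  exact key

end Integrability

/-! ### Equivariant forms contracted with fundamental vector fields. -/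

section StructureEquations

variable {E_K : Type*} [NormedAddCommGroup E_K] [NormedSpace ℝ E_K] [FiniteDimensional ℝ E_K]
  {K : Type*} [TopologicalSpace K] [ChartedSpace E_K K] [Group K] [LieGroup 𝓘(ℝ, E_K) ∞ K]
  {E_P : Type*} [NormedAddCommGroup E_P] [NormedSpace ℝ E_P] [FiniteDimensional ℝ E_P]
  {P : Type*} [TopologicalSpace P] [ChartedSpace E_P P] [IsManifold 𝓘(ℝ, E_P) ∞ P]
  {E_M : Type*} [NormedAddCommGroup E_M] [NormedSpace ℝ E_M] [FiniteDimensional ℝ E_M]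
  {M : Type*} [TopologicalSpace M] [ChartedSpace E_M M] [IsManifold 𝓘(ℝ, E_M) ∞ M]

variable (E_K) in
/-- The adjoint action on the Lie algebra, as a continuous linear map of the model space. -/
def adCLM (k : K) : E_K →L[ℝ] E_K := mfderiv 𝓘(ℝ, E_K) 𝓘(ℝ, E_K) (fun h : K ↦ k * h * k⁻¹) 1

variable (K) in
/-- `br` is the Lie bracket of the Lie algebra of `K`: it is alternating, satisfies the Jacobi
identity and is the differential of the adjoint action. -/
structure IsAdBracket (br : E_K →L[ℝ] E_K →L[ℝ] E_K) : Prop where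
  skew : ∀ X Y, br X Y = -br Y X
  jacobi : ∀ X Y Z, br X (br Y Z) - br Y (br X Z) = br (br X Y) Z
  hasMFDerivAt : HasMFDerivAt 𝓘(ℝ, E_K) 𝓘(ℝ, E_K →L[ℝ] E_K) (fun k : K ↦ adCLM E_K k⁻¹) 1
    (-br : E_K →L[ℝ] E_K →L[ℝ] E_K)

theorem IsAdBracket.hasMFDerivAt_apply {br : E_K →L[ℝ] E_K →L[ℝ] E_K} (hbr : IsAdBracket K br)
    (Y : E_K) : HasMFDerivAt 𝓘(ℝ, E_K) 𝓘(ℝ, E_K) (fun k : K ↦ adCLM E_K k⁻¹ Y) 1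
      (-(br.flip Y) : E_K →L[ℝ] E_K) :=
  HasMFDerivAt.comp (g := ContinuousLinearMap.apply ℝ E_K Y) (f := fun k : K ↦ adCLM E_K k⁻¹)
    (1 : K) (ContinuousLinearMap.apply ℝ E_K Y).hasMFDerivAt hbr.hasMFDerivAt

namespace SmoothPrincipalBundle

variable (Q : SmoothPrincipalBundle E_K K E_P P E_M M)

/-- The fundamental vector field, in terms of the model spaces. -/
def vert (p : P) : E_K →L[ℝ] E_P := Q.fundamental p

/-- The differential of the right translation, in terms of the model spaces. -/
def dright (k : K) (p : P) : E_P →L[ℝ] E_P := Q.rightTranslation k p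

variable {Q} in
/-- The connection form, in terms of the model spaces. -/
def Connection.oneForm (A : Q.Connection) (p : P) : E_P →L[ℝ] E_K := A.form p

variable {Q} in
/-- The tensorial form, in terms of the model spaces. -/
def TensorialIso.oneForm {A : Q.Connection} (α : TensorialIso A) (p : P) : E_P →L[ℝ] E_K := α.form p

theorem contMDiff_act_left (p : P) : ContMDiff 𝓘(ℝ, E_K) 𝓘(ℝ, E_P) ∞ fun k : K ↦ Q.act p k :=
  Q.contMDiff_act.comp (contMDiff_const.prodMk contMDiff_id)

theorem contMDiff_act_right (k : K) : ContMDiff 𝓘(ℝ, E_P) 𝓘(ℝ, E_P) ∞ fun p : P ↦ Q.act p k :=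
  Q.contMDiff_act.comp (contMDiff_id.prodMk contMDiff_const)

/-- The action in the charts at `1 ∈ K` and `p ∈ P`. -/
def actChart (p : P) (z : E_K × E_P) : P :=
  Q.act ((extChartAt 𝓘(ℝ, E_P) p).symm z.2) ((extChartAt 𝓘(ℝ, E_K) (1 : K)).symm z.1)

theorem contMDiffOn_actChart (p : P) : ContMDiffOn 𝓘(ℝ, E_K × E_P) 𝓘(ℝ, E_P) ∞ (Q.actChart p)
    ((extChartAt 𝓘(ℝ, E_K) (1 : K)).target ×ˢ (extChartAt 𝓘(ℝ, E_P) p).target) := by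
  have hK : IsManifold 𝓘(ℝ, E_K) ∞ K := inferInstance
  refine Q.contMDiff_act.comp_contMDiffOn (ContMDiffOn.prodMk ?_ ?_)
  · exact (contMDiffOn_extChartAt_symm p).comp contDiff_snd.contMDiff.contMDiffOn fun z hz ↦ hz.2
  · exact (contMDiffOn_extChartAt_symm (1 : K)).comp contDiff_fst.contMDiff.contMDiffOn
      fun z hz ↦ hz.1

/-- This lemma and `mdiff_actChart_inr` give the two partial differentials of the action, along the
slice `k = 1` with the point of `P` varying, and along the slice at the base point `p` with `k`
varying. These are the slices along which `mextd_vert` differentiates. -/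
theorem mdiff_actChart_inl (p : P) {y : E_P} (hy : y ∈ (extChartAt 𝓘(ℝ, E_P) p).target) (X : E_K) :
    mdiff (Q.actChart p) (extChartAt 𝓘(ℝ, E_K) (1 : K) 1, y)
      (dchart (1 : K) 1 X, (0 : E_P)) = Q.vert ((extChartAt 𝓘(ℝ, E_P) p).symm y) X := by
  have hK : IsManifold 𝓘(ℝ, E_K) ∞ K := inferInstance
  set χ := extChartAt 𝓘(ℝ, E_K) (1 : K)
  set q := (extChartAt 𝓘(ℝ, E_P) p).symm y
  have h0 : (χ 1, y) ∈ χ.target ×ˢ (extChartAt 𝓘(ℝ, E_P) p).target := ⟨mem_extChartAt_target 1, hy⟩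
  have ho : IsOpen (χ.target ×ˢ (extChartAt 𝓘(ℝ, E_P) p).target) :=
    (isOpen_extChartAt_target (1 : K)).prod (isOpen_extChartAt_target p)
  have hd : MDifferentiableAt 𝓘(ℝ, E_K × E_P) 𝓘(ℝ, E_P) (Q.actChart p) (χ 1, y) :=
    ((Q.contMDiffOn_actChart p).contMDiffAt (ho.mem_nhds h0)).mdifferentiableAt (by simp)
  have hi : HasFDerivAt (𝕜 := ℝ) (fun x : E_K ↦ (x, y)) (ContinuousLinearMap.inl ℝ E_K E_P) (χ 1) :=
    hasFDerivAt_prodMk_left _ _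
  have hχ := (mdifferentiableAt_extChartAt (I := 𝓘(ℝ, E_K)) (x := (1 : K)) (mem_chart_source _ _)).hasMFDerivAt
  have h2 : HasMFDerivAt 𝓘(ℝ, E_K) 𝓘(ℝ, E_P) (fun k : K ↦ Q.actChart p (χ k, y)) 1 _ :=
    hd.hasMFDerivAt.comp (1 : K) (hi.hasMFDerivAt.comp (1 : K) hχ)
  have h3 : (fun k : K ↦ Q.actChart p (χ k, y)) =ᶠ[nhds 1] fun k ↦ Q.act q k := by
    filter_upwards [extChartAt_source_mem_nhds (I := 𝓘(ℝ, E_K)) (1 : K)] with k hk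
    change Q.act q (χ.symm (χ k)) = _
    rw [χ.left_inv hk]
  have h4 := h3.mfderiv_eq (I := 𝓘(ℝ, E_K)) (I' := 𝓘(ℝ, E_P))
  rw [h2.mfderiv] at h4
  exact DFunLike.congr_fun h4 X

theorem mdiff_actChart_inr (p : P) {x : E_K} (hx : x ∈ (extChartAt 𝓘(ℝ, E_K) (1 : K)).target)
    (v : E_P) :
    mdiff (Q.actChart p) (x, extChartAt 𝓘(ℝ, E_P) p p) ((0 : E_K), dchart p p v) =
      Q.dright ((extChartAt 𝓘(ℝ, E_K) (1 : K)).symm x) p v := by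
  have hK : IsManifold 𝓘(ℝ, E_K) ∞ K := inferInstance
  set ψ := extChartAt 𝓘(ℝ, E_P) p
  set k := (extChartAt 𝓘(ℝ, E_K) (1 : K)).symm x
  have h0 : (x, ψ p) ∈ (extChartAt 𝓘(ℝ, E_K) (1 : K)).target ×ˢ ψ.target :=
    ⟨hx, mem_extChartAt_target p⟩
  have ho : IsOpen ((extChartAt 𝓘(ℝ, E_K) (1 : K)).target ×ˢ ψ.target) :=
    (isOpen_extChartAt_target (1 : K)).prod (isOpen_extChartAt_target p)
  have hd : MDifferentiableAt 𝓘(ℝ, E_K × E_P) 𝓘(ℝ, E_P) (Q.actChart p) (x, ψ p) :=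
    ((Q.contMDiffOn_actChart p).contMDiffAt (ho.mem_nhds h0)).mdifferentiableAt (by simp)
  have hi : HasFDerivAt (𝕜 := ℝ) (fun y : E_P ↦ (x, y)) (ContinuousLinearMap.inr ℝ E_K E_P) (ψ p) :=
    hasFDerivAt_prodMk_right _ _
  have hψ := (mdifferentiableAt_extChartAt (I := 𝓘(ℝ, E_P)) (x := p) (mem_chart_source _ _)).hasMFDerivAt
  have h2 : HasMFDerivAt 𝓘(ℝ, E_P) 𝓘(ℝ, E_P) (fun q : P ↦ Q.actChart p (x, ψ q)) p _ :=
    hd.hasMFDerivAt.comp p (hi.hasMFDerivAt.comp p hψ)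
  have h3 : (fun q : P ↦ Q.actChart p (x, ψ q)) =ᶠ[nhds p] fun q ↦ Q.act q k := by
    filter_upwards [extChartAt_source_mem_nhds (I := 𝓘(ℝ, E_P)) p] with q hq
    change Q.act (ψ.symm (ψ q)) k = _
    rw [ψ.left_inv hq]
  have h4 := h3.mfderiv_eq (I := 𝓘(ℝ, E_P)) (I' := 𝓘(ℝ, E_P))
  rw [h2.mfderiv] at h4
  exact DFunLike.congr_fun h4 v

variable {Q} {br : E_K →L[ℝ] E_K →L[ℝ] E_K}

/-- The contraction of `dθ` with a fundamental vector field `X^#`, for an equivariant form `θ` which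
is constant on `X^#`: this is the infinitesimal form of the equivariance. -/
theorem mextd_vert (hbr : IsAdBracket K br) {θ : P → E_P →L[ℝ] E_K} (hθ : SmoothForm θ)
    (heq : ∀ k p v, θ (Q.act p k) (Q.dright k p v) = adCLM E_K k⁻¹ (θ p v)) {X c : E_K}
    (hc : ∀ p, θ p (Q.vert p X) = c) (p : P) (v : E_P) :
    mextd θ p (Q.vert p X) v = -br X (θ p v) := by
  have hK : IsManifold 𝓘(ℝ, E_K) ∞ K := inferInstance
  let χ := extChartAt 𝓘(ℝ, E_K) (1 : K)
  let ψ := extChartAt 𝓘(ℝ, E_P) p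
  let z : E_K × E_P := (χ 1, ψ p)
  let ξ : E_K × E_P := (dchart (1 : K) 1 X, 0)
  let w : E_K × E_P := (0, dchart p p v)
  have h0 : z ∈ χ.target ×ˢ ψ.target := ⟨mem_extChartAt_target 1, mem_extChartAt_target p⟩
  have ho : IsOpen (χ.target ×ˢ ψ.target) :=
    (isOpen_extChartAt_target (1 : K)).prod (isOpen_extChartAt_target p)
  have e1 : ψ.symm (ψ p) = p := extChartAt_to_inv p
  have e2 : χ.symm (χ 1) = 1 := extChartAt_to_inv 1
  have e3 : Q.actChart p z = p := by
    change Q.act (ψ.symm (ψ p)) (χ.symm (χ 1)) = p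
    rw [e1, e2, Q.act_one]
  have hξ : mdiff (Q.actChart p) z ξ = Q.vert p X := by
    have := Q.mdiff_actChart_inl p (mem_extChartAt_target p) X
    rwa [extChartAt_to_inv] at this
  have hdr1 : Q.dright 1 p v = v := by
    have h := mfderiv_id (I := 𝓘(ℝ, E_P)) (x := p)
    have h' : (id : P → P) = fun q ↦ Q.act q 1 := by funext q; exact (Q.act_one q).symm
    rw [h'] at h
    exact DFunLike.congr_fun h v
  have hw : mdiff (Q.actChart p) z w = v := by
    have := Q.mdiff_actChart_inr p (mem_extChartAt_target (1 : K)) v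
    rwa [extChartAt_to_inv, hdr1] at this
  have hd : DifferentiableAt ℝ (mpull (Q.actChart p) θ) z :=
    ((hθ.contDiffOn_mpull ho (Q.contMDiffOn_actChart p)).contDiffAt
      (ho.mem_nhds h0)).differentiableAt (by simp)
  -- The form is pulled back by the action map `Φ` in charts. The constant fields `ξ` and `w`
  -- represent `X^#` and `v` at `z`, so `dθ(X^#, v) = ∂_ξ((Φ^* θ)(w)) - ∂_w((Φ^* θ)(ξ))`.
  have key := mextd_mpull hθ ho (Q.contMDiffOn_actChart p) h0 ξ w
  rw [hξ, hw, e3] at key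
  rw [← key, extd]
  have hz1 : HasFDerivAt (𝕜 := ℝ) (fun x : E_K ↦ (x, ψ p)) (ContinuousLinearMap.inl ℝ E_K E_P) (χ 1) :=
    hasFDerivAt_prodMk_left _ _
  have hz2 : HasFDerivAt (𝕜 := ℝ) (fun y : E_P ↦ (χ 1, y)) (ContinuousLinearMap.inr ℝ E_K E_P) (ψ p) :=
    hasFDerivAt_prodMk_right _ _
  -- Along the group direction `(Φ^* θ)(w) = θ((R_k)_* v) = ad_{k⁻¹}(θ v)`, with derivative `-[X, θ
  -- v]` at `k = 1`.
  have d1 : fderiv ℝ (mpull (Q.actChart p) θ) z ξ w = -br X (θ p v) := by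
    have h1 : HasFDerivAt (fun x : E_K ↦ mpull (Q.actChart p) θ (x, ψ p) w) _ (χ 1) :=
      (HasFDerivAt.comp (χ 1) hd.hasFDerivAt hz1).clm_apply (hasFDerivAt_const w (χ 1))
    have h2 : (fun x : E_K ↦ mpull (Q.actChart p) θ (x, ψ p) w) =ᶠ[nhds (χ 1)]
        fun x ↦ adCLM E_K (χ.symm x)⁻¹ (θ p v) := by
      filter_upwards [extChartAt_target_mem_nhds (I := 𝓘(ℝ, E_K)) (1 : K)] with x hx
      have e4 : Q.actChart p (x, ψ p) = Q.act p (χ.symm x) := by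
        change Q.act (ψ.symm (ψ p)) (χ.symm x) = _
        rw [e1]
      rw [mpull, ContinuousLinearMap.comp_apply, e4, Q.mdiff_actChart_inr p hx, heq]
    have hb := hbr.hasMFDerivAt_apply (θ p v)
    have hχ := (mdifferentiableAt_extChartAt (I := 𝓘(ℝ, E_K)) (x := (1 : K)) (mem_chart_source _ _)).hasMFDerivAt
    have h3 := (HasMFDerivAt.comp (1 : K)
      (h1.congr_of_eventuallyEq h2.symm).hasMFDerivAt hχ).mfderiv
    have h4 : ((fun x ↦ adCLM E_K (χ.symm x)⁻¹ (θ p v)) ∘ χ) =ᶠ[nhds (1 : K)]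
        fun k ↦ adCLM E_K k⁻¹ (θ p v) := by
      filter_upwards [extChartAt_source_mem_nhds (I := 𝓘(ℝ, E_K)) (1 : K)] with k hk
      simp only [Function.comp]
      rw [χ.left_inv hk]
    rw [h4.mfderiv_eq, hb.mfderiv] at h3
    have h5 : -br X (θ p v) = _ := DFunLike.congr_fun h3 X
    rw [h5]
    simp [ξ, dchart]
    rfl
  -- Along the slice `k = 1` the function `(Φ^* θ)(ξ) = θ(X^#)` is the constant `c`.
  have d2 : fderiv ℝ (mpull (Q.actChart p) θ) z w ξ = 0 := by
    have h1 : HasFDerivAt (fun y : E_P ↦ mpull (Q.actChart p) θ (χ 1, y) ξ) _ (ψ p) :=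
      (HasFDerivAt.comp (ψ p) hd.hasFDerivAt hz2).clm_apply (hasFDerivAt_const ξ (ψ p))
    have h2 : (fun y : E_P ↦ mpull (Q.actChart p) θ (χ 1, y) ξ) =ᶠ[nhds (ψ p)] fun _ ↦ c := by
      filter_upwards [extChartAt_target_mem_nhds (I := 𝓘(ℝ, E_P)) p] with y hy
      have e4 : Q.actChart p (χ 1, y) = ψ.symm y := by
        change Q.act (ψ.symm y) (χ.symm (χ 1)) = _
        rw [e2, Q.act_one]
      rw [mpull, ContinuousLinearMap.comp_apply, e4, Q.mdiff_actChart_inl p hy, hc]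
    have h3 := (h1.congr_of_eventuallyEq h2.symm).unique (hasFDerivAt_const c (ψ p))
    have h4 := DFunLike.congr_fun h3 (dchart p p v)
    simpa using h4
  rw [d1, d2, sub_zero]

end SmoothPrincipalBundle

end StructureEquations

/-! ### The structure equations of an integrable `J_α`. -/

section IntegrableStructureEquations

variable {E_K : Type*} [NormedAddCommGroup E_K] [NormedSpace ℝ E_K] [FiniteDimensional ℝ E_K]
  {K : Type*} [TopologicalSpace K] [ChartedSpace E_K K] [Group K] [LieGroup 𝓘(ℝ, E_K) ∞ K]
  {E_P : Type*} [NormedAddCommGroup E_P] [NormedSpace ℝ E_P] [FiniteDimensional ℝ E_P]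
  {P : Type*} [TopologicalSpace P] [ChartedSpace E_P P] [IsManifold 𝓘(ℝ, E_P) ∞ P]
  {E_M : Type*} [NormedAddCommGroup E_M] [NormedSpace ℝ E_M] [FiniteDimensional ℝ E_M]
  {M : Type*} [TopologicalSpace M] [ChartedSpace E_M M] [IsManifold 𝓘(ℝ, E_M) ∞ M]

namespace SmoothPrincipalBundle

variable {Q : SmoothPrincipalBundle E_K K E_P P E_M M}

namespace Connection

variable (A : Q.Connection)

theorem smoothForm : SmoothForm A.oneForm := A.contMDiff_form

theorem oneForm_vert (p : P) (X : E_K) : A.oneForm p (Q.vert p X) = X := A.form_fundamental p X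

theorem oneForm_dright (k : K) (p : P) (v : E_P) :
    A.oneForm (Q.act p k) (Q.dright k p v) = adCLM E_K k⁻¹ (A.oneForm p v) :=
  A.form_rightTranslation k p v

end Connection

namespace TensorialIso

variable {A : Q.Connection} (α : TensorialIso A)

theorem smoothForm : SmoothForm α.oneForm := α.contMDiff_form

theorem oneForm_vert (p : P) (X : E_K) : α.oneForm p (Q.vert p X) = 0 :=
  α.form_vertical p _ (Q.dproj_fundamental p X)

theorem oneForm_dright (k : K) (p : P) (v : E_P) :
    α.oneForm (Q.act p k) (Q.dright k p v) = adCLM E_K k⁻¹ (α.oneForm p v) :=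
  α.form_rightTranslation k p v

/-- The inverse `α_p⁻¹ : 𝔨 → A_p`, in terms of the model spaces. -/
def lift (p : P) (X : E_K) : E_P := α.inv p X

theorem connection_lift (p : P) (X : E_K) : A.oneForm p (α.lift p X) = 0 :=
  (α.existsUnique_horizontal p X).choose_spec.1.1

theorem oneForm_lift (p : P) (X : E_K) : α.oneForm p (α.lift p X) = X :=
  (α.existsUnique_horizontal p X).choose_spec.1.2

/-- Uniqueness in `existsUnique_horizontal` for `X = 0` says that `ker ω` and `ker α` meet in zero,
so identities between tangent vectors of `P` can be tested on `ω` and `α`. -/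
theorem eq_of_forms_eq {p : P} {v w : E_P} (h1 : A.oneForm p v = A.oneForm p w)
    (h2 : α.oneForm p v = α.oneForm p w) : v = w := by
  obtain ⟨z, -, hz⟩ := α.existsUnique_horizontal p 0
  have e1 : v - w = z := hz (v - w) ⟨by
    change A.oneForm p (v - w) = 0
    rw [map_sub, h1, sub_self], by
    change α.oneForm p (v - w) = 0
    rw [map_sub, h2, sub_self]⟩
  have e2 : (0 : E_P) = z := hz (0 : E_P) ⟨map_zero (A.oneForm p), map_zero (α.oneForm p)⟩
  rw [← sub_eq_zero, e1, ← e2]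

/-- The almost complex structure, in terms of the model spaces. -/
def J (p : P) (v : E_P) : E_P := Q.vert p (α.oneForm p v) - α.lift p (A.oneForm p v)

theorem connection_J (p : P) (v : E_P) : A.oneForm p (α.J p v) = α.oneForm p v := by
  rw [J, map_sub, A.oneForm_vert, α.connection_lift, sub_zero]

theorem J_of_horizontal {p : P} {v : E_P} (h : A.oneForm p v = 0) :
    α.J p v = Q.vert p (α.oneForm p v) := by
  refine α.eq_of_forms_eq (p := p) ?_ ?_
  · rw [connection_J, A.oneForm_vert]
  · rw [J, map_sub, α.oneForm_vert, α.oneForm_lift, h, sub_zero]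

variable {br : E_K →L[ℝ] E_K →L[ℝ] E_K}

theorem mextd_connection_vert (hbr : IsAdBracket K br) (A : Q.Connection) (p : P) (X : E_K) (v : E_P) :
    mextd A.oneForm p (Q.vert p X) v = -br X (A.oneForm p v) :=
  mextd_vert hbr A.smoothForm A.oneForm_dright (fun p ↦ A.oneForm_vert p X) p v

theorem mextd_oneForm_vert (hbr : IsAdBracket K br) (p : P) (X : E_K) (v : E_P) :
    mextd α.oneForm p (Q.vert p X) v = -br X (α.oneForm p v) :=
  mextd_vert hbr α.smoothForm α.oneForm_dright (fun p ↦ α.oneForm_vert p X) p v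

theorem mextd_connection_vert_right (hbr : IsAdBracket K br) (A : Q.Connection) (p : P) (X : E_K)
    (v : E_P) : mextd A.oneForm p v (Q.vert p X) = br X (A.oneForm p v) := by
  rw [mextd_swap, mextd_connection_vert hbr, neg_neg]

theorem mextd_oneForm_vert_right (hbr : IsAdBracket K br) (p : P) (X : E_K) (v : E_P) :
    mextd α.oneForm p v (Q.vert p X) = br X (α.oneForm p v) := by
  rw [mextd_swap, α.mextd_oneForm_vert hbr, neg_neg]

/-- Since `Ju = (α u)^#` and `Jv = (α v)^#` are vertical, every term on the right of
`mextd_of_isIntegrable` is a known contraction. For `dω` the three terms are `-[α u, α v]`, `+[α u,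
α v]`, `+[α u, α v]`; for `dα` all three vanish. -/
theorem structure_equations_horizontal (hbr : IsAdBracket K br)
    (hJ : IsIntegrable α.almostComplex) {p : P} {u v : E_P}
    (hu : A.oneForm p u = 0) (hv : A.oneForm p v = 0) :
    mextd A.oneForm p u v = br (α.oneForm p u) (α.oneForm p v) ∧ mextd α.oneForm p u v = 0 := by
  have h := mextd_of_isIntegrable (J := α.J) hJ A.smoothForm α.smoothForm α.connection_J p u v
  simp only [α.J_of_horizontal hu, α.J_of_horizontal hv, mextd_connection_vert hbr,
    mextd_connection_vert_right hbr, α.mextd_oneForm_vert hbr, α.mextd_oneForm_vert_right hbr,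
    α.oneForm_vert, A.oneForm_vert, hu, hv, hbr.skew (α.oneForm p v), map_zero, neg_zero,
    add_zero] at h
  rw [h.1, h.2]
  simp

/-- The curvature of the connection is `[α, α] / 2`, and `α` is covariantly closed. -/
theorem structure_equations (hbr : IsAdBracket K br) (hJ : IsIntegrable α.almostComplex) (p : P) (u v : E_P) :
    mextd A.oneForm p u v =
      br (α.oneForm p u) (α.oneForm p v) - br (A.oneForm p u) (A.oneForm p v) ∧
    mextd α.oneForm p u v =
      br (A.oneForm p v) (α.oneForm p u) - br (A.oneForm p u) (α.oneForm p v) := by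
  have dec : ∀ w : E_P, ∃ w' : E_P, A.oneForm p w' = 0 ∧ w = w' + Q.vert p (A.oneForm p w) :=
    fun w ↦ ⟨w - Q.vert p (A.oneForm p w), by rw [map_sub, A.oneForm_vert, sub_self], by abel⟩
  obtain ⟨u', hu', eu⟩ := dec u
  obtain ⟨v', hv', ev⟩ := dec v
  have h := α.structure_equations_horizontal hbr hJ hu' hv'
  have au : α.oneForm p u = α.oneForm p u' := by rw [eu, map_add, α.oneForm_vert, add_zero]
  have av : α.oneForm p v = α.oneForm p v' := by rw [ev, map_add, α.oneForm_vert, add_zero]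
  rw [au, av]
  -- In `eu` the vector `u` also occurs on the right, inside `A.oneForm p u`; naming that component
  -- `x` makes the substitution possible.
  generalize A.oneForm p u = x at *
  generalize A.oneForm p v = y at *
  subst eu ev
  simp only [mextd_add_left, mextd_connection_vert hbr, α.mextd_oneForm_vert hbr,
    mextd_add_right, mextd_connection_vert_right hbr, α.mextd_oneForm_vert_right hbr, map_add,
    A.oneForm_vert, α.oneForm_vert, hu', hv', h.1, h.2, map_zero, neg_zero, add_zero, zero_add]
  rw [hbr.skew y x]
  constructor <;> abel

end TensorialIso

end SmoothPrincipalBundle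

end IntegrableStructureEquations

/-! ### Chart representatives of vector fields and of their Lie brackets. -/

section VectorFieldsInCharts

variable {E : Type*} [NormedAddCommGroup E] [NormedSpace ℝ E] [FiniteDimensional ℝ E]
  {N : Type*} [TopologicalSpace N] [ChartedSpace E N]

/-- The representative of a vector field in the preferred chart at `x₀`. -/
def vrep (x₀ : N) (Y : ∀ x : N, TangentSpace 𝓘(ℝ, E) x) : E → E :=
  VectorField.mpullback 𝓘(ℝ, E) 𝓘(ℝ, E) (extChartAt 𝓘(ℝ, E) x₀).symm Y

variable [IsManifold 𝓘(ℝ, E) ∞ N]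

theorem isInvertible_mfderiv_chart_symm {x₀ : N} {z : E} (hz : z ∈ (extChartAt 𝓘(ℝ, E) x₀).target) :
    (mfderiv 𝓘(ℝ, E) 𝓘(ℝ, E) (extChartAt 𝓘(ℝ, E) x₀).symm z).IsInvertible := by
  have : IsManifold 𝓘(ℝ, E) 1 N := .of_le (n := ∞) (by simp)
  have h := isInvertible_mfderivWithin_extChartAt_symm (I := 𝓘(ℝ, E)) hz
  rwa [show Set.range 𝓘(ℝ, E) = Set.univ by simp, mfderivWithin_univ] at h

theorem isInvertible_mdiff_chart_symm {x₀ : N} {z : E} (hz : z ∈ (extChartAt 𝓘(ℝ, E) x₀).target) :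
    (mdiff (extChartAt 𝓘(ℝ, E) x₀).symm z : E →L[ℝ] E).IsInvertible :=
  isInvertible_mfderiv_chart_symm hz

theorem mdiff_vrep {x₀ : N} {z : E} (hz : z ∈ (extChartAt 𝓘(ℝ, E) x₀).target)
    (Y : ∀ x : N, TangentSpace 𝓘(ℝ, E) x) :
    (mdiff (extChartAt 𝓘(ℝ, E) x₀).symm z : E →L[ℝ] E) (vrep x₀ Y z) =
      Y ((extChartAt 𝓘(ℝ, E) x₀).symm z) :=
  (isInvertible_mdiff_chart_symm hz).self_apply_inverse _

theorem contMDiffAt_chart_symm {x₀ : N} {z : E} (hz : z ∈ (extChartAt 𝓘(ℝ, E) x₀).target) :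
    ContMDiffAt 𝓘(ℝ, E) 𝓘(ℝ, E) ∞ (extChartAt 𝓘(ℝ, E) x₀).symm z :=
  (contMDiffOn_extChartAt_symm x₀).contMDiffAt ((isOpen_extChartAt_target x₀).mem_nhds hz)

theorem differentiableAt_vrep {x₀ : N} {z : E} (hz : z ∈ (extChartAt 𝓘(ℝ, E) x₀).target)
    {Y : ∀ x : N, TangentSpace 𝓘(ℝ, E) x}
    (hY : MDifferentiableAt 𝓘(ℝ, E) 𝓘(ℝ, E).tangent
      (fun x ↦ (⟨x, Y x⟩ : TangentBundle 𝓘(ℝ, E) N)) ((extChartAt 𝓘(ℝ, E) x₀).symm z)) :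
    DifferentiableAt ℝ (vrep x₀ Y) z := by
  have : IsManifold 𝓘(ℝ, E) 1 N := .of_le (n := ∞) (by simp)
  have h := hY.mpullback_vectorField (contMDiffAt_chart_symm hz)
    (isInvertible_mfderiv_chart_symm hz) two_le_infty
  have h2 := ((contMDiff_snd_tangentBundle_modelSpace E 𝓘(ℝ, E) (n := 1)).mdifferentiable
    (by simp)).mdifferentiableAt.comp _ h
  exact h2.differentiableAt

theorem contDiffAt_vrep {x₀ : N} {z : E} (hz : z ∈ (extChartAt 𝓘(ℝ, E) x₀).target)
    {Y : ∀ x : N, TangentSpace 𝓘(ℝ, E) x}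
    (hY : ContMDiff 𝓘(ℝ, E) 𝓘(ℝ, E).tangent ∞
      (fun x ↦ (⟨x, Y x⟩ : TangentBundle 𝓘(ℝ, E) N))) :
    ContDiffAt ℝ ∞ (vrep x₀ Y) z := by
  have : IsManifold 𝓘(ℝ, E) 1 N := .of_le (n := ∞) (by simp)
  have h := ContMDiffAt.mpullback_vectorField_preimage (hY _) (contMDiffAt_chart_symm hz)
    (isInvertible_mfderiv_chart_symm hz) (m := ∞) (by simp)
  exact contMDiffAt_vectorSpace_iff_contDiffAt.1 h

theorem vrep_mlieBracket {x₀ : N} {z : E} (hz : z ∈ (extChartAt 𝓘(ℝ, E) x₀).target)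
    {X Y : ∀ x : N, TangentSpace 𝓘(ℝ, E) x}
    (hX : MDifferentiableAt 𝓘(ℝ, E) 𝓘(ℝ, E).tangent
      (fun x ↦ (⟨x, X x⟩ : TangentBundle 𝓘(ℝ, E) N)) ((extChartAt 𝓘(ℝ, E) x₀).symm z))
    (hY : MDifferentiableAt 𝓘(ℝ, E) 𝓘(ℝ, E).tangent
      (fun x ↦ (⟨x, Y x⟩ : TangentBundle 𝓘(ℝ, E) N)) ((extChartAt 𝓘(ℝ, E) x₀).symm z)) :
    vrep x₀ (VectorField.mlieBracket 𝓘(ℝ, E) X Y) z =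
      VectorField.lieBracket ℝ (vrep x₀ X) (vrep x₀ Y) z := by
  have : IsManifold 𝓘(ℝ, E) 1 N := .of_le (n := ∞) (by simp)
  have : IsManifold 𝓘(ℝ, E) (minSmoothness ℝ 2) N := .of_le (n := ∞) (by simpa using two_le_infty)
  have h := VectorField.mpullback_mlieBracket hX hY (contMDiffAt_chart_symm hz)
    (by simpa using two_le_infty)
  rw [← VectorField.mlieBracketWithin_univ (I := 𝓘(ℝ, E)) (M := E),
    VectorField.mlieBracketWithin_eq_lieBracketWithin] at h
  exact h.trans (congrFun VectorField.lieBracketWithin_univ z)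

end VectorFieldsInCharts

/-! ### Vector fields on `M` as equivariant functions on `P`; local sections. -/

section AssociatedSections

variable {E_K : Type*} [NormedAddCommGroup E_K] [NormedSpace ℝ E_K] [FiniteDimensional ℝ E_K]
  {K : Type*} [TopologicalSpace K] [ChartedSpace E_K K] [Group K] [LieGroup 𝓘(ℝ, E_K) ∞ K]
  {E_P : Type*} [NormedAddCommGroup E_P] [NormedSpace ℝ E_P] [FiniteDimensional ℝ E_P]
  {P : Type*} [TopologicalSpace P] [ChartedSpace E_P P] [IsManifold 𝓘(ℝ, E_P) ∞ P]
  {E_M : Type*} [NormedAddCommGroup E_M] [NormedSpace ℝ E_M] [FiniteDimensional ℝ E_M]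
  {M : Type*} [TopologicalSpace M] [ChartedSpace E_M M] [IsManifold 𝓘(ℝ, E_M) ∞ M]

namespace SmoothPrincipalBundle

/-- The differential of the projection, in terms of the model spaces. -/
def dpr (Q : SmoothPrincipalBundle E_K K E_P P E_M M) (p : P) : E_P →L[ℝ] E_M := Q.dproj p

variable {Q : SmoothPrincipalBundle E_K K E_P P E_M M}

theorem dpr_vert (p : P) (X : E_K) : Q.dpr p (Q.vert p X) = 0 := Q.dproj_fundamental p X

theorem dpr_dright (k : K) (p : P) (v : E_P) : Q.dpr (Q.act p k) (Q.dright k p v) = Q.dpr p v := by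
  have h := mfderiv_comp p (g := Q.proj) (f := fun q ↦ Q.act q k) (I := 𝓘(ℝ, E_P))
    (I' := 𝓘(ℝ, E_P)) (I'' := 𝓘(ℝ, E_M)) ((Q.contMDiff_proj _).mdifferentiableAt (by simp))
    ((Q.contMDiff_act_right k _).mdifferentiableAt (by simp))
  have h2 : Q.proj ∘ (fun q ↦ Q.act q k) = Q.proj := funext fun q ↦ Q.proj_act q k
  rw [h2] at h
  exact (DFunLike.congr_fun h v).symm

namespace TensorialIso

variable {A : Q.Connection}

theorem oneForm_vertical (α : TensorialIso A) {p : P} {v : E_P} (h : Q.dpr p v = 0) : α.oneForm p v = 0 :=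
  α.form_vertical p v h

/-- Uniqueness of horizontal lifts. It is obtained from `α` and not from a dimension count: a vector
in `ker dπ` is killed by `α`, so if it is also killed by `ω` it is zero by `eq_of_forms_eq`. -/
theorem eq_of_dpr_eq (α : TensorialIso A) {p : P} {v w : E_P} (h1 : A.oneForm p v = A.oneForm p w)
    (h2 : Q.dpr p v = Q.dpr p w) : v = w :=
  α.eq_of_forms_eq h1 <| sub_eq_zero.1 <| by
    rw [← map_sub]
    exact α.oneForm_vertical (by rw [map_sub, h2, sub_self])

/-- The horizontal lift of a tangent vector to `p`, in terms of the model spaces. -/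
def hor (A : Q.Connection) (p : P) (u : E_M) : E_P := A.horizontalLift p u

theorem connection_hor (A : Q.Connection) (p : P) (u : E_M) : A.oneForm p (hor A p u) = 0 :=
  (exists_horizontalLift A p u).choose_spec.1

theorem dpr_hor (A : Q.Connection) (p : P) (u : E_M) : Q.dpr p (hor A p u) = u :=
  (exists_horizontalLift A p u).choose_spec.2

theorem hor_dpr (α : TensorialIso A) (p : P) (v : E_P) : hor A p (Q.dpr p v) = v - Q.vert p (A.oneForm p v) := by
  refine α.eq_of_dpr_eq (p := p) ?_ ?_
  · rw [connection_hor, map_sub, A.oneForm_vert, sub_self]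
  · rw [dpr_hor, map_sub, dpr_vert, sub_zero]

theorem hor_act (α : TensorialIso A) (k : K) (p : P) (u : E_M) : hor A (Q.act p k) u = Q.dright k p (hor A p u) := by
  refine α.eq_of_dpr_eq (p := Q.act p k) ?_ ?_
  · rw [connection_hor, A.oneForm_dright, connection_hor, map_zero]
  · rw [dpr_hor, dpr_dright, dpr_hor]

/-- The horizontal lift to `p` as a linear map. -/
def horL (α : TensorialIso A) (p : P) : E_M →L[ℝ] E_P :=
  LinearMap.toContinuousLinearMap
    { toFun := hor A p
      map_add' := fun u v ↦ α.eq_of_dpr_eq (p := p) (by simp only [map_add, connection_hor, add_zero])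
        (by simp only [map_add, dpr_hor])
      map_smul' := fun c u ↦ α.eq_of_dpr_eq (p := p)
        (by simp only [map_smul, connection_hor, smul_zero, RingHom.id_apply])
        (by simp only [map_smul, dpr_hor, RingHom.id_apply]) }

/-- The isomorphism `T_{π p} M → 𝔨`, `u ↦ α_p(ũ)`. -/
def iso (α : TensorialIso A) (p : P) : E_M ≃L[ℝ] E_K :=
  (LinearEquiv.ofBijective ((α.oneForm p).comp (α.horL p) : E_M →ₗ[ℝ] E_K) <| by
    constructor
    · intro u v h
      have : hor A p u = hor A p v := α.eq_of_forms_eq (by rw [connection_hor, connection_hor]) h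
      rw [← dpr_hor A p u, this, dpr_hor]
    · intro X
      refine ⟨Q.dpr p (α.lift p X), ?_⟩
      change α.oneForm p (hor A p _) = X
      rw [α.hor_dpr, map_sub, α.oneForm_lift, α.oneForm_vert, sub_zero]).toContinuousLinearEquiv

theorem iso_apply (α : TensorialIso A) (p : P) (u : E_M) : α.iso p u = α.oneForm p (hor A p u) := rfl

theorem iso_dpr (α : TensorialIso A) (p : P) (v : E_P) : α.iso p (Q.dpr p v) = α.oneForm p v := by
  rw [iso_apply, α.hor_dpr, map_sub, α.oneForm_vert, sub_zero]

theorem iso_act (α : TensorialIso A) (k : K) (p : P) (u : E_M) : α.iso (Q.act p k) u = adCLM E_K k⁻¹ (α.iso p u) := by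
  rw [iso_apply, α.hor_act, α.oneForm_dright, iso_apply]

/-- The equivariant function on `P` with values in `𝔨` which corresponds to a vector field on `M`. -/
def sec (α : TensorialIso A) (Y : ∀ x : M, TangentSpace 𝓘(ℝ, E_M) x) (p : P) : E_K := α.iso p (Y (Q.proj p))

theorem sec_act (α : TensorialIso A) (Y : ∀ x : M, TangentSpace 𝓘(ℝ, E_M) x) (k : K) (p : P) :
    α.sec Y (Q.act p k) = adCLM E_K k⁻¹ (α.sec Y p) := by
  -- The base points `π(pk)` and `π(p)` are equal only propositionally; the values of `Y` are
  -- compared in the common model space `E_M`.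
  have h : ∀ x y : M, x = y → (Y x : E_M) = Y y := by rintro x _ rfl; rfl
  exact (congrArg (α.iso (Q.act p k)) (h _ _ (Q.proj_act p k))).trans (α.iso_act k p _)

end TensorialIso

theorem proj_eq_iff {p q : P} : Q.proj p = Q.proj q ↔ ∃ k, q = Q.act p k := by
  constructor
  · intro h
    obtain ⟨U, e, -, hx, hs, -, -, -, h1, h2⟩ := Q.exists_trivialization (Q.proj p)
    have hp : p ∈ e.source := by rw [hs]; exact hx
    have hq : q ∈ e.source := by rw [hs]; change Q.proj q ∈ U; rwa [← h]
    refine ⟨(e p).2⁻¹ * (e q).2, e.injOn hq ?_ (Prod.ext ?_ ?_)⟩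
    · rw [hs]; change Q.proj _ ∈ U; rwa [Q.proj_act]
    · rw [h1 _ hq, h1 _ (by rw [hs]; change Q.proj _ ∈ U; rwa [Q.proj_act]), Q.proj_act, h]
    · rw [h2 _ hp, mul_inv_cancel_left]
  · rintro ⟨k, rfl⟩
    exact (Q.proj_act p k).symm

variable (Q) in
/-- `f` is the expression of a local section of `P → M` in the preferred chart at `x₀`. -/
structure IsLocalSection (x₀ : M) (s : Set E_M) (f : E_M → P) : Prop where
  isOpen : IsOpen s
  subset : s ⊆ (extChartAt 𝓘(ℝ, E_M) x₀).target
  mem : extChartAt 𝓘(ℝ, E_M) x₀ x₀ ∈ s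
  contMDiffOn : ContMDiffOn 𝓘(ℝ, E_M) 𝓘(ℝ, E_P) ∞ f s
  proj_eq : ∀ z ∈ s, Q.proj (f z) = (extChartAt 𝓘(ℝ, E_M) x₀).symm z

/-- The section is constant in a local trivialization, with the group component of `p₀`. The
function `κ` measures how far `q` is from the section; it transfers differentiability along the
section to differentiability on `P` near the section, and `κ p₀ = 1` because the section passes
through `p₀`. -/
theorem exists_isLocalSection (p₀ : P) : ∃ (s : Set E_M) (f : E_M → P),
    IsLocalSection Q (Q.proj p₀) s f ∧ f (extChartAt 𝓘(ℝ, E_M) (Q.proj p₀) (Q.proj p₀)) = p₀ ∧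
    ∃ κ : P → K, MDifferentiableAt 𝓘(ℝ, E_P) 𝓘(ℝ, E_K) κ p₀ ∧ κ p₀ = 1 ∧
      ∀ᶠ q in nhds p₀, q = Q.act (f (extChartAt 𝓘(ℝ, E_M) (Q.proj p₀) (Q.proj q))) (κ q) := by
  have hK : IsManifold 𝓘(ℝ, E_K) ∞ K := inferInstance
  obtain ⟨U, e, hU, hx, hs, ht, he, hes, h1, h2⟩ := Q.exists_trivialization (Q.proj p₀)
  set x₀ := Q.proj p₀ with hx₀
  set ψ := extChartAt 𝓘(ℝ, E_M) x₀
  have hp : p₀ ∈ e.source := by rw [hs]; exact hx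
  have hep : e p₀ = (x₀, (e p₀).2) := Prod.ext (h1 p₀ hp) rfl
  have hψ : ψ.symm (ψ x₀) = x₀ := extChartAt_to_inv x₀
  have hmem : ∀ y ∈ U, ∀ k : K, (y, k) ∈ e.target := fun y hy k ↦ by rw [ht]; exact ⟨hy, trivial⟩
  refine ⟨ψ.target ∩ ψ.symm ⁻¹' U, fun z ↦ e.symm (ψ.symm z, (e p₀).2), ⟨?_, Set.inter_subset_left,
    ⟨mem_extChartAt_target x₀, by change ψ.symm (ψ x₀) ∈ U; rwa [hψ]⟩, ?_, ?_⟩, ?_,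
    fun q ↦ (e p₀).2⁻¹ * (e q).2, ?_, inv_mul_cancel _, ?_⟩
  · exact (continuousOn_extChartAt_symm x₀).isOpen_inter_preimage (isOpen_extChartAt_target x₀) hU
  · refine hes.comp (ContMDiffOn.prodMk
      ((contMDiffOn_extChartAt_symm x₀).mono Set.inter_subset_left) contMDiffOn_const) ?_
    exact fun z hz ↦ hmem _ hz.2 _
  · intro z hz
    have hm := hmem _ hz.2 (e p₀).2
    rw [← h1 _ (e.map_target hm), e.right_inv hm]
  · change e.symm (ψ.symm (ψ x₀), (e p₀).2) = p₀
    rw [hψ, ← hep, e.left_inv hp]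
  · have h3 := (contMDiff_snd.contMDiffAt.comp p₀ (he.contMDiffAt (e.open_source.mem_nhds hp)))
    exact ((contMDiff_mul_left (I := 𝓘(ℝ, E_K)) (n := ∞) (a := (e p₀).2⁻¹)).contMDiffAt.comp p₀
      h3).mdifferentiableAt (by simp)
  · have hc : ContinuousAt Q.proj p₀ := Q.contMDiff_proj.continuous.continuousAt
    filter_upwards [e.open_source.mem_nhds hp, hc (extChartAt_source_mem_nhds (I := 𝓘(ℝ, E_M)) x₀)]
      with q hq hq2
    have hqU : Q.proj q ∈ U := by rw [hs] at hq; exact hq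
    have hm := hmem _ hqU (e p₀).2
    have e1 : ψ.symm (ψ (Q.proj q)) = Q.proj q := ψ.left_inv hq2
    rw [e1]
    have hpr : Q.proj (e.symm (Q.proj q, (e p₀).2)) = Q.proj q := by
      rw [← h1 _ (e.map_target hm), e.right_inv hm]
    have hm2 : Q.act (e.symm (Q.proj q, (e p₀).2)) ((e p₀).2⁻¹ * (e q).2) ∈ e.source := by
      rw [hs]; change Q.proj _ ∈ U; rwa [Q.proj_act, hpr]
    refine e.injOn hq hm2 (Prod.ext ?_ ?_)
    · rw [h1 _ hq, h1 _ hm2, Q.proj_act, hpr]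
    · rw [h2 _ (e.map_target hm), e.right_inv hm, mul_inv_cancel_left]

end SmoothPrincipalBundle

end AssociatedSections

/-! ### The covariant derivative on `TM` induced by `A`. -/

section InducedConnection

variable {E_K : Type*} [NormedAddCommGroup E_K] [NormedSpace ℝ E_K] [FiniteDimensional ℝ E_K]
  {K : Type*} [TopologicalSpace K] [ChartedSpace E_K K] [Group K] [LieGroup 𝓘(ℝ, E_K) ∞ K]
  {E_P : Type*} [NormedAddCommGroup E_P] [NormedSpace ℝ E_P] [FiniteDimensional ℝ E_P]
  {P : Type*} [TopologicalSpace P] [ChartedSpace E_P P] [IsManifold 𝓘(ℝ, E_P) ∞ P]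
  {E_M : Type*} [NormedAddCommGroup E_M] [NormedSpace ℝ E_M] [FiniteDimensional ℝ E_M]
  {M : Type*} [TopologicalSpace M] [ChartedSpace E_M M] [IsManifold 𝓘(ℝ, E_M) ∞ M]

namespace SmoothPrincipalBundle

variable {Q : SmoothPrincipalBundle E_K K E_P P E_M M}

section LocalSections

variable {x₀ : M} {s : Set E_M} {f : E_M → P}

theorem IsLocalSection.contMDiffAt (h : IsLocalSection Q x₀ s f) {z : E_M} (hz : z ∈ s) :
    ContMDiffAt 𝓘(ℝ, E_M) 𝓘(ℝ, E_P) ∞ f z :=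
  h.contMDiffOn.contMDiffAt (h.isOpen.mem_nhds hz)

theorem IsLocalSection.dpr_mdiff (h : IsLocalSection Q x₀ s f) {z : E_M} (hz : z ∈ s) (ζ : E_M) :
    Q.dpr (f z) (mdiff f z ζ) = mdiff (extChartAt 𝓘(ℝ, E_M) x₀).symm z ζ := by
  have h1 := mfderiv_comp z (g := Q.proj) (f := f) (I := 𝓘(ℝ, E_M))
    (I' := 𝓘(ℝ, E_P)) (I'' := 𝓘(ℝ, E_M)) ((Q.contMDiff_proj _).mdifferentiableAt (by simp))
    ((h.contMDiffAt hz).mdifferentiableAt (by simp))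
  have h2 : Q.proj ∘ f =ᶠ[nhds z] (extChartAt 𝓘(ℝ, E_M) x₀).symm :=
    Filter.eventually_of_mem (h.isOpen.mem_nhds hz) h.proj_eq
  rw [h2.mfderiv_eq] at h1
  exact (DFunLike.congr_fun h1 ζ).symm

end LocalSections

namespace TensorialIso

variable {A : Q.Connection} {br : E_K →L[ℝ] E_K →L[ℝ] E_K} {x₀ : M} {s : Set E_M} {f : E_M → P}

theorem mpull_oneForm (α : TensorialIso A) (h : IsLocalSection Q x₀ s f) {z : E_M} (hz : z ∈ s) (ζ : E_M) :
    mpull f α.oneForm z ζ = α.iso (f z) (mdiff (extChartAt 𝓘(ℝ, E_M) x₀).symm z ζ) := by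
  rw [← h.dpr_mdiff hz, α.iso_dpr]
  rfl

theorem sec_localSection (α : TensorialIso A) (h : IsLocalSection Q x₀ s f)
    (Y : ∀ x : M, TangentSpace 𝓘(ℝ, E_M) x) {z : E_M} (hz : z ∈ s) :
    α.sec Y (f z) = mpull f α.oneForm z (vrep x₀ Y z) := by
  have h1 : ∀ x y : M, x = y → (Y x : E_M) = Y y := by rintro x _ rfl; rfl
  rw [α.mpull_oneForm h hz, mdiff_vrep (h.subset hz)]
  exact congrArg (α.iso (f z)) (h1 _ _ (h.proj_eq z hz))

theorem isInvertible_mpull_oneForm (α : TensorialIso A) (h : IsLocalSection Q x₀ s f) {z : E_M} (hz : z ∈ s) :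
    (mpull f α.oneForm z).IsInvertible := by
  obtain ⟨e, he⟩ := isInvertible_mdiff_chart_symm (h.subset hz)
  refine ⟨e.trans (α.iso (f z)), ?_⟩
  ext ζ
  rw [α.mpull_oneForm h hz, ← he]
  rfl

theorem contDiffAt_mpull_oneForm (α : TensorialIso A) (h : IsLocalSection Q x₀ s f) {z : E_M} (hz : z ∈ s) :
    ContDiffAt ℝ ∞ (mpull f α.oneForm) z :=
  (α.smoothForm.contDiffOn_mpull h.isOpen h.contMDiffOn).contDiffAt (h.isOpen.mem_nhds hz)

theorem contDiffAt_mpull_connection (A : Q.Connection) (h : IsLocalSection Q x₀ s f) {z : E_M} (hz : z ∈ s) :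
    ContDiffAt ℝ ∞ (mpull f A.oneForm) z :=
  (A.smoothForm.contDiffOn_mpull h.isOpen h.contMDiffOn).contDiffAt (h.isOpen.mem_nhds hz)

/-- On a local section `f` the function `sec Y` is `(f^* α)(Y)`, which is differentiable; off the
section it is recovered by equivariance as `ad_{κ(q)⁻¹}` of its value on the section. -/
theorem mdifferentiableAt_sec (α : TensorialIso A) (hbr : IsAdBracket K br)
    {Y : ∀ x : M, TangentSpace 𝓘(ℝ, E_M) x} {p : P}
    (hY : MDifferentiableAt 𝓘(ℝ, E_M) 𝓘(ℝ, E_M).tangent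
      (fun x ↦ (⟨x, Y x⟩ : TangentBundle 𝓘(ℝ, E_M) M)) (Q.proj p)) :
    MDifferentiableAt 𝓘(ℝ, E_P) 𝓘(ℝ, E_K) (α.sec Y) p := by
  obtain ⟨s, f, hs, hfp, κ, hκ, hκ1, hq⟩ := exists_isLocalSection (Q := Q) p
  set ψ := extChartAt 𝓘(ℝ, E_M) (Q.proj p) with hψ
  have hto : ψ.symm (ψ (Q.proj p)) = Q.proj p := extChartAt_to_inv _
  have hπ : MDifferentiableAt 𝓘(ℝ, E_P) 𝓘(ℝ, E_M) (fun q ↦ ψ (Q.proj q)) p :=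
    (mdifferentiableAt_extChartAt (I := 𝓘(ℝ, E_M)) (mem_chart_source _ _)).comp p
      ((Q.contMDiff_proj p).mdifferentiableAt (by simp))
  have hd : DifferentiableAt ℝ (fun z ↦ mpull f α.oneForm z (vrep (Q.proj p) Y z)) (ψ (Q.proj p)) :=
    ((α.contDiffAt_mpull_oneForm hs hs.mem).differentiableAt (by simp)).clm_apply
      (differentiableAt_vrep (mem_extChartAt_target _) (by rw [← hψ, hto]; exact hY))
  have h1 : MDifferentiableAt 𝓘(ℝ, E_P) 𝓘(ℝ, E_K)
      (fun q ↦ mpull f α.oneForm (ψ (Q.proj q)) (vrep (Q.proj p) Y (ψ (Q.proj q)))) p :=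
    MDifferentiableAt.comp (f := fun q ↦ ψ (Q.proj q)) p hd.mdifferentiableAt hπ
  have h2 : MDifferentiableAt 𝓘(ℝ, E_P) 𝓘(ℝ, E_K →L[ℝ] E_K) (fun q ↦ adCLM E_K (κ q)⁻¹) p := by
    refine MDifferentiableAt.comp (g := fun k : K ↦ adCLM E_K k⁻¹) (I' := 𝓘(ℝ, E_K)) p ?_ hκ
    -- `IsAdBracket` gives differentiability of `k ↦ ad_{k⁻¹}` only at `k = 1`, hence the
    -- normalization of `κ`.
    rw [hκ1]
    exact hbr.hasMFDerivAt.mdifferentiableAt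
  refine (h2.clm_apply h1).congr_of_eventuallyEq ?_
  filter_upwards [hq, hπ.continuousAt (hs.isOpen.mem_nhds hs.mem)] with q hq1 hq2
  conv_lhs => rw [hq1, sec_act]
  rw [α.sec_localSection hs Y hq2]

/-- The differential of `sec Y`. -/
def dsec (α : TensorialIso A) (Y : ∀ x : M, TangentSpace 𝓘(ℝ, E_M) x) (p : P) : E_P →L[ℝ] E_K :=
  mfderiv 𝓘(ℝ, E_P) 𝓘(ℝ, E_K) (α.sec Y) p

/-- The derivative at `k = 1` of the equivariance `sec Y (pk) = ad_{k⁻¹}(sec Y p)`. -/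
theorem dsec_vert (α : TensorialIso A) (hbr : IsAdBracket K br)
    {Y : ∀ x : M, TangentSpace 𝓘(ℝ, E_M) x} {p : P}
    (hY : MDifferentiableAt 𝓘(ℝ, E_M) 𝓘(ℝ, E_M).tangent
      (fun x ↦ (⟨x, Y x⟩ : TangentBundle 𝓘(ℝ, E_M) M)) (Q.proj p)) (X : E_K) :
    α.dsec Y p (Q.vert p X) = -br X (α.sec Y p) := by
  have hd := α.mdifferentiableAt_sec hbr hY
  have h1 : HasMFDerivAt 𝓘(ℝ, E_P) 𝓘(ℝ, E_K) (α.sec Y) (Q.act p 1) (α.dsec Y p) := by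
    rw [Q.act_one]; exact hd.hasMFDerivAt
  have h2 := (h1.comp (1 : K) (f := fun k ↦ Q.act p k)
    ((Q.contMDiff_act_left p 1).mdifferentiableAt (by simp)).hasMFDerivAt).mfderiv
  have h3 : α.sec Y ∘ (fun k ↦ Q.act p k) = fun k ↦ adCLM E_K k⁻¹ (α.sec Y p) :=
    funext fun k ↦ α.sec_act Y k p
  rw [h3, (hbr.hasMFDerivAt_apply (α.sec Y p)).mfderiv] at h2
  exact (DFunLike.congr_fun h2 X).symm

theorem dsec_dright (α : TensorialIso A) (hbr : IsAdBracket K br)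
    {Y : ∀ x : M, TangentSpace 𝓘(ℝ, E_M) x} {p : P}
    (hY : MDifferentiableAt 𝓘(ℝ, E_M) 𝓘(ℝ, E_M).tangent
      (fun x ↦ (⟨x, Y x⟩ : TangentBundle 𝓘(ℝ, E_M) M)) (Q.proj p)) (k : K) (v : E_P) :
    α.dsec Y (Q.act p k) (Q.dright k p v) = adCLM E_K k⁻¹ (α.dsec Y p v) := by
  have hd := α.mdifferentiableAt_sec hbr hY
  have hd' := α.mdifferentiableAt_sec hbr (p := Q.act p k) (by rw [Q.proj_act]; exact hY)
  have h2 := mfderiv_comp p hd' ((Q.contMDiff_act_right k p).mdifferentiableAt (by simp))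
  have h3 : α.sec Y ∘ (fun q ↦ Q.act q k) = fun q ↦ adCLM E_K k⁻¹ (α.sec Y q) :=
    funext fun q ↦ α.sec_act Y k q
  have h4 : mfderiv 𝓘(ℝ, E_P) 𝓘(ℝ, E_K) (fun q ↦ adCLM E_K k⁻¹ (α.sec Y q)) p =
      (adCLM E_K k⁻¹).comp (α.dsec Y p) :=
    ((adCLM E_K k⁻¹).hasMFDerivAt.comp p hd.hasMFDerivAt).mfderiv
  rw [h3, h4] at h2
  exact (DFunLike.congr_fun h2 v).symm

theorem fderiv_mpull_vrep (α : TensorialIso A) (hbr : IsAdBracket K br) (h : IsLocalSection Q x₀ s f)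
    {Y : ∀ x : M, TangentSpace 𝓘(ℝ, E_M) x} {z : E_M} (hz : z ∈ s)
    (hY : MDifferentiableAt 𝓘(ℝ, E_M) 𝓘(ℝ, E_M).tangent
      (fun x ↦ (⟨x, Y x⟩ : TangentBundle 𝓘(ℝ, E_M) M)) ((extChartAt 𝓘(ℝ, E_M) x₀).symm z)) (ζ : E_M) :
    fderiv ℝ (fun z ↦ mpull f α.oneForm z (vrep x₀ Y z)) z ζ = α.dsec Y (f z) (mdiff f z ζ) := by
  have h1 : (fun z ↦ mpull f α.oneForm z (vrep x₀ Y z)) =ᶠ[nhds z] α.sec Y ∘ f :=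
    Filter.eventually_of_mem (h.isOpen.mem_nhds hz) fun y hy ↦ (α.sec_localSection h Y hy).symm
  rw [h1.fderiv_eq, ← mfderiv_eq_fderiv, mfderiv_comp z
    (α.mdifferentiableAt_sec hbr (by rw [h.proj_eq z hz]; exact hY))
    ((h.contMDiffAt hz).mdifferentiableAt (by simp))]
  rfl

/-- The covariant derivative on `TM` which corresponds to the connection `A` under the isomorphism
`TM → ad(P)`. -/
def cov (α : TensorialIso A) (Y : ∀ x : M, TangentSpace 𝓘(ℝ, E_M) x) (x : M) :
    TangentSpace 𝓘(ℝ, E_M) x →L[ℝ] TangentSpace 𝓘(ℝ, E_M) x :=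
  let p := (Q.proj_surjective x).choose
  ((α.iso p).symm.toContinuousLinearMap.comp ((α.dsec Y p).comp (α.horL p)) : E_M →L[ℝ] E_M)

/-- The definition of `cov` picks one point of each fibre. By equivariance of `iso`, of horizontal
lifts and of `dsec`, the same formula holds at every point of the fibre. -/
theorem iso_cov (α : TensorialIso A) (hbr : IsAdBracket K br)
    {Y : ∀ x : M, TangentSpace 𝓘(ℝ, E_M) x} {p : P}
    (hY : MDifferentiableAt 𝓘(ℝ, E_M) 𝓘(ℝ, E_M).tangent
      (fun x ↦ (⟨x, Y x⟩ : TangentBundle 𝓘(ℝ, E_M) M)) (Q.proj p)) (v : E_M) :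
    α.iso p (α.cov Y (Q.proj p) v) = α.dsec Y p (hor A p v) := by
  have hq := (Q.proj_surjective (Q.proj p)).choose_spec
  set q := (Q.proj_surjective (Q.proj p)).choose with hqd
  change α.iso p ((α.iso q).symm (α.dsec Y q (hor A q v))) = _
  -- With its value forgotten, the chosen point is an arbitrary point `q` of the fibre, and `p = q
  -- k` for some `k`.
  clear_value q
  obtain ⟨k, rfl⟩ := proj_eq_iff.1 hq
  rw [α.iso_act, ContinuousLinearEquiv.apply_symm_apply, α.hor_act,
    α.dsec_dright hbr (by rw [hq]; exact hY)]

/-- The covariant derivative in the trivialization given by a local section. -/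
theorem mpull_cov (α : TensorialIso A) (hbr : IsAdBracket K br) (h : IsLocalSection Q x₀ s f)
    {Y : ∀ x : M, TangentSpace 𝓘(ℝ, E_M) x} {z : E_M} (hz : z ∈ s)
    (hY : MDifferentiableAt 𝓘(ℝ, E_M) 𝓘(ℝ, E_M).tangent
      (fun x ↦ (⟨x, Y x⟩ : TangentBundle 𝓘(ℝ, E_M) M)) ((extChartAt 𝓘(ℝ, E_M) x₀).symm z)) (ζ : E_M) :
    α.iso (f z) (α.cov Y ((extChartAt 𝓘(ℝ, E_M) x₀).symm z)
        (mdiff (extChartAt 𝓘(ℝ, E_M) x₀).symm z ζ : E_M)) =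
      fderiv ℝ (fun z ↦ mpull f α.oneForm z (vrep x₀ Y z)) z ζ +
        br (mpull f A.oneForm z ζ) (mpull f α.oneForm z (vrep x₀ Y z)) := by
  have hp := h.proj_eq z hz
  have h1 : ∀ x y : M, x = y → ∀ v : E_M, (α.cov Y x v : E_M) = α.cov Y y v := by
    rintro x _ rfl v; rfl
  have hY' : MDifferentiableAt 𝓘(ℝ, E_M) 𝓘(ℝ, E_M).tangent
      (fun x ↦ (⟨x, Y x⟩ : TangentBundle 𝓘(ℝ, E_M) M)) (Q.proj (f z)) := by rw [hp]; exact hY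
  refine (congrArg (α.iso (f z)) (h1 _ _ hp.symm _)).trans ((α.iso_cov hbr hY' _).trans ?_)
  -- The horizontal lift is `f_* ζ - (a(ζ))^#` with `a = f^* ω`; `dsec_vert` turns the vertical
  -- correction into `+[a(ζ), s]`.
  rw [α.fderiv_mpull_vrep hbr h hz hY, ← h.dpr_mdiff hz, α.hor_dpr, map_sub,
    α.dsec_vert hbr hY', α.sec_localSection h Y hz, sub_neg_eq_add]
  rfl

end TensorialIso

end SmoothPrincipalBundle

end InducedConnection

/-! ### The induced covariant derivative: Leibniz rule, torsion, smoothness. -/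

section LeviCivitaConnection

theorem HasMFDerivAt.bilinear {E N F G H : Type*} [NormedAddCommGroup E] [NormedSpace ℝ E]
    [TopologicalSpace N] [ChartedSpace E N] [NormedAddCommGroup F] [NormedSpace ℝ F]
    [NormedAddCommGroup G] [NormedSpace ℝ G] [NormedAddCommGroup H] [NormedSpace ℝ H]
    (b : F →L[ℝ] G →L[ℝ] H) {u : N → F} {v : N → G} {p : N} {u' : E →L[ℝ] F} {v' : E →L[ℝ] G}
    (hu : HasMFDerivAt 𝓘(ℝ, E) 𝓘(ℝ, F) u p u') (hv : HasMFDerivAt 𝓘(ℝ, E) 𝓘(ℝ, G) v p v') :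
    HasMFDerivAt 𝓘(ℝ, E) 𝓘(ℝ, H) (fun q ↦ b (u q) (v q)) p
      ((b (u p)).comp v' + (b.flip (v p)).comp u' : E →L[ℝ] H) := by
  refine ⟨((b.continuous.continuousAt.comp hu.1).clm_apply hv.1), ?_⟩
  have h := (b.hasFDerivAt.comp_hasFDerivWithinAt _ hu.2).clm_apply hv.2
  refine h.congr_fderiv ?_
  ext w
  simp [writtenInExtChartAt]
  rfl

variable {E_K : Type*} [NormedAddCommGroup E_K] [NormedSpace ℝ E_K] [FiniteDimensional ℝ E_K]
  {K : Type*} [TopologicalSpace K] [ChartedSpace E_K K] [Group K] [LieGroup 𝓘(ℝ, E_K) ∞ K]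
  {E_P : Type*} [NormedAddCommGroup E_P] [NormedSpace ℝ E_P] [FiniteDimensional ℝ E_P]
  {P : Type*} [TopologicalSpace P] [ChartedSpace E_P P] [IsManifold 𝓘(ℝ, E_P) ∞ P]
  {E_M : Type*} [NormedAddCommGroup E_M] [NormedSpace ℝ E_M] [FiniteDimensional ℝ E_M]
  {M : Type*} [TopologicalSpace M] [ChartedSpace E_M M] [IsManifold 𝓘(ℝ, E_M) ∞ M]

namespace SmoothPrincipalBundle

namespace TensorialIso

variable {Q : SmoothPrincipalBundle E_K K E_P P E_M M}
  {A : Q.Connection} {br : E_K →L[ℝ] E_K →L[ℝ] E_K} {x₀ : M} {s : Set E_M} {f : E_M → P}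
  {X Y Z : ∀ x : M, TangentSpace 𝓘(ℝ, E_M) x}

theorem sec_cov_localSection (α : TensorialIso A) (hbr : IsAdBracket K br) (h : IsLocalSection Q x₀ s f)
    (X : ∀ x : M, TangentSpace 𝓘(ℝ, E_M) x) {z : E_M} (hz : z ∈ s)
    (hY : MDifferentiableAt 𝓘(ℝ, E_M) 𝓘(ℝ, E_M).tangent
      (fun x ↦ (⟨x, Y x⟩ : TangentBundle 𝓘(ℝ, E_M) M)) ((extChartAt 𝓘(ℝ, E_M) x₀).symm z)) :
    α.sec (fun x ↦ α.cov Y x (X x)) (f z) = gaugeDeriv br (mpull f A.oneForm) (vrep x₀ X)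
      (fun z ↦ mpull f α.oneForm z (vrep x₀ Y z)) z := by
  have h1 : ∀ x y : M, x = y → (α.cov Y x (X x) : E_M) = α.cov Y y (X y) := by
    rintro x _ rfl; rfl
  have h2 : (α.cov Y ((extChartAt 𝓘(ℝ, E_M) x₀).symm z) (X ((extChartAt 𝓘(ℝ, E_M) x₀).symm z)) : E_M) =
      α.cov Y ((extChartAt 𝓘(ℝ, E_M) x₀).symm z)
        (mdiff (extChartAt 𝓘(ℝ, E_M) x₀).symm z (vrep x₀ X z) : E_M) :=
    congrArg (α.cov Y ((extChartAt 𝓘(ℝ, E_M) x₀).symm z)) (mdiff_vrep (h.subset hz) X).symm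
  refine (congrArg (α.iso (f z)) ((h1 _ _ (h.proj_eq z hz)).trans h2)).trans ?_
  exact α.mpull_cov hbr h hz hY _

/-- Each axiom is checked in `𝔨` after applying the injective map `iso p`; the Leibniz rule comes
from `sec (g Y) = (g ∘ π) sec Y` and from `dπ` being inverse to the horizontal lift. -/
theorem isCovariantDerivativeOn_cov (α : TensorialIso A) (hbr : IsAdBracket K br) :
    IsCovariantDerivativeOn E_M (V := (TangentSpace 𝓘(ℝ, E_M) : M → Type _)) α.cov where
  add {Y Z x} hY hZ _ := by
    obtain ⟨p, rfl⟩ := Q.proj_surjective x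
    ext v
    apply (α.iso p).injective
    have hYZ := mdifferentiableAt_add_section hY hZ
    have h1 : α.sec (Y + Z) = fun q ↦ α.sec Y q + α.sec Z q := funext fun q ↦ map_add (α.iso q) _ _
    have h2 : α.dsec (Y + Z) p = α.dsec Y p + α.dsec Z p := by
      rw [dsec, h1]
      exact mfderiv_add (α.mdifferentiableAt_sec hbr hY) (α.mdifferentiableAt_sec hbr hZ)
    refine (α.iso_cov hbr hYZ v).trans ?_
    rw [h2]
    refine Eq.trans ?_ (map_add (α.iso p) _ _).symm
    exact (congrArg₂ (· + ·) (α.iso_cov hbr hY v) (α.iso_cov hbr hZ v)).symm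
  leibniz {Y g x} hY hg _ := by
    obtain ⟨p, rfl⟩ := Q.proj_surjective x
    ext v
    apply (α.iso p).injective
    have hgY := hg.smul_section hY
    have h1 : α.sec (g • Y) = fun q ↦ g (Q.proj q) • α.sec Y q :=
      funext fun q ↦ map_smul (α.iso q) _ _
    have hπ : MDifferentiableAt 𝓘(ℝ, E_P) 𝓘(ℝ, E_M) Q.proj p :=
      (Q.contMDiff_proj p).mdifferentiableAt (by simp)
    have h2 := (HasMFDerivAt.bilinear (ContinuousLinearMap.lsmul ℝ ℝ) (hg.hasMFDerivAt.comp p hπ.hasMFDerivAt)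
      (α.mdifferentiableAt_sec hbr hY).hasMFDerivAt).mfderiv
    refine (α.iso_cov hbr hgY v).trans ?_
    rw [dsec, h1]
    refine (DFunLike.congr_fun h2 (hor A p v)).trans ?_
    refine Eq.trans ?_ (map_add (α.iso p) _ _).symm
    refine congrArg₂ (fun a b : E_K ↦ a + b) ?_ ?_
    · exact (congrArg (g (Q.proj p) • ·) (α.iso_cov hbr hY v).symm).trans
        (map_smul (α.iso p) (g (Q.proj p)) (α.cov Y (Q.proj p) v)).symm
    · refine Eq.trans ?_ (map_smul (α.iso p) _ _).symm
      exact congrArg (fun t : E_M ↦ (show E_M →L[ℝ] ℝ from mfderiv 𝓘(ℝ, E_M) 𝓘(ℝ, ℝ) g (Q.proj p)) t • α.sec Y p)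
        (dpr_hor A p v)

/-- `TensorialIso.cov` as a bundled covariant derivative. -/
def covariantDerivative (α : TensorialIso A) (hbr : IsAdBracket K br) :
    CovariantDerivative 𝓘(ℝ, E_M) E_M (TangentSpace 𝓘(ℝ, E_M) : M → Type _) :=
  ⟨α.cov, α.isCovariantDerivativeOn_cov hbr⟩

/-- Torsion-freeness is the equation `d_A α = 0` read along a local section: `extd_fields` expresses
`X(α Y) - Y(α X) - α[X, Y]` as `dα(X, Y)`, and the second structure equation supplies exactly the
bracket terms of the two covariant derivatives. -/
theorem sec_torsion (α : TensorialIso A) (hbr : IsAdBracket K br) (hJ : IsIntegrable α.almostComplex)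
    {p : P}
    (hX : MDifferentiableAt 𝓘(ℝ, E_M) 𝓘(ℝ, E_M).tangent
      (fun x ↦ (⟨x, X x⟩ : TangentBundle 𝓘(ℝ, E_M) M)) (Q.proj p))
    (hY : MDifferentiableAt 𝓘(ℝ, E_M) 𝓘(ℝ, E_M).tangent
      (fun x ↦ (⟨x, Y x⟩ : TangentBundle 𝓘(ℝ, E_M) M)) (Q.proj p)) :
    α.sec (fun x ↦ α.cov Y x (X x)) p - α.sec (fun x ↦ α.cov X x (Y x)) p =
      α.sec (VectorField.mlieBracket 𝓘(ℝ, E_M) X Y) p := by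
  obtain ⟨s, f, hs, hfp, -⟩ := exists_isLocalSection (Q := Q) p
  set x₀ := Q.proj p
  set z := extChartAt 𝓘(ℝ, E_M) x₀ x₀
  have hz : z ∈ s := hs.mem
  have hto : (extChartAt 𝓘(ℝ, E_M) x₀).symm z = x₀ := extChartAt_to_inv _
  rw [← hto] at hX hY
  rw [← hfp, α.sec_cov_localSection hbr hs _ hz hY, α.sec_cov_localSection hbr hs _ hz hX,
    α.sec_localSection hs _ hz, vrep_mlieBracket (hs.subset hz) hX hY, gaugeDeriv, gaugeDeriv,
    sub_eq_iff_eq_add]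
  have h1 := extd_fields ((α.contDiffAt_mpull_oneForm hs hz).differentiableAt (by simp))
    (differentiableAt_vrep (hs.subset hz) hX) (differentiableAt_vrep (hs.subset hz) hY)
  rw [mextd_mpull α.smoothForm hs.isOpen hs.contMDiffOn hz, (α.structure_equations hbr hJ _ _ _).2] at h1
  rw [sub_eq_iff_eq_add, sub_eq_iff_eq_add] at h1
  rw [h1]
  change br (mpull f A.oneForm z _) (mpull f α.oneForm z _) -
    br (mpull f A.oneForm z _) (mpull f α.oneForm z _) + _ + _ + _ = _
  abel

theorem torsion_covariantDerivative (α : TensorialIso A) (hbr : IsAdBracket K br)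
    (hJ : IsIntegrable α.almostComplex) : (α.covariantDerivative hbr).torsion = 0 := by
  rw [CovariantDerivative.torsion_eq_zero_iff]
  intro X Y x hX hY
  obtain ⟨p, rfl⟩ := Q.proj_surjective x
  exact (α.iso p).injective ((map_sub (α.iso p) _ _).trans (α.sec_torsion hbr hJ hX hY))

/-- Smoothness is tested in the coordinates of `TM` centred at `x₀`, where `mpull_cov` gives an
explicit formula. -/
theorem contMDiff_cov (α : TensorialIso A) (hbr : IsAdBracket K br)
    (hY : ContMDiff 𝓘(ℝ, E_M) 𝓘(ℝ, E_M).tangent ∞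
      (fun x ↦ (⟨x, Y x⟩ : TangentBundle 𝓘(ℝ, E_M) M))) :
    ContMDiff 𝓘(ℝ, E_M) (𝓘(ℝ, E_M).prod 𝓘(ℝ, E_M →L[ℝ] E_M)) ∞
      (fun x ↦ (⟨x, α.cov Y x⟩ : Bundle.TotalSpace (E_M →L[ℝ] E_M)
        fun x : M ↦ TangentSpace 𝓘(ℝ, E_M) x →L[ℝ] TangentSpace 𝓘(ℝ, E_M) x)) := by
  intro x
  obtain ⟨p, rfl⟩ := Q.proj_surjective x
  obtain ⟨s, f, hs, hfp, -⟩ := exists_isLocalSection (Q := Q) p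
  rw [contMDiffAt_hom_bundle]
  refine ⟨contMDiffAt_id, ?_⟩
  dsimp only
  have : IsManifold 𝓘(ℝ, E_M) 1 M := .of_le (n := ∞) (by simp)
  set x₀ := Q.proj p
  set ψ := extChartAt 𝓘(ℝ, E_M) x₀
  let s' : E_M → E_K := fun z ↦ mpull f α.oneForm z (vrep x₀ Y z)
  -- The chart representative of `∇Y`: the formula `ds + [a, s]` of `mpull_cov`, brought back from
  -- `𝔨` by the inverse of `f^* α`. Inversion is smooth near an invertible map.
  let G : E_M → E_M →L[ℝ] E_M := fun z ↦ (mpull f α.oneForm z).inverse.comp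
    (fderiv ℝ s' z + (br.flip (s' z)).comp (mpull f A.oneForm z))
  have hs' : ContDiffAt ℝ ∞ s' (ψ x₀) :=
    (α.contDiffAt_mpull_oneForm hs hs.mem).clm_apply (contDiffAt_vrep (hs.subset hs.mem) hY)
  have hG : ContDiffAt ℝ ∞ G (ψ x₀) := by
    refine ContDiffAt.clm_comp ?_ (ContDiffAt.add (hs'.fderiv_right (m := ∞) (by simp))
      (ContDiffAt.clm_comp ?_ (contDiffAt_mpull_connection A hs hs.mem)))
    · obtain ⟨e, he⟩ := α.isInvertible_mpull_oneForm hs hs.mem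
      have := contDiffAt_map_inverse (𝕜 := ℝ) (n := ∞) e
      rw [he] at this
      exact this.comp _ (α.contDiffAt_mpull_oneForm hs hs.mem)
    · exact br.flip.contDiff.contDiffAt.comp _ hs'
  have hψ : ContMDiffAt 𝓘(ℝ, E_M) 𝓘(ℝ, E_M) ∞ ψ x₀ := contMDiffAt_extChartAt
  refine ContMDiffAt.congr_of_eventuallyEq (f := fun x ↦ G (ψ x)) (hG.contMDiffAt.comp x₀ hψ) ?_
  filter_upwards [hψ.continuousAt (hs.isOpen.mem_nhds hs.mem),
    extChartAt_source_mem_nhds (I := 𝓘(ℝ, E_M)) x₀] with y hy hys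
  have hyc : y ∈ (chartAt E_M x₀).source := by simpa using hys
  rw [ContinuousLinearMap.inCoordinates, TangentBundle.continuousLinearMapAt_trivializationAt hyc,
    TangentBundle.symmL_trivializationAt hyc, ModelWithCorners.range_eq_univ, mfderivWithin_univ]
  obtain ⟨e, he⟩ := α.isInvertible_mpull_oneForm hs hy
  have hyy : ψ.symm (ψ y) = y := ψ.left_inv hys
  have hYy := (hY (ψ.symm (ψ y))).mdifferentiableAt (by simp)
  have key : ∀ ζ : E_M, ∀ u : E_M, (mdiff ψ.symm (ψ y) u : E_M) =
      α.cov Y (ψ.symm (ψ y)) (mdiff ψ.symm (ψ y) ζ : E_M) → u = G (ψ y) ζ := by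
    intro ζ u hu
    have h1 := α.mpull_cov hbr hs hy hYy ζ
    rw [← hu, ← α.mpull_oneForm hs hy] at h1
    replace h1 : mpull f α.oneForm (ψ y) u =
      (fderiv ℝ s' (ψ y) + (br.flip (s' (ψ y))).comp (mpull f A.oneForm (ψ y))) ζ := h1
    change u = (mpull f α.oneForm (ψ y)).inverse
      ((fderiv ℝ s' (ψ y) + (br.flip (s' (ψ y))).comp (mpull f A.oneForm (ψ y))) ζ)
    rw [← h1, ← he, ContinuousLinearMap.inverse_equiv]
    exact (e.symm_apply_apply u).symm
  ext ζ
  refine key ζ _ ?_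
  have h5 : ∀ x : M, x = y → (mdiff ψ.symm (ψ y) (mfderiv 𝓘(ℝ, E_M) 𝓘(ℝ, E_M) ψ y
      (α.cov Y y (mdiff ψ.symm (ψ y) ζ : E_M)) : E_M) : E_M) = α.cov Y x (mdiff ψ.symm (ψ y) ζ : E_M) := by
    rintro x rfl
    have h6 := mfderivWithin_extChartAt_symm_comp_mfderiv_extChartAt' (I := 𝓘(ℝ, E_M)) hys
    rw [ModelWithCorners.range_eq_univ, mfderivWithin_univ] at h6
    exact DFunLike.congr_fun h6 _
  exact h5 _ hyy

end TensorialIso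

end SmoothPrincipalBundle

end LeviCivitaConnection

/-! ### Curvature, metric compatibility and constant sectional curvature. -/

section SectionalCurvature

variable {E_K : Type*} [NormedAddCommGroup E_K] [NormedSpace ℝ E_K] [FiniteDimensional ℝ E_K]
  {K : Type*} [TopologicalSpace K] [ChartedSpace E_K K] [Group K] [LieGroup 𝓘(ℝ, E_K) ∞ K]
  {E_P : Type*} [NormedAddCommGroup E_P] [NormedSpace ℝ E_P] [FiniteDimensional ℝ E_P]
  {P : Type*} [TopologicalSpace P] [ChartedSpace E_P P] [IsManifold 𝓘(ℝ, E_P) ∞ P]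
  {E_M : Type*} [NormedAddCommGroup E_M] [NormedSpace ℝ E_M] [FiniteDimensional ℝ E_M]
  {M : Type*} [TopologicalSpace M] [ChartedSpace E_M M] [IsManifold 𝓘(ℝ, E_M) ∞ M]

namespace SmoothPrincipalBundle

namespace TensorialIso

variable {Q : SmoothPrincipalBundle E_K K E_P P E_M M}
  {A : Q.Connection} {br : E_K →L[ℝ] E_K →L[ℝ] E_K}
  {X Y Z : ∀ x : M, TangentSpace 𝓘(ℝ, E_M) x}

theorem mdifferentiableAt_cov (α : TensorialIso A) (hbr : IsAdBracket K br)
    (hX : ContMDiff 𝓘(ℝ, E_M) 𝓘(ℝ, E_M).tangent ∞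
      (fun x ↦ (⟨x, X x⟩ : TangentBundle 𝓘(ℝ, E_M) M)))
    (hY : ContMDiff 𝓘(ℝ, E_M) 𝓘(ℝ, E_M).tangent ∞
      (fun x ↦ (⟨x, Y x⟩ : TangentBundle 𝓘(ℝ, E_M) M))) (x : M) :
    MDifferentiableAt 𝓘(ℝ, E_M) 𝓘(ℝ, E_M).tangent
      (fun x ↦ (⟨x, α.cov Y x (X x)⟩ : TangentBundle 𝓘(ℝ, E_M) M)) x := by
  have : IsManifold 𝓘(ℝ, E_M) 1 M := .of_le (n := ∞) (by simp)
  exact ((ContMDiff.clm_bundle_apply (α.contMDiff_cov hbr hY) hX) x).mdifferentiableAt (by simp)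

/-- The curvature of `TM` corresponds to the double bracket. -/
theorem sec_curvature (α : TensorialIso A) (hbr : IsAdBracket K br) (hJ : IsIntegrable α.almostComplex)
    (hX : ContMDiff 𝓘(ℝ, E_M) 𝓘(ℝ, E_M).tangent ∞
      (fun x ↦ (⟨x, X x⟩ : TangentBundle 𝓘(ℝ, E_M) M)))
    (hY : ContMDiff 𝓘(ℝ, E_M) 𝓘(ℝ, E_M).tangent ∞
      (fun x ↦ (⟨x, Y x⟩ : TangentBundle 𝓘(ℝ, E_M) M)))
    (hZ : ContMDiff 𝓘(ℝ, E_M) 𝓘(ℝ, E_M).tangent ∞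
      (fun x ↦ (⟨x, Z x⟩ : TangentBundle 𝓘(ℝ, E_M) M))) (p : P) :
    α.sec (curvature (α.covariantDerivative hbr) X Y Z) p =
      br (br (α.sec X p) (α.sec Y p)) (α.sec Z p) := by
  obtain ⟨s, f, hs, hfp, -⟩ := exists_isLocalSection (Q := Q) p
  set x₀ := Q.proj p
  set z := extChartAt 𝓘(ℝ, E_M) x₀ x₀
  have hz : z ∈ s := hs.mem
  have hd : ∀ {W : ∀ x : M, TangentSpace 𝓘(ℝ, E_M) x}, ContMDiff 𝓘(ℝ, E_M) 𝓘(ℝ, E_M).tangent ∞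
      (fun x ↦ (⟨x, W x⟩ : TangentBundle 𝓘(ℝ, E_M) M)) → ∀ x, MDifferentiableAt 𝓘(ℝ, E_M)
      𝓘(ℝ, E_M).tangent (fun x ↦ (⟨x, W x⟩ : TangentBundle 𝓘(ℝ, E_M) M)) x :=
    fun h x ↦ (h x).mdifferentiableAt (by simp)
  -- The identity is needed on a neighbourhood of `z`, because the outer covariant derivative
  -- differentiates the inner one.
  have hcov : ∀ V : ∀ x : M, TangentSpace 𝓘(ℝ, E_M) x,
      (fun z ↦ mpull f α.oneForm z (vrep x₀ (fun x ↦ α.cov Z x (V x)) z)) =ᶠ[nhds z]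
        gaugeDeriv br (mpull f A.oneForm) (vrep x₀ V)
          (fun z ↦ mpull f α.oneForm z (vrep x₀ Z z)) := fun V ↦
    Filter.eventually_of_mem (hs.isOpen.mem_nhds hz) fun y hy ↦
      (α.sec_localSection hs _ hy).symm.trans (α.sec_cov_localSection hbr hs V hy (hd hZ _))
  have hlin : α.sec (curvature (α.covariantDerivative hbr) X Y Z) p =
      α.sec (fun x ↦ α.cov (fun y ↦ α.cov Z y (Y y)) x (X x)) p -
      α.sec (fun x ↦ α.cov (fun y ↦ α.cov Z y (X y)) x (Y x)) p -
      α.sec (fun x ↦ α.cov Z x (VectorField.mlieBracket 𝓘(ℝ, E_M) X Y x)) p :=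
    (map_sub (α.iso p) _ _).trans (congrArg (fun t : E_K ↦ t -
      α.sec (fun x ↦ α.cov Z x (VectorField.mlieBracket 𝓘(ℝ, E_M) X Y x)) p) (map_sub (α.iso p) _ _))
  rw [hlin, ← hfp,
    α.sec_cov_localSection hbr hs X hz (α.mdifferentiableAt_cov hbr hY hZ _),
    α.sec_cov_localSection hbr hs Y hz (α.mdifferentiableAt_cov hbr hX hZ _),
    α.sec_cov_localSection hbr hs _ hz (hd hZ _),
    gaugeDeriv_congr (hcov Y), gaugeDeriv_congr (hcov X)]
  have h1 : gaugeDeriv br (mpull f A.oneForm) (vrep x₀ (VectorField.mlieBracket 𝓘(ℝ, E_M) X Y))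
      (fun z ↦ mpull f α.oneForm z (vrep x₀ Z z)) z =
      gaugeDeriv br (mpull f A.oneForm) (VectorField.lieBracket ℝ (vrep x₀ X) (vrep x₀ Y))
      (fun z ↦ mpull f α.oneForm z (vrep x₀ Z z)) z := by
    rw [gaugeDeriv, gaugeDeriv, vrep_mlieBracket (hs.subset hz) (hd hX _) (hd hY _)]
  rw [h1, gaugeDeriv_curvature hbr.jacobi
    ((contDiffAt_mpull_connection A hs hz).differentiableAt (by simp))
    (((α.contDiffAt_mpull_oneForm hs hz).clm_apply
      (contDiffAt_vrep (hs.subset hz) hZ)).of_le two_le_infty)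
    ((contDiffAt_vrep (hs.subset hz) hX).differentiableAt (by simp))
    ((contDiffAt_vrep (hs.subset hz) hY).differentiableAt (by simp)),
    mextd_mpull A.smoothForm hs.isOpen hs.contMDiffOn hz, (α.structure_equations hbr hJ _ _ _).1,
    α.sec_localSection hs X hz, α.sec_localSection hs Y hz, α.sec_localSection hs Z hz]
  -- The structure equation gives `dω = [α, α] - [ω, ω]` on the two vectors, and the curvature adds
  -- `[ω, ω]`, so only `[α X, α Y]` remains.
  refine congrArg (fun t ↦ br t _) ?_
  exact sub_add_cancel _ _

variable {B : E_K →L[ℝ] E_K →L[ℝ] ℝ}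

/-- Two points of a fibre differ by some `k`, and `ad_k` preserves `B`; so the point chosen in the
definition of the metric is immaterial. -/
theorem inducedMetric_eq (α : TensorialIso A)
    (hB : ∀ (k : K) X Y, B (adCLM E_K k X) (adCLM E_K k Y) = B X Y) (p : P) (u v : E_M) :
    α.inducedMetric (fun X Y ↦ B X Y) (Q.proj p) u v = B (α.iso p u) (α.iso p v) := by
  have hq := (Q.proj_surjective (Q.proj p)).choose_spec
  set q := (Q.proj_surjective (Q.proj p)).choose with hqd
  change B (α.iso q u) (α.iso q v) = _
  clear_value q
  obtain ⟨k, rfl⟩ := proj_eq_iff.1 hq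
  rw [α.iso_act, α.iso_act, hB]

/-- On `P` the function `g(Y, Z) ∘ π` equals `B(sec Y, sec Z)`. Differentiating it along horizontal
lifts gives the claim by the product rule, since `∇` is the derivative of `sec` in horizontal
directions. -/
theorem metric_covariantDerivative (α : TensorialIso A) (hbr : IsAdBracket K br)
    (hB : ∀ (k : K) X Y, B (adCLM E_K k X) (adCLM E_K k Y) = B X Y)
    (hY : ContMDiff 𝓘(ℝ, E_M) 𝓘(ℝ, E_M).tangent ∞
      (fun x ↦ (⟨x, Y x⟩ : TangentBundle 𝓘(ℝ, E_M) M)))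
    (hZ : ContMDiff 𝓘(ℝ, E_M) 𝓘(ℝ, E_M).tangent ∞
      (fun x ↦ (⟨x, Z x⟩ : TangentBundle 𝓘(ℝ, E_M) M))) (x : M) (v : TangentSpace 𝓘(ℝ, E_M) x) :
    (mfderiv 𝓘(ℝ, E_M) 𝓘(ℝ, ℝ) (fun y ↦ α.inducedMetric (fun X Y ↦ B X Y) y (Y y) (Z y)) x v : ℝ) =
      α.inducedMetric (fun X Y ↦ B X Y) x (α.cov Y x v) (Z x) +
        α.inducedMetric (fun X Y ↦ B X Y) x (Y x) (α.cov Z x v) := by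
  obtain ⟨p, rfl⟩ := Q.proj_surjective x
  obtain ⟨s, f, hs, hfp, -⟩ := exists_isLocalSection (Q := Q) p
  have hY' := (hY (Q.proj p)).mdifferentiableAt (by simp)
  have hZ' := (hZ (Q.proj p)).mdifferentiableAt (by simp)
  let g : M → ℝ := fun y ↦ α.inducedMetric (fun X Y ↦ B X Y) y (Y y) (Z y)
  have hg : ∀ q, g (Q.proj q) = B (α.sec Y q) (α.sec Z q) := fun q ↦ α.inducedMetric_eq hB q _ _
  have h1 := HasMFDerivAt.bilinear B (α.mdifferentiableAt_sec hbr hY').hasMFDerivAt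
    (α.mdifferentiableAt_sec hbr hZ').hasMFDerivAt
  let ψ := extChartAt 𝓘(ℝ, E_M) (Q.proj p)
  have hψ : MDifferentiableAt 𝓘(ℝ, E_M) 𝓘(ℝ, E_M) ψ (Q.proj p) :=
    mdifferentiableAt_extChartAt (mem_chart_source _ _)
  have hf : MDifferentiableAt 𝓘(ℝ, E_M) 𝓘(ℝ, E_P) (fun y ↦ f (ψ y)) (Q.proj p) :=
    MDifferentiableAt.comp (g := f) (f := ψ) _ ((hs.contMDiffAt hs.mem).mdifferentiableAt (by simp)) hψ
  -- Differentiability is known only for `g ∘ π` on `P`; it descends to `M` by composing with the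
  -- local section.
  have hgd : MDifferentiableAt 𝓘(ℝ, E_M) 𝓘(ℝ, ℝ) g (Q.proj p) := by
    have h2 : MDifferentiableAt 𝓘(ℝ, E_P) 𝓘(ℝ, ℝ) (fun q ↦ B (α.sec Y q) (α.sec Z q))
        (f (ψ (Q.proj p))) := by
      rw [hfp]; exact h1.mdifferentiableAt
    refine (MDifferentiableAt.comp (f := fun y ↦ f (ψ y)) _ h2 hf).congr_of_eventuallyEq ?_
    filter_upwards [hψ.continuousAt (hs.isOpen.mem_nhds hs.mem),
      extChartAt_source_mem_nhds (I := 𝓘(ℝ, E_M)) (Q.proj p)] with y hy hys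
    have e : Q.proj (f (ψ y)) = y := (hs.proj_eq _ hy).trans (ψ.left_inv hys)
    exact (congrArg g e).symm.trans (hg _)
  have h3 := (hgd.hasMFDerivAt.comp p
    ((Q.contMDiff_proj p).mdifferentiableAt (by simp)).hasMFDerivAt).mfderiv
  have h4 : g ∘ Q.proj = fun q ↦ B (α.sec Y q) (α.sec Z q) := funext hg
  rw [h4, h1.mfderiv] at h3
  have h5 : ∀ w : E_M, (mfderiv 𝓘(ℝ, E_M) 𝓘(ℝ, ℝ) g (Q.proj p) : E_M →L[ℝ] ℝ) w =
      B (α.iso p (α.cov Y (Q.proj p) w)) (α.sec Z p) +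
        B (α.sec Y p) (α.iso p (α.cov Z (Q.proj p) w)) := by
    intro w
    refine (congrArg (mfderiv 𝓘(ℝ, E_M) 𝓘(ℝ, ℝ) g (Q.proj p) : E_M →L[ℝ] ℝ)
      (dpr_hor A p w).symm).trans ((DFunLike.congr_fun h3 (hor A p w)).symm.trans ?_)
    refine Eq.trans ?_ (congrArg₂ (fun a b ↦ B a (α.sec Z p) + B (α.sec Y p) b)
      (α.iso_cov hbr hY' w).symm (α.iso_cov hbr hZ' w).symm)
    exact add_comm _ _
  exact (h5 v).trans (congrArg₂ (fun a b : ℝ ↦ a + b) (α.inducedMetric_eq hB p _ _).symm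
    (α.inducedMetric_eq hB p _ _).symm)

/-- A general form of the theorem for a structure group whose Lie algebra has constant sectional
curvature. -/
theorem hasConstantSectionalCurvature (α : TensorialIso A) (hbr : IsAdBracket K br)
    (hJ : IsIntegrable α.almostComplex)
    (hB : ∀ (k : K) X Y, B (adCLM E_K k X) (adCLM E_K k Y) = B X Y)
    (hsymm : ∀ X Y, B X Y = B Y X) (hpos : ∀ X, X ≠ 0 → 0 < B X X) {κ : ℝ}
    (hκ : ∀ X Y, B (br (br X Y) Y) X = κ * (B X X * B Y Y - B X Y ^ 2)) :
    HasConstantSectionalCurvature (α.inducedMetric fun X Y ↦ B X Y) κ := by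
  refine ⟨α.covariantDerivative hbr, ⟨⟨⟨fun hY ↦ ?_⟩⟩, α.torsion_covariantDerivative hbr hJ,
    fun Y Z hY hZ x v ↦ α.metric_covariantDerivative hbr hB hY hZ x v⟩, fun X Y hX hY x hli ↦ ?_⟩
  · exact (α.contMDiff_cov hbr (contMDiffOn_univ.1 hY)).contMDiffOn
  · obtain ⟨p, rfl⟩ := Q.proj_surjective x
    have h1 : ∀ U V : ∀ x : M, TangentSpace 𝓘(ℝ, E_M) x,
        α.inducedMetric (fun X Y ↦ B X Y) (Q.proj p) (U (Q.proj p)) (V (Q.proj p)) =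
          B (α.sec U p) (α.sec V p) := fun U V ↦ α.inducedMetric_eq hB p _ _
    rw [h1, h1, h1, h1, α.sec_curvature hbr hJ hX hY hY, hκ]
    refine mul_div_cancel_right₀ _ (ne_of_gt ?_)
    have hY0 : α.sec Y p ≠ 0 := fun h ↦ hli.ne_zero 1 ((map_eq_zero_iff _ (α.iso p).injective).1 h)
    have hYp := hpos _ hY0
    -- Strict Cauchy-Schwarz: `W = B(Y,Y) X - B(X,Y) Y` is nonzero by linear independence, and
    -- `B(W,W)` is `B(Y,Y)` times the denominator of the sectional curvature.
    have hW : B (α.sec Y p) (α.sec Y p) • α.sec X p - B (α.sec X p) (α.sec Y p) • α.sec Y p ≠ 0 := by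
      intro h
      have h2 : (B (α.sec Y p) (α.sec Y p) • X (Q.proj p) +
          (-B (α.sec X p) (α.sec Y p)) • Y (Q.proj p) : E_M) = 0 := by
        have h5 : ∀ (a b : ℝ) (u w : E_M), α.iso p (a • u + (-b) • w) = a • α.iso p u - b • α.iso p w :=
          fun a b u w ↦ by simp [sub_eq_add_neg]
        exact (α.iso p).injective ((h5 _ _ _ _).trans (h.trans (map_zero (α.iso p)).symm))
      exact hYp.ne' (LinearIndependent.pair_iff.1 hli _ _ h2).1
    have h3 := hpos _ hW
    simp only [map_sub, map_smul, sub_apply, smul_apply,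
      smul_eq_mul, hsymm (α.sec Y p) (α.sec X p)] at h3
    have h4 : 0 < B (α.sec Y p) (α.sec Y p) * (B (α.sec X p) (α.sec X p) * B (α.sec Y p) (α.sec Y p) -
        B (α.sec X p) (α.sec Y p) ^ 2) := by
      refine h3.trans_eq ?_
      ring
    exact (mul_pos_iff_of_pos_left hYp).1 h4

end TensorialIso

end SmoothPrincipalBundle

end SectionalCurvature

/-! ### The bracket of a linear group as a matrix commutator. -/

section LinearGroups

variable {E_K : Type*} [NormedAddCommGroup E_K] [NormedSpace ℝ E_K] [FiniteDimensional ℝ E_K]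
  {K : Type*} [TopologicalSpace K] [ChartedSpace E_K K] [Group K] [LieGroup 𝓘(ℝ, E_K) ∞ K]
  {R : Type*} [NormedRing R] [NormedAlgebra ℝ R] [CompleteSpace R]
  {ι : K →* R} {T : E_K →L[ℝ] R}

/-- Chain rule at `1` for `ι(k h k⁻¹) = ι(k) ι(h) ι(k⁻¹)`, whose right side is linear in `ι(h)`. -/
theorem map_adCLM (hT : HasMFDerivAt 𝓘(ℝ, E_K) 𝓘(ℝ, R) ι 1 T) (k : K) (X : E_K) :
    T (adCLM E_K k X) = ι k * T X * ι k⁻¹ := by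
  have hk : ContMDiff 𝓘(ℝ, E_K) 𝓘(ℝ, E_K) ∞ fun h : K ↦ k * h * k⁻¹ :=
    (contMDiff_mul_right (a := k⁻¹)).comp (contMDiff_mul_left (a := k))
  have h1 : HasMFDerivAt 𝓘(ℝ, E_K) 𝓘(ℝ, R) ι (k * 1 * k⁻¹) T := by
    rwa [mul_one, mul_inv_cancel]
  have h2 := (h1.comp (1 : K) (f := fun h : K ↦ k * h * k⁻¹)
    ((hk 1).mdifferentiableAt (by simp)).hasMFDerivAt).mfderiv
  have h3 : ι ∘ (fun h : K ↦ k * h * k⁻¹) =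
      ContinuousLinearMap.mulLeftRight ℝ R (ι k) (ι k⁻¹) ∘ ι := funext fun h ↦ by simp
  rw [h3, ((ContinuousLinearMap.mulLeftRight ℝ R (ι k) (ι k⁻¹)).hasMFDerivAt.comp (1 : K) hT).mfderiv] at h2
  exact (DFunLike.congr_fun h2 X).symm

/-- The commutator of matrices is the bracket of a linear group. -/
theorem isAdBracket_of_map (hT : HasMFDerivAt 𝓘(ℝ, E_K) 𝓘(ℝ, R) ι 1 T) {S : R →L[ℝ] E_K} (hS : ∀ X, S (T X) = X)
    {br : E_K →L[ℝ] E_K →L[ℝ] E_K} (hbr : ∀ X Y, T (br X Y) = T X * T Y - T Y * T X) :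
    IsAdBracket K br := by
  have hinj : Function.Injective T := Function.LeftInverse.injective hS
  refine ⟨fun X Y ↦ hinj ?_, fun X Y Z ↦ hinj ?_, ?_⟩
  · rw [map_neg, hbr, hbr, neg_sub]
  · simp only [map_sub, hbr]
    noncomm_ring
  · let L : (R →L[ℝ] R) →L[ℝ] (E_K →L[ℝ] E_K) := (T.precomp E_K).comp (S.postcomp R)
    have h1 : (fun k : K ↦ adCLM E_K k⁻¹) =
        fun k : K ↦ L (ContinuousLinearMap.mulLeftRight ℝ R (Ring.inverse (ι k)) (ι k)) := by
      funext k
      ext X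
      apply hinj
      have h2 := map_adCLM hT k⁻¹ X
      rw [inv_inv, IsCayleyPair.map_inv_eq] at h2
      rw [h2]
      change _ = T (S (Ring.inverse (ι k) * T X * ι k))
      rw [← h2, hS]
    have h3 : HasMFDerivAt 𝓘(ℝ, E_K) 𝓘(ℝ, R) (fun k : K ↦ Ring.inverse (ι k)) 1 (-T : E_K →L[ℝ] R) := by
      have h4 := hasFDerivAt_ringInverse (𝕜 := ℝ) (1 : Rˣ)
      have h5 : HasFDerivAt Ring.inverse (-ContinuousLinearMap.id ℝ R) (ι 1) := by
        rw [map_one]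
        refine h4.congr_fderiv ?_
        ext; simp
      exact (h5.hasMFDerivAt.comp (1 : K) hT)
    have h6 := L.hasMFDerivAt.comp (1 : K)
      (HasMFDerivAt.bilinear (ContinuousLinearMap.mulLeftRight ℝ R) h3 hT)
    rw [h1]
    refine h6.congr_mfderiv ?_
    refine ContinuousLinearMap.ext fun v : E_K ↦ ContinuousLinearMap.ext fun X : E_K ↦ hinj ?_
    change T (S (Ring.inverse (ι 1) * T X * T v + -T v * T X * ι 1)) = T (-br v X)
    have h7 : Ring.inverse (ι 1) * T X * T v + -T v * T X * ι 1 = T (-br v X) := by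
      rw [map_neg, hbr, map_one, Ring.inverse_one]
      noncomm_ring
    rw [h7, hS]

/-- The bracket is the commutator in `R` carried back by a left inverse of `T`; `hcomm` ensures that
commutators lie in the range of `T`, so nothing is lost. -/
theorem exists_isAdBracket [FiniteDimensional ℝ R] (hT : HasMFDerivAt 𝓘(ℝ, E_K) 𝓘(ℝ, R) ι 1 T) (hinj : Function.Injective T)
    (hcomm : ∀ X Y, ∃ Z, T Z = T X * T Y - T Y * T X) :
    ∃ br : E_K →L[ℝ] E_K →L[ℝ] E_K, IsAdBracket K br ∧
      ∀ X Y, T (br X Y) = T X * T Y - T Y * T X := by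
  obtain ⟨S', hS'⟩ := T.toLinearMap.exists_leftInverse_of_injective (LinearMap.ker_eq_bot.2 hinj)
  let S : R →L[ℝ] E_K := S'.toContinuousLinearMap
  have hS : ∀ X, S (T X) = X := LinearMap.congr_fun hS'
  let m : R →L[ℝ] R →L[ℝ] R := ContinuousLinearMap.mul ℝ R - (ContinuousLinearMap.mul ℝ R).flip
  let br : E_K →L[ℝ] E_K →L[ℝ] E_K :=
    ((T.precomp E_K).comp (S.postcomp R)).comp (m.comp T)
  have h : ∀ X Y, T (br X Y) = T X * T Y - T Y * T X := by
    intro X Y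
    obtain ⟨Z, hZ⟩ := hcomm X Y
    change T (S (T X * T Y - T Y * T X)) = _
    rw [← hZ, hS]
  exact ⟨br, isAdBracket_of_map hT hS h, h⟩

namespace IsCayleyPair

variable {G : Type*} [Group G] [TopologicalSpace G] [FiniteDimensional ℝ R] {j : G →* R} {𝔤 : Submodule ℝ R}

theorem hasMFDerivAt_map (hS : IsCayleyPair j 𝔤) :
    letI := hS.chartedSpace
    HasMFDerivAt 𝓘(ℝ, 𝔤) 𝓘(ℝ, R) j 1 ((-2 : ℝ) • 𝔤.subtypeL : 𝔤 →L[ℝ] R) := by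
  let _ := hS.chartedSpace
  refine (((hS.contMDiff_map 1).mdifferentiableAt (by simp)).hasMFDerivAt).congr_mfderiv ?_
  exact ContinuousLinearMap.ext fun X ↦ hS.derivAtOne_map X

theorem derivAtOne_adCLM (hS : IsCayleyPair j 𝔤) (k : G) (X : 𝔤) :
    letI := hS.chartedSpace
    derivAtOne (E := 𝔤) (K := G) j (adCLM 𝔤 k X) =
      j k * derivAtOne (E := 𝔤) (K := G) j X * j k⁻¹ := by
  let _ := hS.chartedSpace
  have := hS.lieGroup
  have h : ∀ X : 𝔤, derivAtOne (E := 𝔤) (K := G) j X = ((-2 : ℝ) • 𝔤.subtypeL : 𝔤 →L[ℝ] R) X :=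
    hS.derivAtOne_map
  exact (h _).trans ((map_adCLM hS.hasMFDerivAt_map k X).trans
    (congrArg (fun t ↦ j k * t * j k⁻¹) (h X).symm))

theorem exists_isAdBracket (hS : IsCayleyPair j 𝔤) (hcomm : ∀ x ∈ 𝔤, ∀ y ∈ 𝔤, x * y - y * x ∈ 𝔤) :
    letI := hS.chartedSpace
    letI := hS.lieGroup
    ∃ br : 𝔤 →L[ℝ] 𝔤 →L[ℝ] 𝔤, IsAdBracket G br ∧
      ∀ X Y, derivAtOne (E := 𝔤) (K := G) j (br X Y) =
        derivAtOne (E := 𝔤) (K := G) j X * derivAtOne (E := 𝔤) (K := G) j Y -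
          derivAtOne (E := 𝔤) (K := G) j Y * derivAtOne (E := 𝔤) (K := G) j X := by
  let _ := hS.chartedSpace
  have := hS.lieGroup
  have h : ∀ X : 𝔤, derivAtOne (E := 𝔤) (K := G) j X = ((-2 : ℝ) • 𝔤.subtypeL : 𝔤 →L[ℝ] R) X :=
    hS.derivAtOne_map
  obtain ⟨br, h1, h2⟩ := _root_.exists_isAdBracket hS.hasMFDerivAt_map
    (fun X Y hXY ↦ Subtype.ext (smul_right_injective R (by norm_num : (-2 : ℝ) ≠ 0) hXY))
    -- In the Cayley chart `T = -2 · inclusion`, so `T X T Y - T Y T X = 4(XY - YX)`, which is `T`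
    -- of `-2(XY - YX)`.
    (fun X Y ↦ ⟨(-2 : ℝ) • ⟨_, hcomm X X.2 Y Y.2⟩, by simp [smul_sub, smul_smul]; abel⟩)
  refine ⟨br, h1, fun X Y ↦ ?_⟩
  rw [h, h X, h Y]
  exact h2 X Y

end IsCayleyPair

end LinearGroups

/-! ### Trace forms and the double bracket on `𝔰𝔲(2)` and `𝔰𝔬(3)`. -/

section TraceInner

variable {n : ℕ} {𝕜 : Type*} [RCLike 𝕜]

theorem traceInner_eq_sum (X Y : Matrix (Fin n) (Fin n) 𝕜) :
    traceInner X Y = ∑ i, ∑ j, RCLike.re (X i j * star (Y i j)) := by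
  simp only [traceInner, Matrix.trace, Matrix.diag_apply, Matrix.mul_apply, map_sum,
    Matrix.conjTranspose_apply]

theorem traceInner_comm (X Y : Matrix (Fin n) (Fin n) 𝕜) : traceInner X Y = traceInner Y X := by
  rw [traceInner, traceInner, ← RCLike.conj_re, starRingEnd_apply, ← Matrix.trace_conjTranspose]
  simp

theorem traceInner_self_pos {X : Matrix (Fin n) (Fin n) 𝕜} (hX : X ≠ 0) : 0 < traceInner X X := by
  have h : traceInner X X = ∑ i, ∑ j, ‖X i j‖ ^ 2 := by
    simp [traceInner, Matrix.trace, Matrix.mul_apply, RCLike.mul_conj]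
  rw [h]
  refine lt_of_le_of_ne (by positivity) fun h0 ↦ hX ?_
  ext i j
  have h1 := (Finset.sum_eq_zero_iff_of_nonneg (fun i _ ↦ by positivity)).1 h0.symm i (Finset.mem_univ _)
  have h2 := (Finset.sum_eq_zero_iff_of_nonneg (fun i _ ↦ by positivity)).1 h1 j (Finset.mem_univ _)
  simpa using h2

theorem traceInner_conj {g h : Matrix (Fin n) (Fin n) 𝕜} (hg : gᴴ = h) (hgh : h * g = 1)
    (X Y : Matrix (Fin n) (Fin n) 𝕜) : traceInner (g * X * h) (g * Y * h) = traceInner X Y := by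
  subst hg
  simp only [traceInner, Matrix.conjTranspose_mul, Matrix.conjTranspose_conjTranspose]
  have e : g * X * gᴴ * (g * (Yᴴ * gᴴ)) = g * (X * Yᴴ * gᴴ) := by
    rw [Matrix.mul_assoc (g * X), ← Matrix.mul_assoc gᴴ g, hgh, Matrix.one_mul]
    simp only [Matrix.mul_assoc]
  rw [e, Matrix.trace_mul_comm,
    Matrix.mul_assoc, hgh, Matrix.mul_one]

/-- `traceInner` as a bilinear map. -/
def traceInnerLM (n : ℕ) (𝕜 : Type*) [RCLike 𝕜] :
    Matrix (Fin n) (Fin n) 𝕜 →ₗ[ℝ] Matrix (Fin n) (Fin n) 𝕜 →ₗ[ℝ] ℝ :=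
  LinearMap.mk₂ ℝ traceInner
    (fun X X' Y ↦ by simp [traceInner, add_mul])
    (fun c X Y ↦ by simp [traceInner, RCLike.smul_re])
    (fun X Y Y' ↦ by simp [traceInner, mul_add])
    (fun c X Y ↦ by simp [traceInner, RCLike.smul_re])

/-- In the basis `iσ₁, iσ₂, iσ₃` the trace form is twice the Euclidean one and the commutator is
`-2` times the cross product. The left side is `-|[X, Y]|² = -8 |x × y|²`, while the Gram
determinant is `4 |x × y|²` by Lagrange's identity. In the coordinates `a, b, c` this is a
polynomial identity. -/
theorem traceInner_commutator_su2 {X Y : Matrix (Fin 2) (Fin 2) ℂ} (hX : X ∈ specialUnitaryAlgebra 2 ℂ)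
    (hY : Y ∈ specialUnitaryAlgebra 2 ℂ) :
    traceInner ((X * Y - Y * X) * Y - Y * (X * Y - Y * X)) X =
      -2 * (traceInner X X * traceInner Y Y - traceInner X Y ^ 2) := by
  have key : ∀ {X : Matrix (Fin 2) (Fin 2) ℂ}, X ∈ specialUnitaryAlgebra 2 ℂ →
      ∃ a b c : ℝ, X = !![⟨0, a⟩, ⟨b, c⟩; ⟨-b, c⟩, ⟨0, -a⟩] := by
    rintro X ⟨h1, h2⟩
    have h3 (i j) := congrFun (congrFun h1 i) j
    have h00 := h3 0 0
    have h10 := h3 1 0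
    rw [Matrix.trace_fin_two] at h2
    simp [Complex.ext_iff] at h00 h10 h2
    refine ⟨(X 0 0).im, (X 0 1).re, (X 0 1).im, ?_⟩
    ext i j
    fin_cases i <;> fin_cases j <;> apply Complex.ext <;> simp <;> linarith
  obtain ⟨a, b, c, rfl⟩ := key hX
  obtain ⟨a', b', c', rfl⟩ := key hY
  simp only [traceInner_eq_sum, Matrix.sub_apply, Matrix.mul_apply, Fin.sum_univ_two]
  simp
  ring

theorem so3ToSu2_mem (X : Matrix (Fin 3) (Fin 3) ℝ) : so3ToSu2 X ∈ specialUnitaryAlgebra 2 ℂ := by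
  constructor
  · ext i j
    fin_cases i <;> fin_cases j <;> apply Complex.ext <;> simp [so3ToSu2] <;> ring
  · simp [so3ToSu2, Matrix.trace_fin_two]

/-- The factor is read off on a basis vector: the cross product matrix of a unit vector has square
norm `2`, and its image, such as `-(i/2) σ₁`, has square norm `1/2`. -/
theorem traceInner_so3ToSu2 {X Y : Matrix (Fin 3) (Fin 3) ℝ} (hX : X ∈ specialUnitaryAlgebra 3 ℝ)
    (hY : Y ∈ specialUnitaryAlgebra 3 ℝ) :
    traceInner (so3ToSu2 X) (so3ToSu2 Y) = 1 / 4 * traceInner X Y := by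
  have hX' (i j) : X j i = -X i j := by simpa using congrFun (congrFun hX.1 i) j
  have hY' (i j) : Y j i = -Y i j := by simpa using congrFun (congrFun hY.1 i) j
  have hX0 (i) : X i i = 0 := by linarith [hX' i i]
  have hY0 (i) : Y i i = 0 := by linarith [hY' i i]
  simp [traceInner_eq_sum, so3ToSu2, Fin.sum_univ_succ, hX0, hY0, hX' 0 1,
    hX' 0 2, hX' 1 2, hY' 0 1, hY' 0 2, hY' 1 2]
  ring

theorem commutator_mem_specialUnitaryAlgebra {X Y : Matrix (Fin n) (Fin n) 𝕜}
    (hX : X ∈ specialUnitaryAlgebra n 𝕜) (hY : Y ∈ specialUnitaryAlgebra n 𝕜) :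
    X * Y - Y * X ∈ specialUnitaryAlgebra n 𝕜 := by
  refine ⟨?_, by rw [Matrix.trace_sub, Matrix.trace_mul_comm, sub_self]⟩
  rw [Matrix.conjTranspose_sub, Matrix.conjTranspose_mul, Matrix.conjTranspose_mul, hX.1, hY.1]
  simp

end TraceInner

/-! ### The groups `SU(2)` and `SO(3)`. -/

section ConcreteGroups

instance : FiniteDimensional ℝ SU2Model :=
  inferInstanceAs (FiniteDimensional ℝ (specialUnitaryAlgebra 2 ℂ))

instance : FiniteDimensional ℝ SO3Model :=
  inferInstanceAs (FiniteDimensional ℝ (specialUnitaryAlgebra 3 ℝ))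

/-- `SU2.toMatrix` as a linear map. -/
def SU2.toMatrixLM : SU2Model →ₗ[ℝ] Matrix (Fin 2) (Fin 2) ℂ where
  toFun := SU2.toMatrix
  map_add' X Y := (SU2.toMatrix_eq _).trans <| (smul_add (-2 : ℝ) _ _).trans <|
    congrArg₂ (· + ·) (SU2.toMatrix_eq X).symm (SU2.toMatrix_eq Y).symm
  map_smul' c X := (SU2.toMatrix_eq _).trans <| (smul_comm (-2 : ℝ) c _).trans <|
    congrArg (c • ·) (SU2.toMatrix_eq X).symm

theorem SU2.toMatrix_mem (X : SU2Model) : SU2.toMatrix X ∈ specialUnitaryAlgebra 2 ℂ := by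
  rw [show SU2.toMatrix X = _ from SU2.toMatrix_eq X]
  exact Submodule.smul_mem _ _ (Subtype.prop _)

theorem SU2.toMatrix_ne_zero {X : SU2Model} (hX : X ≠ 0) : SU2.toMatrix X ≠ 0 := fun h ↦
  hX <| Subtype.ext <| (smul_eq_zero_iff_right (by norm_num)).1 ((SU2.toMatrix_eq X).symm.trans h)

theorem SU2.exists_isAdBracket : ∃ br : SU2Model →L[ℝ] SU2Model →L[ℝ] SU2Model,
    IsAdBracket SU2 br ∧ ∀ X Y, SU2.toMatrix (br X Y) =
      SU2.toMatrix X * SU2.toMatrix Y - SU2.toMatrix Y * SU2.toMatrix X :=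
  isCayleyPair_SU2.exists_isAdBracket fun _ hx _ hy ↦ commutator_mem_specialUnitaryAlgebra hx hy

/-- `SU2.traceForm` as a continuous bilinear map. -/
def SU2.traceFormCLM : SU2Model →L[ℝ] SU2Model →L[ℝ] ℝ :=
  ((traceInnerLM 2 ℂ).compl₁₂ SU2.toMatrixLM SU2.toMatrixLM).toContinuousBilinearMap

theorem SU2.traceFormCLM_apply (X Y : SU2Model) :
    SU2.traceFormCLM X Y = traceInner (SU2.toMatrix X) (SU2.toMatrix Y) := rfl

theorem SU2.toMatrix_ad (k : SU2) (X : SU2Model) : SU2.toMatrix (adCLM SU2Model k X) =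
    (k : Matrix (Fin 2) (Fin 2) ℂ) * SU2.toMatrix X * (k⁻¹ : SU2) :=
  isCayleyPair_SU2.derivAtOne_adCLM k X

theorem SU2.traceFormCLM_ad (k : SU2) (X Y : SU2Model) :
    SU2.traceFormCLM (adCLM SU2Model k X) (adCLM SU2Model k Y) = SU2.traceFormCLM X Y := by
  rw [traceFormCLM_apply, traceFormCLM_apply, SU2.toMatrix_ad, SU2.toMatrix_ad]
  exact traceInner_conj rfl (congrArg Subtype.val (inv_mul_cancel k)) _ _

/-- `SO3.toMatrix` as a linear map. -/
def SO3.toMatrixLM : SO3Model →ₗ[ℝ] Matrix (Fin 3) (Fin 3) ℝ where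
  toFun := SO3.toMatrix
  map_add' X Y := (SO3.toMatrix_eq _).trans <| (smul_add (-2 : ℝ) _ _).trans <|
    congrArg₂ (· + ·) (SO3.toMatrix_eq X).symm (SO3.toMatrix_eq Y).symm
  map_smul' c X := (SO3.toMatrix_eq _).trans <| (smul_comm (-2 : ℝ) c _).trans <|
    congrArg (c • ·) (SO3.toMatrix_eq X).symm

theorem SO3.toMatrix_mem (X : SO3Model) : SO3.toMatrix X ∈ specialUnitaryAlgebra 3 ℝ := by
  rw [show SO3.toMatrix X = _ from SO3.toMatrix_eq X]
  exact Submodule.smul_mem _ _ (Subtype.prop _)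

theorem SO3.toMatrix_ne_zero {X : SO3Model} (hX : X ≠ 0) : SO3.toMatrix X ≠ 0 := fun h ↦
  hX <| Subtype.ext <| (smul_eq_zero_iff_right (by norm_num)).1 ((SO3.toMatrix_eq X).symm.trans h)

theorem SO3.exists_isAdBracket : ∃ br : SO3Model →L[ℝ] SO3Model →L[ℝ] SO3Model,
    IsAdBracket SO3 br ∧ ∀ X Y, SO3.toMatrix (br X Y) =
      SO3.toMatrix X * SO3.toMatrix Y - SO3.toMatrix Y * SO3.toMatrix X :=
  isCayleyPair_SO3.exists_isAdBracket fun _ hx _ hy ↦ commutator_mem_specialUnitaryAlgebra hx hy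

/-- `SO3.traceForm` as a continuous bilinear map. -/
def SO3.traceFormCLM : SO3Model →L[ℝ] SO3Model →L[ℝ] ℝ :=
  ((traceInnerLM 3 ℝ).compl₁₂ SO3.toMatrixLM SO3.toMatrixLM).toContinuousBilinearMap

theorem SO3.traceFormCLM_apply (X Y : SO3Model) :
    SO3.traceFormCLM X Y = traceInner (SO3.toMatrix X) (SO3.toMatrix Y) := rfl

theorem SO3.toMatrix_ad (k : SO3) (X : SO3Model) : SO3.toMatrix (adCLM SO3Model k X) =
    (k : Matrix (Fin 3) (Fin 3) ℝ) * SO3.toMatrix X * (k⁻¹ : SO3) :=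
  isCayleyPair_SO3.derivAtOne_adCLM k X

theorem SO3.traceFormCLM_ad (k : SO3) (X Y : SO3Model) :
    SO3.traceFormCLM (adCLM SO3Model k X) (adCLM SO3Model k Y) = SO3.traceFormCLM X Y := by
  rw [traceFormCLM_apply, traceFormCLM_apply, SO3.toMatrix_ad, SO3.toMatrix_ad]
  exact traceInner_conj (Matrix.conjTranspose_eq_transpose_of_trivial _) (congrArg Subtype.val (inv_mul_cancel k)) _ _

/-- The computation is moved to `𝔰𝔲(2)` by the Lie algebra homomorphism `so3ToSu2`. Since the form
on `𝔰𝔬(3)` is 4 times the one on `𝔰𝔲(2)`, the double bracket term scales by 4 and the Gram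
determinant by 16, so `-2` becomes `-1/2`. -/
theorem SO3.traceForm_double_bracket {br : SO3Model →L[ℝ] SO3Model →L[ℝ] SO3Model}
    (hbr : ∀ X Y, SO3.toMatrix (br X Y) =
      SO3.toMatrix X * SO3.toMatrix Y - SO3.toMatrix Y * SO3.toMatrix X) (X Y : SO3Model) :
    SO3.traceFormCLM (br (br X Y) Y) X = -(1 / 2) *
      (SO3.traceFormCLM X X * SO3.traceFormCLM Y Y - SO3.traceFormCLM X Y ^ 2) := by
  have hm := SO3.toMatrix_mem
  have h4 : ∀ X Y, SO3.traceFormCLM X Y =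
      4 * traceInner (so3ToSu2 (SO3.toMatrix X)) (so3ToSu2 (SO3.toMatrix Y)) := by
    intro X Y
    rw [traceInner_so3ToSu2 (hm X) (hm Y), SO3.traceFormCLM_apply]
    ring
  rw [h4, h4, h4, h4, hbr, so3ToSu2_lie (hm _) (hm _), hbr, so3ToSu2_lie (hm _) (hm _),
    traceInner_commutator_su2 (so3ToSu2_mem _) (so3ToSu2_mem _)]
  ring

end ConcreteGroups

end

theorem theorem2p3
    {E_M : Type*} [NormedAddCommGroup E_M] [NormedSpace ℝ E_M] [FiniteDimensional ℝ E_M]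
    {M : Type*} [TopologicalSpace M] [T2Space M] [ChartedSpace E_M M] [IsManifold 𝓘(ℝ, E_M) ∞ M]
    {E_P : Type*} [NormedAddCommGroup E_P] [NormedSpace ℝ E_P] [FiniteDimensional ℝ E_P]
    {P : Type*} [TopologicalSpace P] [T2Space P] [ChartedSpace E_P P]
    [IsManifold 𝓘(ℝ, E_P) ∞ P] :
    (∀ (Q : SmoothPrincipalBundle SU2Model SU2 E_P P E_M M) (A : Q.Connection)
      (α : SmoothPrincipalBundle.TensorialIso A), IsIntegrable α.almostComplex →
        HasConstantSectionalCurvature (α.inducedMetric SU2.traceForm) (-2)) ∧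
    (∀ (Q : SmoothPrincipalBundle SO3Model SO3 E_P P E_M M) (A : Q.Connection)
      (α : SmoothPrincipalBundle.TensorialIso A), IsIntegrable α.almostComplex →
        HasConstantSectionalCurvature (α.inducedMetric SO3.su2TraceForm) (-2) ∧
        HasConstantSectionalCurvature (α.inducedMetric SO3.traceForm) (-(1 / 2))) := by
  refine ⟨fun Q A α hJ ↦ ?_, fun Q A α hJ ↦ ?_⟩
  · obtain ⟨br, hbr, hc⟩ := SU2.exists_isAdBracket
    refine α.hasConstantSectionalCurvature (B := SU2.traceFormCLM) hbr hJ SU2.traceFormCLM_ad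
      (fun X Y ↦ traceInner_comm (SU2.toMatrix X) (SU2.toMatrix Y))
      (fun X hX ↦ traceInner_self_pos (SU2.toMatrix_ne_zero hX)) fun X Y ↦ ?_
    · simp only [SU2.traceFormCLM_apply, hc]
      exact traceInner_commutator_su2 (SU2.toMatrix_mem X) (SU2.toMatrix_mem Y)
  · obtain ⟨br, hbr, hc⟩ := SO3.exists_isAdBracket
    have hpos : ∀ X : SO3Model, X ≠ 0 → 0 < SO3.traceFormCLM X X := fun X hX ↦
      traceInner_self_pos (SO3.toMatrix_ne_zero hX)
    refine ⟨?_, α.hasConstantSectionalCurvature (B := SO3.traceFormCLM) hbr hJ SO3.traceFormCLM_ad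
      (fun X Y ↦ traceInner_comm (SO3.toMatrix X) (SO3.toMatrix Y)) hpos (SO3.traceForm_double_bracket hc)⟩
    -- The transported form is a quarter of the trace form on `𝔰𝔬(3)`; scaling the form by `1/4`
    -- multiplies the constant by 4, from `-1/2` to `-2`.
    have he : SO3.su2TraceForm = fun X Y ↦ ((1 / 4 : ℝ) • SO3.traceFormCLM) X Y := by
      funext X Y
      exact traceInner_so3ToSu2 (SO3.toMatrix_mem X) (SO3.toMatrix_mem Y)
    rw [he]
    refine α.hasConstantSectionalCurvature (B := (1 / 4 : ℝ) • SO3.traceFormCLM) hbr hJ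
      (fun k X Y ↦ congrArg ((1 / 4 : ℝ) * ·) (SO3.traceFormCLM_ad k X Y))
      (fun X Y ↦ congrArg ((1 / 4 : ℝ) * ·) (traceInner_comm (SO3.toMatrix X) (SO3.toMatrix Y)))
      (fun X hX ↦ mul_pos (by norm_num) (hpos X hX)) fun X Y ↦ ?_
    simp only [smul_apply, smul_eq_mul]
    rw [SO3.traceForm_double_bracket hc]
    ring
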